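/- Let $K$ be an algebraically closed field of characteristic $0$ and let $m,n,k$ be integers with $m\ge n$ and $0\le k\le n-1$. Let $\mathbb{P}^{mn-1}$ be the projective space of nonzero $m\times n$ matrices over $K$ up to scalars, and let $G(k,n)$ be the Grassmannian of $k$-dimensional subspaces of $K^n$. Put $$\tau_{m,n,k}=\{\varphi\in\mathbb{P}^{mn-1} : \dim\ker\varphi\ge k\},\qquad \hat\tau_{m,n,k}=\{(\Lambda,\varphi)\in G(k,n)\times\mathbb{P}^{mn-1} : \varphi\in\tau_{m,n,k},\ \Lambda\subseteq\ker\varphi\},$$ and let $\rho\colon\hat\tau_{m,n,k}\to G(k,n)$ and $\nu\colon\hat\tau_{m,n,k}\to\tau_{m,n,k}$ be the projections $(\Lambda,\varphi)\mapsto\Lambda$ and $(\Lambda,\varphi)\mapsto\varphi$. Let $Q$ be the universal quotient bundle on $G(k,n)$, with fibre $K^n/\Lambda$ at $\Lambda$, let $Q^{\vee m}$ be the direct sum of $m$ copies of its dual, and let $\mathbb{P}(Q^{\vee m})$ be the projective bundle of lines in its fibres. Then $\tau_{m,n,k}\subseteq\mathbb{P}^{mn-1}$ and $\hat\tau_{m,n,k}\subseteq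 G(k,n)\times\mathbb{P}^{mn-1}$ are closed, and with their induced structures of algebraic varieties the following hold. 1. There is an isomorphism $\hat\tau_{m,n,k}\cong\mathbb{P}(Q^{\vee m})$ of varieties over $G(k,n)$, that is, compatible with $\rho$ and the bundle projection. 2. $\hat\tau_{m,n,k}$ is smooth. 3. $\nu$ is a birational morphism. 4. $\nu$ is a resolution of singularities of $\tau_{m,n,k}$: $\hat\tau_{m,n,k}$ and $\tau_{m,n,k}$ are (irreducible, separated) varieties, $\hat\tau_{m,n,k}$ is smooth, and $\nu$ is proper and birational. -/

import Mathlib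

open Filter Topology
open scoped LinearAlgebra.Projectivization

universe u

/-- A space with functions over a field `K`: a topological space with a sheaf of `K`-algebras of
`K`-valued functions. The sheaf is recorded through its germs: `RegAt f p` says that the function
`f` is regular on some neighbourhood of `p` (the values of `f` far from `p` do not matter). -/
structure SpaceWithFunctions (K : Type u) [Field K] where
  carrier : Type u
  top : TopologicalSpace carrier
  RegAt : (carrier → K) → carrier → Prop
  regAt_const : ∀ (c : K) (p : carrier), RegAt (fun _ => c) p
  regAt_add : ∀ f g p, RegAt f p → RegAt g p → RegAt (f + g) p
  regAt_mul : ∀ f g p, RegAt f p → RegAt g p → RegAt (f * g) p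
  regAt_inv : ∀ f p, RegAt f p → f p ≠ 0 → RegAt f⁻¹ p
  regAt_congr : ∀ f g p, RegAt f p → f =ᶠ[𝓝 p] g → RegAt g p
  regAt_eventually : ∀ f p, RegAt f p → ∀ᶠ q in 𝓝 p, RegAt f q
  regAt_ne_zero : ∀ f p, RegAt f p → f p ≠ 0 → ∀ᶠ q in 𝓝 p, f q ≠ 0

namespace SpaceWithFunctions

variable {K : Type u} [Field K]

instance : CoeSort (SpaceWithFunctions K) (Type u) := ⟨carrier⟩

instance (X : SpaceWithFunctions K) : TopologicalSpace X := X.top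

/-- `f` is a regular function on the (open) set `U`. -/
def RegularOn (X : SpaceWithFunctions K) (f : X → K) (U : Set X) : Prop :=
  ∀ p ∈ U, X.RegAt f p

/-- A morphism: a continuous map that pulls regular functions back to regular functions. -/
def IsMorphism {X Y : SpaceWithFunctions K} (φ : X → Y) : Prop :=
  Continuous φ ∧ ∀ (f : Y → K) (p : X), Y.RegAt f (φ p) → X.RegAt (f ∘ φ) p

/-- A bijection that is a morphism in both directions. -/
def IsIsomorphism {X Y : SpaceWithFunctions K} (e : X ≃ Y) : Prop :=
  IsMorphism (X := X) (Y := Y) e ∧ IsMorphism (X := Y) (Y := X) e.symm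

/-- The local ring at `p`: germs at `p` of functions that are regular near `p`. -/
def localRing (X : SpaceWithFunctions K) (p : X) : Subring (Germ (𝓝 p) K) where
  carrier := {g | ∃ f : X → K, X.RegAt f p ∧ g = (f : Germ (𝓝 p) K)}
  one_mem' := ⟨fun _ => 1, X.regAt_const 1 p, rfl⟩
  zero_mem' := ⟨fun _ => 0, X.regAt_const 0 p, rfl⟩
  add_mem' := by
    rintro _ _ ⟨f, hf, rfl⟩ ⟨g, hg, rfl⟩
    exact ⟨f + g, X.regAt_add f g p hf hg, rfl⟩
  mul_mem' := by
    rintro _ _ ⟨f, hf, rfl⟩ ⟨g, hg, rfl⟩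
    exact ⟨f * g, X.regAt_mul f g p hf hg, rfl⟩
  neg_mem' := by
    rintro _ ⟨f, hf, rfl⟩
    refine ⟨(fun _ => -1) * f, X.regAt_mul _ f p (X.regAt_const (-1) p) hf, ?_⟩
    have h : (fun _ => (-1 : K)) * f = -f := by
      funext q
      simp
    rw [h]
    rfl

/-! ### Constructions -/

/-- The space with functions on `X` given by a family of sets `U i`, closed under pairwise
intersection and covering `X`, and of algebras `A i` of functions that restrict to each other:
the sets `{q ∈ U i | a q ≠ 0}` with `a ∈ A i` form a basis of the topology, and the regular
functions are locally the fractions `a / b` with `a, b ∈ A i` on `U i`. -/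
def ofFractions (X : Type u) {ι : Type u} (U : ι → Set X) (A : ι → Subalgebra K (X → K))
    (hcover : ∀ p, ∃ i, p ∈ U i)
    (hdir : ∀ i j, ∃ l, U l = U i ∩ U j ∧ A i ≤ A l ∧ A j ≤ A l) : SpaceWithFunctions K :=
  letI top : TopologicalSpace X := TopologicalSpace.generateFrom
    {S | ∃ i, ∃ a ∈ A i, S = {q | q ∈ U i ∧ a q ≠ 0}}
  have hnhds : ∀ i, ∀ a ∈ A i, ∀ p ∈ U i, a p ≠ 0 → ∀ᶠ q in 𝓝 p, q ∈ U i ∧ a q ≠ 0 :=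
    fun i a ha p hp h => IsOpen.mem_nhds
      (TopologicalSpace.isOpen_generateFrom_of_mem ⟨i, a, ha, rfl⟩) ⟨hp, h⟩
  { carrier := X
    top := top
    RegAt := fun f p => ∃ i, p ∈ U i ∧ ∃ a ∈ A i, ∃ b ∈ A i, b p ≠ 0 ∧ f =ᶠ[𝓝 p] a / b
    regAt_const := fun c p => by
      obtain ⟨i, hi⟩ := hcover p
      refine ⟨i, hi, algebraMap K (X → K) c, (A i).algebraMap_mem c, 1, (A i).one_mem, by simp, ?_⟩
      exact Eventually.of_forall fun q => by simp
    regAt_add := by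
      rintro f g p ⟨i, hi, a, ha, b, hb, hbp, hf⟩ ⟨j, hj, c, hc, d, hd, hdp, hg⟩
      obtain ⟨l, hU, h1, h2⟩ := hdir i j
      refine ⟨l, hU ▸ ⟨hi, hj⟩, a * d + c * b,
        add_mem (mul_mem (h1 ha) (h2 hd)) (mul_mem (h2 hc) (h1 hb)), b * d,
        mul_mem (h1 hb) (h2 hd), mul_ne_zero hbp hdp, ?_⟩
      filter_upwards [hf, hg, hnhds i b hb p hi hbp, hnhds j d hd p hj hdp] with q h3 h4 h5 h6
      have h5' := h5.2
      have h6' := h6.2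
      simp only [Pi.add_apply, Pi.mul_apply, Pi.div_apply] at *
      rw [h3, h4]
      field_simp
    regAt_mul := by
      rintro f g p ⟨i, hi, a, ha, b, hb, hbp, hf⟩ ⟨j, hj, c, hc, d, hd, hdp, hg⟩
      obtain ⟨l, hU, h1, h2⟩ := hdir i j
      refine ⟨l, hU ▸ ⟨hi, hj⟩, a * c, mul_mem (h1 ha) (h2 hc), b * d,
        mul_mem (h1 hb) (h2 hd), mul_ne_zero hbp hdp, ?_⟩
      filter_upwards [hf, hg] with q h3 h4
      simp only [Pi.mul_apply, Pi.div_apply] at *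
      rw [h3, h4, div_mul_div_comm]
    regAt_inv := by
      rintro f p ⟨i, hi, a, ha, b, hb, hbp, hf⟩ hfp
      refine ⟨i, hi, b, hb, a, ha, ?_, ?_⟩
      · intro h
        apply hfp
        rw [hf.self_of_nhds, Pi.div_apply, h, zero_div]
      · filter_upwards [hf] with q h3
        simp only [Pi.inv_apply, Pi.div_apply] at *
        rw [h3, inv_div]
    regAt_congr := by
      rintro f g p ⟨i, hi, a, ha, b, hb, hbp, hf⟩ hfg
      exact ⟨i, hi, a, ha, b, hb, hbp, hfg.symm.trans hf⟩
    regAt_eventually := by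
      rintro f p ⟨i, hi, a, ha, b, hb, hbp, hf⟩
      filter_upwards [hnhds i b hb p hi hbp, eventually_eventually_nhds.2 hf] with q h1 h2
      exact ⟨i, h1.1, a, ha, b, hb, h1.2, h2⟩
    regAt_ne_zero := by
      rintro f p ⟨i, hi, a, ha, b, hb, hbp, hf⟩ hfp
      have hap : a p ≠ 0 := by
        intro h
        apply hfp
        rw [hf.self_of_nhds, Pi.div_apply, h, zero_div]
      filter_upwards [hf, hnhds i a ha p hi hap, hnhds i b hb p hi hbp] with q h1 h2 h3
      rw [h1]
      exact div_ne_zero h2.2 h3.2 }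

/-- Polynomial functions on a vector space: the algebra generated by the linear forms. -/
def polynomialFunctions (K : Type u) [Field K] (V : Type u) [AddCommGroup V] [Module K V] :
    Subalgebra K (V → K) :=
  Algebra.adjoin K (Set.range fun l : Module.Dual K V => (l : V → K))

/-- A (finite-dimensional) vector space as an affine space: the Zariski topology, and regular
functions that are locally fractions of polynomial functions. -/
def affineSpace (K : Type u) [Field K] (V : Type u) [AddCommGroup V] [Module K V] :
    SpaceWithFunctions K :=
  ofFractions V (fun _ : PUnit => Set.univ) (fun _ => polynomialFunctions K V)
    (fun _ => ⟨PUnit.unit, Set.mem_univ _⟩)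
    (fun _ _ => ⟨PUnit.unit, (Set.inter_self _).symm, le_rfl, le_rfl⟩)

/-- The functions `∑ fᵢ(x) gᵢ(y)` with `fᵢ` regular on `U` and `gᵢ` regular on `V`. -/
def productFunctions (X Y : SpaceWithFunctions K) (U : Set X) (V : Set Y) :
    Subalgebra K (X × Y → K) :=
  Algebra.adjoin K ({h | ∃ f, X.RegularOn f U ∧ h = fun q => f q.1} ∪
    {h | ∃ g, Y.RegularOn g V ∧ h = fun q => g q.2})

theorem productFunctions_mono (X Y : SpaceWithFunctions K) {U U' : Set X} {V V' : Set Y}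
    (hU : U' ⊆ U) (hV : V' ⊆ V) :
    productFunctions X Y U V ≤ productFunctions X Y U' V' := by
  apply Algebra.adjoin_mono
  rintro h (⟨f, hf, rfl⟩ | ⟨g, hg, rfl⟩)
  · exact Or.inl ⟨f, fun p hp => hf p (hU hp), rfl⟩
  · exact Or.inr ⟨g, fun p hp => hg p (hV hp), rfl⟩

/-- The product of two spaces with functions. The topology is not the product topology: it has
the basis of sets `{(x, y) ∈ U × V | h(x, y) ≠ 0}` with `U`, `V` open and `h` a sum of products of
regular functions on `U` and `V`; the regular functions are locally fractions of such `h`. -/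
def prod (X Y : SpaceWithFunctions K) : SpaceWithFunctions K :=
  ofFractions (X × Y)
    (fun i : TopologicalSpace.Opens X × TopologicalSpace.Opens Y => (i.1 : Set X) ×ˢ (i.2 : Set Y))
    (fun i => productFunctions X Y i.1 i.2)
    (fun _ => ⟨(⊤, ⊤), by simp⟩)
    (fun i j => ⟨(i.1 ⊓ j.1, i.2 ⊓ j.2), by simp [Set.prod_inter_prod],
      productFunctions_mono X Y Set.inter_subset_left Set.inter_subset_left,
      productFunctions_mono X Y Set.inter_subset_right Set.inter_subset_right⟩)

/-- The first projection of a product. -/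
def fst {X Y : SpaceWithFunctions K} (p : prod X Y) : X := Prod.fst (α := X) (β := Y) p

/-- The second projection of a product. -/
def snd {X Y : SpaceWithFunctions K} (p : prod X Y) : Y := Prod.snd (α := X) (β := Y) p

/-- A subset with the induced structure: the subspace topology, and functions that locally extend
to regular functions of the ambient space. -/
def restrict (X : SpaceWithFunctions K) (S : Set X) : SpaceWithFunctions K where
  carrier := S
  top := instTopologicalSpaceSubtype
  RegAt f p := ∃ g : X → K, X.RegAt g p.1 ∧ f =ᶠ[𝓝 p] fun q => g q.1
  regAt_const c p := ⟨fun _ => c, X.regAt_const c p.1, EventuallyEq.rfl⟩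
  regAt_add := by
    rintro f g p ⟨f', hf, hf'⟩ ⟨g', hg, hg'⟩
    exact ⟨f' + g', X.regAt_add _ _ _ hf hg, hf'.add hg'⟩
  regAt_mul := by
    rintro f g p ⟨f', hf, hf'⟩ ⟨g', hg, hg'⟩
    exact ⟨f' * g', X.regAt_mul _ _ _ hf hg, hf'.mul hg'⟩
  regAt_inv := by
    rintro f p ⟨f', hf, hf'⟩ h
    exact ⟨f'⁻¹, X.regAt_inv _ _ hf (by rwa [hf'.self_of_nhds] at h), hf'.inv⟩
  regAt_congr := by
    rintro f g p ⟨f', hf, hf'⟩ hfg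
    exact ⟨f', hf, hfg.symm.trans hf'⟩
  regAt_eventually := by
    rintro f p ⟨f', hf, hf'⟩
    filter_upwards [continuous_subtype_val.continuousAt.eventually (X.regAt_eventually _ _ hf),
      eventually_eventually_nhds.2 hf'] with q h1 h2
    exact ⟨f', h1, h2⟩
  regAt_ne_zero := by
    rintro f p ⟨f', hf, hf'⟩ h
    rw [hf'.self_of_nhds] at h
    filter_upwards [continuous_subtype_val.continuousAt.eventually (X.regAt_ne_zero _ _ hf h),
      hf'] with q h1 h2
    rwa [h2]

/-- The final structure on `Y` for maps `π i : X i → Y`: a set is open if all its preimages are,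
and a function is regular on an open set if all its pullbacks are. For one surjective map this is
the quotient structure; for the inclusions of charts it is the structure glued from the charts. -/
def final {ι : Type u} (X : ι → SpaceWithFunctions K) (Y : Type u) (π : ∀ i, X i → Y) :
    SpaceWithFunctions K :=
  letI top : TopologicalSpace Y := ⨆ i, TopologicalSpace.coinduced (π i) (X i).top
  have hcont : ∀ i, Continuous (π i) := fun i =>
    continuous_iff_coinduced_le.2 (le_iSup (fun i => TopologicalSpace.coinduced (π i) (X i).top) i)
  have hne : ∀ (f : Y → K) (y : Y),
      (∀ᶠ y' in 𝓝 y, ∀ i x, π i x = y' → (X i).RegAt (fun z => f (π i z)) x) → f y ≠ 0 →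
      ∀ᶠ y' in 𝓝 y, f y' ≠ 0 := by
    intro f y hf hy
    obtain ⟨U, hU, hUo, hyU⟩ := eventually_nhds_iff.1 hf
    have ho : IsOpen {y' | y' ∈ U ∧ f y' ≠ 0} := by
      refine isOpen_iSup_iff.2 fun i => isOpen_coinduced.2 (isOpen_iff_mem_nhds.2 ?_)
      rintro x ⟨hx1, hx2⟩
      filter_upwards [(hUo.preimage (hcont i)).mem_nhds hx1,
        (X i).regAt_ne_zero _ x (hU _ hx1 i x rfl) hx2] with z h1 h2
      exact ⟨h1, h2⟩
    exact mem_of_superset (ho.mem_nhds ⟨hyU, hy⟩) fun z hz => hz.2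
  { carrier := Y
    top := top
    RegAt := fun f y => ∀ᶠ y' in 𝓝 y, ∀ i x, π i x = y' → (X i).RegAt (fun z => f (π i z)) x
    regAt_const := fun c y => Eventually.of_forall fun _ i x _ => (X i).regAt_const c x
    regAt_add := fun f g y hf hg => by
      filter_upwards [hf, hg] with y' h1 h2 i x hx
      exact (X i).regAt_add _ _ x (h1 i x hx) (h2 i x hx)
    regAt_mul := fun f g y hf hg => by
      filter_upwards [hf, hg] with y' h1 h2 i x hx
      exact (X i).regAt_mul _ _ x (h1 i x hx) (h2 i x hx)
    regAt_inv := fun f y hf hy => by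
      filter_upwards [hf, hne f y hf hy] with y' h1 h2 i x hx
      exact (X i).regAt_inv _ x (h1 i x hx) (by rwa [hx])
    regAt_congr := fun f g y hf hfg => by
      filter_upwards [hf, eventually_eventually_nhds.2 hfg] with y' h1 h2 i x hx
      subst hx
      exact (X i).regAt_congr _ _ x (h1 i x rfl) ((hcont i).continuousAt.eventually h2)
    regAt_eventually := fun f y hf => eventually_eventually_nhds.2 hf
    regAt_ne_zero := hne }

/-- The projective space of lines in a (finite-dimensional) vector space `V`: the quotient of
`V ∖ {0}` by scalars. -/
def projectiveSpace (K : Type u) [Field K] (V : Type u) [AddCommGroup V] [Module K V] :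
    SpaceWithFunctions K :=
  final (fun _ : PUnit => (affineSpace K V).restrict {v : V | v ≠ 0}) (ℙ K V)
    (fun _ v => Projectivization.mk K (V := V) v.1 v.2)

/-! ### Varieties and morphisms between them -/

/-- Isomorphic to a closed subset of an affine space `Kᴺ`. -/
def IsAffineVariety (X : SpaceWithFunctions K) : Prop :=
  ∃ (N : ℕ) (S : Set (affineSpace K (Fin N → K))), IsClosed S ∧
    ∃ e : X ≃ (affineSpace K (Fin N → K)).restrict S, IsIsomorphism e

/-- A prevariety: quasi-compact and locally affine, that is, with a finite affine open cover. -/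
def IsPrevariety (X : SpaceWithFunctions K) : Prop :=
  CompactSpace X ∧ ∀ p : X, ∃ U : Set X, IsOpen U ∧ p ∈ U ∧ IsAffineVariety (X.restrict U)

/-- A variety: an irreducible separated prevariety. -/
def IsVariety (X : SpaceWithFunctions K) : Prop :=
  IsPrevariety X ∧ IsClosed {q : prod X X | fst q = snd q} ∧ IrreducibleSpace X

/-- All local rings are regular. Over an algebraically closed field, this is smoothness. -/
def IsSmooth (X : SpaceWithFunctions K) : Prop :=
  ∀ p : X, IsRegularLocalRing (X.localRing p)

/-- The fibre product, as a subset of the product. -/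
def fiberProduct {X Y Z : SpaceWithFunctions K} (f : X → Y) (g : Z → Y) : SpaceWithFunctions K :=
  (prod X Z).restrict {q | f (fst q) = g (snd q)}

/-- A proper morphism (of prevarieties): separated and universally closed. -/
def IsProperMorphism {X Y : SpaceWithFunctions K} (f : X → Y) : Prop :=
  IsMorphism f ∧
  IsClosed {q : fiberProduct f f | fst q.1 = snd q.1} ∧
  ∀ (Z : SpaceWithFunctions K) (g : Z → Y), IsPrevariety Z → IsMorphism g →
    IsClosedMap (fun q : fiberProduct f g => snd q.1)

/-- A birational morphism: it restricts to an isomorphism between dense open subsets. -/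
def IsBirationalMorphism {X Y : SpaceWithFunctions K} (f : X → Y) : Prop :=
  IsMorphism f ∧ ∃ (U : Set X) (V : Set Y), IsOpen U ∧ Dense U ∧ IsOpen V ∧ Dense V ∧
    ∃ e : X.restrict U ≃ Y.restrict V, IsIsomorphism e ∧ ∀ x, (e x).1 = f x.1

/-- A resolution of singularities of the variety `Y`: a proper birational morphism from a smooth
variety. -/
def IsResolutionOfSingularities {X Y : SpaceWithFunctions K} (f : X → Y) : Prop :=
  IsVariety X ∧ IsVariety Y ∧ IsSmooth X ∧ IsProperMorphism f ∧ IsBirationalMorphism f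

/-! ### Vector bundles -/

/-- An algebraic vector bundle on `X`, given by its fibres and an atlas of local trivializations
with regular transition matrices. The fibre coordinates are indexed by the finite type `idx`. -/
structure VectorBundle (X : SpaceWithFunctions K) where
  idx : Type
  [fintypeIdx : Fintype idx]
  [decEqIdx : DecidableEq idx]
  fiber : X → Type u
  [addCommGroup : ∀ x, AddCommGroup (fiber x)]
  [module : ∀ x, Module K (fiber x)]
  chart : Type u
  base : chart → Set X
  isOpen_base : ∀ i, IsOpen (base i)
  exists_mem_base : ∀ x, ∃ i, x ∈ base i
  triv : ∀ (i : chart) (x : X), x ∈ base i → fiber x ≃ₗ[K] (idx → K)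
  transition : ∀ (i j : chart) (a b : idx) (p : X.restrict (base i ∩ base j)),
    (X.restrict (base i ∩ base j)).RegAt
      (fun x => triv j x.1 x.2.2 ((triv i x.1 x.2.1).symm (Pi.single b 1)) a) p

namespace VectorBundle

attribute [instance] fintypeIdx decEqIdx addCommGroup module

variable {X : SpaceWithFunctions K}

/-- The dual bundle: a linear form `α` has the coordinates `α(e_b)`, where `e_b` is the local frame
given by the trivialization. -/
def dual (E : VectorBundle X) : VectorBundle X where
  idx := E.idx
  fiber x := Module.Dual K (E.fiber x)
  chart := E.chart
  base := E.base
  isOpen_base := E.isOpen_base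
  exists_mem_base := E.exists_mem_base
  triv i x hx := (E.triv i x hx).symm.dualMap.trans (dotProductEquiv K E.idx).symm
  transition i j a b p := by
    refine (X.restrict (E.base i ∩ E.base j)).regAt_congr
      (fun x => E.triv i x.1 x.2.1 ((E.triv j x.1 x.2.2).symm (Pi.single a 1)) b) _ p ?_
      (Eventually.of_forall fun x => by simp)
    obtain ⟨p, hp⟩ := p
    obtain ⟨g, hg, hg'⟩ := E.transition j i b a ⟨p, hp.symm⟩
    have hc : Continuous (fun x : (E.base i ∩ E.base j : Set X) =>
        (⟨x.1, x.2.symm⟩ : (E.base j ∩ E.base i : Set X))) := by fun_prop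
    exact ⟨g, hg, (hc.tendsto ⟨p, hp⟩).eventually hg'⟩

/-- The direct sum of `m` copies of a bundle. -/
def power (E : VectorBundle X) (m : ℕ) : VectorBundle X where
  idx := Fin m × E.idx
  fiber x := Fin m → E.fiber x
  chart := E.chart
  base := E.base
  isOpen_base := E.isOpen_base
  exists_mem_base := E.exists_mem_base
  triv i x hx := (LinearEquiv.piCongrRight fun _ => E.triv i x hx).trans
    (LinearEquiv.curry K K (Fin m) E.idx).symm
  transition i j a b p := by
    have hs : ∀ c : Fin m, (fun d : E.idx => (Pi.single b 1 : Fin m × E.idx → K) (c, d)) =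
        if c = b.1 then Pi.single b.2 1 else 0 := by
      intro c
      funext d
      split_ifs with h
      · subst h
        simp [Pi.single_apply, Prod.ext_iff]
      · simp [Prod.ext_iff, h]
    by_cases h : a.1 = b.1
    · refine (X.restrict (E.base i ∩ E.base j)).regAt_congr _ _ p (E.transition i j a.2 b.2 p)
        (Eventually.of_forall fun x => ?_)
      have := hs a.1
      rw [if_pos h] at this
      change _ = E.triv j x.1 _ ((E.triv i x.1 _).symm
        (fun d : E.idx => (Pi.single b 1 : Fin m × E.idx → K) (a.1, d))) a.2
      rw [this]
    · refine (X.restrict (E.base i ∩ E.base j)).regAt_congr _ _ p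
        ((X.restrict (E.base i ∩ E.base j)).regAt_const 0 p) (Eventually.of_forall fun x => ?_)
      have := hs a.1
      rw [if_neg h] at this
      change _ = E.triv j x.1 _ ((E.triv i x.1 _).symm
        (fun d : E.idx => (Pi.single b 1 : Fin m × E.idx → K) (a.1, d))) a.2
      rw [this]
      simp

/-- The projective bundle `ℙ(E)` of lines in the fibres of `E`, glued from the products
`base i × ℙ(Kʳ)` along the trivializations. -/
def projectivization (E : VectorBundle X) : SpaceWithFunctions K :=
  final (fun i : E.chart => prod (X.restrict (E.base i)) (projectiveSpace K (E.idx → K)))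
    (Σ x : X, ℙ K (E.fiber x))
    (fun i q => ⟨(fst q).1, Projectivization.map
      (E.triv i (fst q).1 (fst q).2).symm.toLinearMap (LinearEquiv.injective _) (snd q)⟩)

/-- The projection of `ℙ(E)` to the base. -/
def projectivizationProj (E : VectorBundle X) (p : E.projectivization) : X :=
  Sigma.fst (β := fun x : X => ℙ K (E.fiber x)) p

end VectorBundle

/-! ### Grassmannians -/

section Grassmannian

variable (K) (k n : ℕ)

/-- The linearly independent `k`-tuples in `Kⁿ`. -/
def frames : SpaceWithFunctions K :=
  (affineSpace K (Fin k → Fin n → K)).restrict {a : Fin k → Fin n → K | LinearIndependent K a}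

/-- The span of a linearly independent `k`-tuple. -/
def frameSpan (a : frames K k n) :
    {Λ : Submodule K (Fin n → K) // Module.finrank K Λ = k} :=
  ⟨Submodule.span K (Set.range a.1), by simpa using finrank_span_eq_card a.2⟩

/-- The Grassmannian `G(k, n)` of `k`-dimensional subspaces of `Kⁿ`, with the structure of the
quotient of the open set of linearly independent `k`-tuples by `GL_k`. -/
def grassmannian : SpaceWithFunctions K :=
  final (fun _ : PUnit => frames K k n) {Λ : Submodule K (Fin n → K) // Module.finrank K Λ = k}
    (fun _ => frameSpan K k n)

variable {k n}

/-- The subspace of `Kⁿ` that corresponds to a point of the Grassmannian. -/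
def subspace (Λ : grassmannian K k n) : Submodule K (Fin n → K) := Λ.1

/-- The composite of `s : Kⁿ⁻ᵏ → Kⁿ` with the projection to `Kⁿ / Λ`. -/
def frameOfQuotient (s : (Fin (n - k) → K) →ₗ[K] (Fin n → K)) (Λ : grassmannian K k n) :
    (Fin (n - k) → K) →ₗ[K] (Fin n → K) ⧸ subspace K Λ :=
  (subspace K Λ).mkQ ∘ₗ s

/-- The set of those `Λ` for which `s : Kⁿ⁻ᵏ → Kⁿ` induces an isomorphism `Kⁿ⁻ᵏ ≅ Kⁿ / Λ`. -/
def quotientChart (s : (Fin (n - k) → K) →ₗ[K] (Fin n → K)) : Set (grassmannian K k n) :=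
  {Λ | Function.Bijective (frameOfQuotient K s Λ)}

variable {K}

/-- The tuple of vectors underlying a point of `frames`. -/
def frameVal (a : frames K k n) : Fin k → Fin n → K := a.1

theorem frameVal_linearIndependent (a : frames K k n) : LinearIndependent K (frameVal a) := a.2

/-- The point of the Grassmannian given by a linearly independent `k`-tuple. -/
def framePoint (a : frames K k n) : grassmannian K k n := frameSpan K k n a

/-- The square matrix with columns `a` and `s(e_c)`. -/
def frameMatrix (e : Fin n ≃ Fin k ⊕ Fin (n - k)) (s : (Fin (n - k) → K) →ₗ[K] (Fin n → K))
    (a : Fin k → Fin n → K) : Matrix (Fin n) (Fin n) K :=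
  Matrix.of fun i j => Sum.elim (fun j' => a j' i) (fun c => s (Pi.single c 1) i) (e j)

theorem frameMatrix_mulVec (e : Fin n ≃ Fin k ⊕ Fin (n - k))
    (s : (Fin (n - k) → K) →ₗ[K] (Fin n → K)) (a : Fin k → Fin n → K) (u : Fin n → K) :
    (frameMatrix e s a).mulVec u =
      (∑ j, u (e.symm (Sum.inl j)) • a j) + s (fun c => u (e.symm (Sum.inr c))) := by
  have h : s (fun c => u (e.symm (Sum.inr c))) =
      ∑ c, u (e.symm (Sum.inr c)) • s (Pi.single c 1) := by
    simp only [← map_smul, ← map_sum]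
    congr 1
    ext d
    simp [Pi.single_apply]
  rw [h]
  ext i
  simp only [Matrix.mulVec, dotProduct, Pi.add_apply, Finset.sum_apply, Pi.smul_apply, smul_eq_mul]
  rw [← e.symm.sum_comp, Fintype.sum_sum_type]
  simp [frameMatrix, mul_comm]

theorem frameMatrix_mkQ (e : Fin n ≃ Fin k ⊕ Fin (n - k))
    (s : (Fin (n - k) → K) →ₗ[K] (Fin n → K)) (a : frames K k n) (u : Fin n → K) :
    (subspace K (framePoint a)).mkQ ((frameMatrix e s (frameVal a)).mulVec u) =
      frameOfQuotient K s (framePoint a)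
        (fun c => u (e.symm (Sum.inr c))) := by
  rw [frameMatrix_mulVec, map_add]
  have : (∑ j, u (e.symm (Sum.inl j)) • frameVal a j) ∈
      subspace K (framePoint a) :=
    Submodule.sum_mem _ fun j _ => Submodule.smul_mem _ _ (Submodule.subset_span ⟨j, rfl⟩)
  rw [(Submodule.Quotient.mk_eq_zero _).2 this |> fun h => (h : Submodule.mkQ _ _ = 0), zero_add]
  rfl

theorem mem_quotientChart_iff (e : Fin n ≃ Fin k ⊕ Fin (n - k))
    (s : (Fin (n - k) → K) →ₗ[K] (Fin n → K)) (a : frames K k n) :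
    framePoint a ∈ quotientChart K s ↔
      (frameMatrix e s (frameVal a)).det ≠ 0 := by
  constructor
  · intro h hdet
    obtain ⟨u, hu, hMu⟩ := Matrix.exists_mulVec_eq_zero_iff.2 hdet
    apply hu
    have h1 := frameMatrix_mkQ e s a u
    rw [hMu, map_zero, ← map_zero (frameOfQuotient K s (framePoint a))] at h1
    have h2 := h.1 h1
    rw [frameMatrix_mulVec, ← h2, map_zero, add_zero] at hMu
    have h3 := Fintype.linearIndependent_iff.1 (frameVal_linearIndependent a) _ hMu
    ext i
    obtain ⟨i, rfl⟩ := e.symm.surjective i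
    rcases i with i | i
    · exact h3 i
    · exact (congrFun h2 i).symm
  · intro h
    have hsurj : Function.Surjective
        (frameOfQuotient K s (framePoint a)) := by
      intro y
      obtain ⟨v, rfl⟩ := Submodule.mkQ_surjective _ y
      have hu : IsUnit (frameMatrix e s (frameVal a)) := by
        rw [Matrix.isUnit_iff_isUnit_det]
        exact isUnit_iff_ne_zero.2 h
      obtain ⟨u, rfl⟩ := (Matrix.mulVec_surjective_iff_isUnit.2 hu) v
      exact ⟨_, (frameMatrix_mkQ e s a u).symm⟩
    refine ⟨?_, hsurj⟩
    refine (LinearMap.injective_iff_surjective_of_finrank_eq_finrank ?_).2 hsurj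
    have h1 := Submodule.finrank_quotient_add_finrank
      (subspace K (framePoint a))
    have h2 : Module.finrank K (subspace K (framePoint a)) = k :=
      (frameSpan K k n a).2
    simp only [Module.finrank_fintype_fun_eq_card, Fintype.card_fin] at h1 ⊢
    omega

theorem exists_frame (Λ : grassmannian K k n) : ∃ a : frames K k n, framePoint a = Λ := by
  obtain ⟨Λ, hΛ⟩ := Λ
  let b := Module.finBasisOfFinrankEq K Λ hΛ
  refine ⟨⟨fun i => (b i : Fin n → K), ?_⟩, ?_⟩
  · exact b.linearIndependent.map' Λ.subtype Λ.ker_subtype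
  · apply Subtype.ext
    change Submodule.span K (Set.range (Λ.subtype ∘ b)) = Λ
    rw [Set.range_comp, ← Submodule.map_span, b.span_eq, Submodule.map_top, Submodule.range_subtype]

theorem le_of_grassmannian (Λ : grassmannian K k n) : k ≤ n := by
  have := Submodule.finrank_le (subspace K Λ)
  rw [show Module.finrank K (subspace K Λ) = k from Λ.2] at this
  simpa using this

theorem exists_mem_quotientChart (Λ : grassmannian K k n) :
    ∃ s : (Fin (n - k) → K) →ₗ[K] (Fin n → K), Λ ∈ quotientChart K s := by
  have h1 := Submodule.finrank_quotient_add_finrank (subspace K Λ)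
  have h2 : Module.finrank K (subspace K Λ) = k := Λ.2
  obtain ⟨g, hg⟩ := LinearMap.exists_rightInverse_of_surjective (subspace K Λ).mkQ
    (Submodule.range_mkQ _)
  have e : (Fin (n - k) → K) ≃ₗ[K] (Fin n → K) ⧸ subspace K Λ := by
    refine LinearEquiv.ofFinrankEq _ _ ?_
    simp only [Module.finrank_fintype_fun_eq_card, Fintype.card_fin] at h1 ⊢
    omega
  refine ⟨g ∘ₗ e.toLinearMap, ?_⟩
  have : frameOfQuotient K (g ∘ₗ e.toLinearMap) Λ = e.toLinearMap := by
    rw [frameOfQuotient, ← LinearMap.comp_assoc, hg, LinearMap.id_comp]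
  change Function.Bijective (frameOfQuotient K (g ∘ₗ e.toLinearMap) Λ)
  rw [this]
  exact e.bijective

theorem det_mem_polynomialFunctions {V : Type u} [AddCommGroup V] [Module K V] {ι : Type}
    [Fintype ι] [DecidableEq ι] (M : V → Matrix ι ι K)
    (h : ∀ i j, (fun v => M v i j) ∈ polynomialFunctions K V) :
    (fun v => (M v).det) ∈ polynomialFunctions K V := by
  have : (fun v => (M v).det) = ∑ σ : Equiv.Perm ι,
      algebraMap K (V → K) ((Equiv.Perm.sign σ : ℤ) : K) * ∏ i, fun v => M v (σ i) i := by
    funext v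
    simp [Matrix.det_apply']
  rw [this]
  exact Subalgebra.sum_mem _ fun σ _ => Subalgebra.mul_mem _ (Subalgebra.algebraMap_mem _ _)
    (Subalgebra.prod_mem _ fun i _ => h _ _)

theorem frameMatrix_entry_mem (e : Fin n ≃ Fin k ⊕ Fin (n - k))
    (s : (Fin (n - k) → K) →ₗ[K] (Fin n → K)) (i j : Fin n) :
    (fun a : Fin k → Fin n → K => frameMatrix e s a i j) ∈
      polynomialFunctions K (Fin k → Fin n → K) := by
  rcases h : e j with j' | c
  · have : (fun a : Fin k → Fin n → K => frameMatrix e s a i j) =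
        (LinearMap.proj i ∘ₗ LinearMap.proj j' : Module.Dual K (Fin k → Fin n → K)) := by
      funext a
      simp [frameMatrix, h]
    rw [this]
    exact Algebra.subset_adjoin ⟨_, rfl⟩
  · have : (fun a : Fin k → Fin n → K => frameMatrix e s a i j) =
        algebraMap K _ (s (Pi.single c 1) i) := by
      funext a
      simp [frameMatrix, h]
    rw [this]
    exact Subalgebra.algebraMap_mem _ _

theorem isOpen_quotientChart (s : (Fin (n - k) → K) →ₗ[K] (Fin n → K)) :
    IsOpen (quotientChart K s : Set (grassmannian K k n)) := by
  refine isOpen_iSup_iff.2 fun _ => isOpen_coinduced.2 ?_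
  change IsOpen (framePoint ⁻¹' quotientChart K s)
  by_cases hk : k ≤ n
  · let e : Fin n ≃ Fin k ⊕ Fin (n - k) :=
      (finCongr (by omega : n = k + (n - k))).trans finSumFinEquiv.symm
    have : framePoint ⁻¹' quotientChart K s =
        frameVal ⁻¹' {a : Fin k → Fin n → K | (frameMatrix e s a).det ≠ 0} := by
      ext a
      exact mem_quotientChart_iff e s a
    rw [this]
    refine IsOpen.preimage (Y := affineSpace K (Fin k → Fin n → K)) continuous_subtype_val ?_
    refine TopologicalSpace.isOpen_generateFrom_of_mem ⟨PUnit.unit, _,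
      det_mem_polynomialFunctions _ (frameMatrix_entry_mem e s), ?_⟩
    simp
  · have : framePoint ⁻¹' quotientChart K s = ∅ := by
      ext a
      exact iff_of_false (fun _ => hk (le_of_grassmannian (framePoint a))) id
    rw [this]
    exact isOpen_empty

/-- The coordinates in the local frame of `Kⁿ / Λ` given by `s` of a fixed vector of `Kⁿ` are
regular functions of `Λ`. -/
theorem regAt_quotient_coordinate (s s' : (Fin (n - k) → K) →ₗ[K] (Fin n → K)) (v : Fin n → K)
    (c : Fin (n - k)) (p : (grassmannian K k n).restrict (quotientChart K s ∩ quotientChart K s')) :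
    ((grassmannian K k n).restrict (quotientChart K s ∩ quotientChart K s')).RegAt
      (fun x => (LinearEquiv.ofBijective (frameOfQuotient K s' x.1) x.2.2).symm
        ((subspace K x.1).mkQ v) c) p := by
  classical
  have hk := le_of_grassmannian p.1
  let e : Fin n ≃ Fin k ⊕ Fin (n - k) :=
    (finCongr (by omega : n = k + (n - k))).trans finSumFinEquiv.symm
  let g : grassmannian K k n → K := fun Λ => if h : Λ ∈ quotientChart K s' then
    (LinearEquiv.ofBijective (frameOfQuotient K s' Λ) h).symm ((subspace K Λ).mkQ v) c else 0
  have hg : ∀ Λ (h : Λ ∈ quotientChart K s'), g Λ =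
      (LinearEquiv.ofBijective (frameOfQuotient K s' Λ) h).symm ((subspace K Λ).mkQ v) c :=
    fun Λ h => dif_pos h
  refine ⟨g, ?_, Eventually.of_forall fun x => (hg x.1 x.2.2).symm⟩
  filter_upwards [(isOpen_quotientChart s').mem_nhds p.2.2]
  rintro Λ hΛ _ a rfl
  have hdet := (mem_quotientChart_iff e s' a).1 hΛ
  refine ⟨(fun a => (frameMatrix e s' a).cramer v (e.symm (Sum.inr c))) /
    fun a => (frameMatrix e s' a).det, ⟨PUnit.unit, Set.mem_univ _, _, ?_, _,
      det_mem_polynomialFunctions _ (frameMatrix_entry_mem e s'), hdet, EventuallyEq.rfl⟩, ?_⟩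
  · simp only [Matrix.cramer_apply]
    refine det_mem_polynomialFunctions _ fun i j => ?_
    by_cases hj : j = e.symm (Sum.inr c)
    · subst hj
      simp only [Matrix.updateCol_self]
      exact Subalgebra.algebraMap_mem _ (v i)
    · simp only [Matrix.updateCol_ne hj]
      exact frameMatrix_entry_mem e s' i j
  · have hev : ∀ᶠ a' in 𝓝 a, framePoint a' ∈ quotientChart K s' := by
      have ho := isOpen_coinduced.1 (isOpen_iSup_iff.1 (isOpen_quotientChart s') PUnit.unit)
      exact ho.mem_nhds hΛ
    filter_upwards [hev] with a' ha'
    have hd := (mem_quotientChart_iff e s' a').1 ha'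
    change g (framePoint a') = _
    rw [hg _ ha']
    have h1 : (frameMatrix e s' (frameVal a')).mulVec
        ((frameMatrix e s' (frameVal a')).det⁻¹ • (frameMatrix e s' (frameVal a')).cramer v) = v := by
      rw [Matrix.mulVec_smul, Matrix.mulVec_cramer, smul_smul, inv_mul_cancel₀ hd, one_smul]
    have h2 := frameMatrix_mkQ e s' a'
      ((frameMatrix e s' (frameVal a')).det⁻¹ • (frameMatrix e s' (frameVal a')).cramer v)
    rw [h1] at h2
    rw [h2]
    change (LinearEquiv.ofBijective (frameOfQuotient K s' _) ha').symm
      (LinearEquiv.ofBijective (frameOfQuotient K s' _) ha' _) c = _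
    rw [LinearEquiv.symm_apply_apply]
    simp only [Pi.smul_apply, smul_eq_mul]
    exact (div_eq_inv_mul _ _).symm

variable (K k n)

/-- The universal quotient bundle `Q` on `G(k, n)`: the fibre at `Λ` is `Kⁿ / Λ`, and each
`s : Kⁿ⁻ᵏ → Kⁿ` gives a local frame where it induces an isomorphism `Kⁿ⁻ᵏ ≅ Kⁿ / Λ`. -/
noncomputable def universalQuotient : VectorBundle (grassmannian K k n) where
  idx := Fin (n - k)
  fiber Λ := (Fin n → K) ⧸ subspace K Λ
  chart := (Fin (n - k) → K) →ₗ[K] (Fin n → K)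
  base s := quotientChart K s
  isOpen_base s := isOpen_quotientChart s
  exists_mem_base Λ := exists_mem_quotientChart Λ
  triv s Λ h := (LinearEquiv.ofBijective (frameOfQuotient K s Λ) h).symm
  transition s s' a b p := by
    simp only [LinearEquiv.symm_symm]
    exact regAt_quotient_coordinate s s' (s (Pi.single b 1)) a p

end Grassmannian

/-! ### Determinantal varieties -/

section Determinantal

variable (K) (m n k : ℕ)

/-- The projective space of nonzero `m × n` matrices up to scalars. -/
def matrixSpace : SpaceWithFunctions K := projectiveSpace K (Matrix (Fin m) (Fin n) K)

variable {m n}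

/-- The kernel in `Kⁿ` of a matrix given up to scalars. -/
noncomputable def matrixKer (φ : matrixSpace K m n) : Submodule K (Fin n → K) :=
  LinearMap.ker (Matrix.mulVecLin (Projectivization.rep (K := K)
    (V := Matrix (Fin m) (Fin n) K) φ))

variable (m n)

/-- The set of matrices with kernel of dimension at least `k`. -/
def detLocus : Set (matrixSpace K m n) := {φ | k ≤ Module.finrank K (matrixKer K φ)}

/-- The determinantal variety `τ_{m,n,k}`. -/
def detVariety : SpaceWithFunctions K := (matrixSpace K m n).restrict (detLocus K m n k)

/-- The incidence correspondence of all `(Λ, φ)` with `φ` in `τ_{m,n,k}` and `Λ ⊆ ker φ`. -/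
def incidenceLocus : Set (prod (grassmannian K k n) (matrixSpace K m n)) :=
  {q | snd q ∈ detLocus K m n k ∧ subspace K (fst q) ≤ matrixKer K (snd q)}

/-- The incidence variety `τ̂_{m,n,k}`. -/
def incidenceVariety : SpaceWithFunctions K :=
  (prod (grassmannian K k n) (matrixSpace K m n)).restrict (incidenceLocus K m n k)

variable {m n k}

/-- The projection of the incidence variety to the Grassmannian. -/
def incidenceRho (q : incidenceVariety K m n k) : grassmannian K k n := fst q.1

/-- The projection `ν` of the incidence variety to the determinantal variety. -/
def incidenceNu (q : incidenceVariety K m n k) : detVariety K m n k := ⟨snd q.1, q.2.1⟩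

end Determinantal

end SpaceWithFunctions

namespace SpaceWithFunctions

variable {K : Type u} [Field K]

/-! ### Morphisms at a point -/

/-! A matrix `φ` that kills `Λ` is an `m`-tuple of linear forms on `Kⁿ / Λ`, so the fibre of the
incidence variety over `Λ` is the projective space of the fibre of `Q^{∨m}`. The work lies in making
this regular in `Λ`. A linear map `s : Kⁿ⁻ᵏ → Kⁿ` has a chart of all `Λ` complementary to its image.
There `Λ` is the kernel of a unique `c` with `c s = 1` (`quotientCoord`), which by Cramer's rule is
regular in `Λ`, and a matrix `M` that kills `Λ` satisfies `M = (M s) c`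
(`mul_section_mul_quotientMatrix`). The entries of `M s` are bundle coordinates, whence the
isomorphism with `ℙ(Q^{∨m})` (`isIsomorphism_incidenceEquiv`). Scaling one entry of `M s` to `1`
identifies an open set with the affine subspace of pairs `(c, ψ)` with `c s = 1`, `ψ i j = 1`
(`exists_chart_incidenceVariety`). So the incidence variety is locally an affine space, whose local
rings are localizations of polynomial rings, and it is smooth.

Irreducibility and quasi-compactness: `(c, ψ) ↦ (ker c, ψ c)` maps an open subset of a vector space
onto the incidence variety, and `ν` maps that onto the determinantal variety.

Birationality: where the kernel of `φ` has dimension exactly `k`, `Λ` must be this kernel, and a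
kernel of constant dimension varies regularly with the matrix (`morphAt_matrixKer`). This locus is
the complement of the determinantal locus for `k + 1`, hence open. It is nonempty because `n ≤ m`
allows injective `ψ`, hence dense.

Closedness and properness come from elimination theory. If homogeneous equations have no common zero
at a parameter `z₀`, the Nullstellensatz puts all monomials of some degree into their ideal. This is
witnessed by an invertible matrix of regular functions, so it persists near `z₀`
(`exists_finset_eventually_eval_ne_zero`). Hence projective spaces are complete, and Grassmannians
are so by induction on `k`, since the `(k+1)`-dimensional spaces above a given `Λ` form a projective
space. The incidence variety is closed in a complete product, its image is closed, and `ν` is proper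
because its target is separated. -/

/-- The algebra of functions that are regular at `p`. -/
def regularAt (X : SpaceWithFunctions K) (p : X) : Subalgebra K (X → K) where
  carrier := {f | X.RegAt f p}
  mul_mem' := X.regAt_mul _ _ p
  add_mem' := X.regAt_add _ _ p
  algebraMap_mem' c := X.regAt_const c p

theorem regAt_sum {X : SpaceWithFunctions K} {p : X} {ι : Type*} (s : Finset ι) (f : ι → X → K)
    (h : ∀ i ∈ s, X.RegAt (f i) p) : X.RegAt (fun x => ∑ i ∈ s, f i x) p := by
  have := (X.regularAt p).sum_mem (t := s) (f := f) h
  rwa [show ∑ i ∈ s, f i = fun x => ∑ i ∈ s, f i x from by ext; simp] at this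

theorem regAt_prod {X : SpaceWithFunctions K} {p : X} {ι : Type*} (s : Finset ι) (f : ι → X → K)
    (h : ∀ i ∈ s, X.RegAt (f i) p) : X.RegAt (fun x => ∏ i ∈ s, f i x) p := by
  have := (X.regularAt p).prod_mem (t := s) (f := f) h
  rwa [show ∏ i ∈ s, f i = fun x => ∏ i ∈ s, f i x from by ext; simp] at this

theorem regAt_div {X : SpaceWithFunctions K} {p : X} {f g : X → K} (hf : X.RegAt f p)
    (hg : X.RegAt g p) (h : g p ≠ 0) : X.RegAt (f / g) p := by
  rw [div_eq_mul_inv]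
  exact X.regAt_mul _ _ _ hf (X.regAt_inv _ _ hg h)

theorem regAt_det {X : SpaceWithFunctions K} {p : X} {ι : Type*} [Fintype ι] [DecidableEq ι]
    (M : X → Matrix ι ι K) (h : ∀ i j, X.RegAt (fun x => M x i j) p) :
    X.RegAt (fun x => (M x).det) p := by
  simp only [Matrix.det_apply']
  exact regAt_sum _ _ fun σ _ => X.regAt_mul _ _ _ (X.regAt_const _ p)
    (regAt_prod _ _ fun i _ => h _ _)

theorem regAt_matrix_mul {X : SpaceWithFunctions K} {p : X} {ι κ μ : Type*} [Fintype κ]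
    {M : X → Matrix ι κ K} {N : X → Matrix κ μ K} (hM : ∀ i j, X.RegAt (fun x => M x i j) p)
    (hN : ∀ i j, X.RegAt (fun x => N x i j) p) (i : ι) (j : μ) :
    X.RegAt (fun x => (M x * N x) i j) p := by
  simp only [Matrix.mul_apply]
  exact regAt_sum _ _ fun l _ => X.regAt_mul _ _ _ (hM _ _) (hN _ _)

theorem regAt_adjugate {X : SpaceWithFunctions K} {p : X} {ι : Type*} [Fintype ι] [DecidableEq ι]
    {M : X → Matrix ι ι K} (h : ∀ i j, X.RegAt (fun x => M x i j) p) (i j : ι) :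
    X.RegAt (fun x => (M x).adjugate i j) p := by
  simp only [Matrix.adjugate_apply]
  refine regAt_det _ fun i' j' => ?_
  by_cases hj : i' = j
  · subst hj
    simp only [Matrix.updateRow_self]
    exact X.regAt_const _ _
  · simp only [Matrix.updateRow_ne hj]
    exact h _ _

/-- `φ` is continuous at `p` and pulls functions regular at `φ p` back to functions regular
at `p`. -/
def MorphAt {X Y : SpaceWithFunctions K} (φ : X → Y) (p : X) : Prop :=
  ContinuousAt φ p ∧ ∀ f, Y.RegAt f (φ p) → X.RegAt (f ∘ φ) p

theorem isMorphism_iff {X Y : SpaceWithFunctions K} {φ : X → Y} :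
    IsMorphism φ ↔ ∀ p, MorphAt φ p :=
  ⟨fun h p => ⟨h.1.continuousAt, fun f hf => h.2 f p hf⟩,
    fun h => ⟨continuous_iff_continuousAt.2 fun p => (h p).1, fun f p hf => (h p).2 f hf⟩⟩

theorem morphAt_id {X : SpaceWithFunctions K} (p : X) : MorphAt (X := X) (Y := X) (fun x => x) p :=
  ⟨continuousAt_id, fun _ h => h⟩

theorem MorphAt.comp {X Y Z : SpaceWithFunctions K} {ψ : Y → Z} {φ : X → Y} {p : X}
    (hψ : MorphAt ψ (φ p)) (hφ : MorphAt φ p) :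
    MorphAt (X := X) (Y := Z) (fun x => ψ (φ x)) p :=
  ⟨ContinuousAt.comp (g := ψ) hψ.1 hφ.1, fun f hf => hφ.2 _ (hψ.2 f hf)⟩

theorem MorphAt.congr {X Y : SpaceWithFunctions K} {φ ψ : X → Y} {p : X} (h : MorphAt φ p)
    (he : φ =ᶠ[𝓝 p] ψ) : MorphAt ψ p := by
  refine ⟨h.1.congr he, fun f hf => ?_⟩
  rw [← he.self_of_nhds] at hf
  exact X.regAt_congr _ _ _ (h.2 f hf) (he.fun_comp f)

theorem MorphAt.regAt {X Y : SpaceWithFunctions K} {φ : X → Y} {p : X} (h : MorphAt φ p)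
    {f : Y → K} (hf : Y.RegAt f (φ p)) : X.RegAt (fun x => f (φ x)) p := h.2 f hf

theorem MorphAt.eventually {X Y : SpaceWithFunctions K} {φ : X → Y} {p : X} (h : MorphAt φ p)
    {P : Y → Prop} (hP : ∀ᶠ y in 𝓝 (φ p), P y) : ∀ᶠ x in 𝓝 p, P (φ x) := h.1.eventually hP

theorem IsMorphism.morphAt {X Y : SpaceWithFunctions K} {φ : X → Y} (h : IsMorphism φ) (p : X) :
    MorphAt φ p := isMorphism_iff.1 h p

theorem IsMorphism.comp {X Y Z : SpaceWithFunctions K} {ψ : Y → Z} {φ : X → Y}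
    (hψ : IsMorphism ψ) (hφ : IsMorphism φ) :
    IsMorphism (X := X) (Y := Z) (fun x => ψ (φ x)) :=
  isMorphism_iff.2 fun p => (hψ.morphAt _).comp (hφ.morphAt p)

theorem IsIsomorphism.trans {X Y Z : SpaceWithFunctions K} {e : X ≃ Y} {e' : Y ≃ Z}
    (h : IsIsomorphism e) (h' : IsIsomorphism e') : IsIsomorphism (X := X) (Y := Z) (e.trans e') :=
  ⟨h'.1.comp h.1, h.2.comp h'.2⟩

/-- An isomorphism as a homeomorphism. -/
def IsIsomorphism.homeomorph {X Y : SpaceWithFunctions K} {e : X ≃ Y}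
    (h : IsIsomorphism e) : X ≃ₜ Y where
  toEquiv := e
  continuous_toFun := h.1.1
  continuous_invFun := h.2.1

/-! ### Morphisms and the basic constructions -/

theorem isMorphism_val {X : SpaceWithFunctions K} (S : Set X) :
    IsMorphism (X := X.restrict S) (Y := X) (fun x => x.1) :=
  ⟨continuous_subtype_val, fun f _ hf => ⟨f, hf, EventuallyEq.rfl⟩⟩

/-- Universal property of the induced structure: the topology and the regular functions of a subset
both come from the ambient space. -/
theorem morphAt_restrict_iff {X Y : SpaceWithFunctions K} {S : Set Y} {φ : X → Y.restrict S}
    {p : X} : MorphAt φ p ↔ MorphAt (X := X) (Y := Y) (fun x => (φ x).1) p := by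
  refine ⟨fun h => ((isMorphism_val S).morphAt _).comp h, fun h => ?_⟩
  have hc : ContinuousAt φ p :=
    (Topology.IsInducing.subtypeVal (t := S)).continuousAt_iff.2 h.1
  refine ⟨hc, ?_⟩
  rintro f ⟨g, hg, hfg⟩
  have : ∀ᶠ x in 𝓝 p, f (φ x) = g (φ x).1 := Tendsto.eventually hc hfg
  exact X.regAt_congr _ _ _ (h.2 g hg) (this.mono fun _ h => h.symm)

/-- For maps that are known to land in `S` only near `p`. Being a morphism at `p` ignores the values
far away, so any point of `S` serves as default. -/
theorem MorphAt.exists_restrict {X Y : SpaceWithFunctions K} {F : X → Y} {S : Set Y} {p : X}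
    (hF : MorphAt F p) (h : ∀ᶠ x in 𝓝 p, F x ∈ S) :
    ∃ F' : X → Y.restrict S, MorphAt F' p ∧ ∀ᶠ x in 𝓝 p, (F' x).1 = F x := by
  classical
  let F' : X → Y.restrict S := fun x => if hx : F x ∈ S then ⟨F x, hx⟩ else ⟨F p, h.self_of_nhds⟩
  have he : ∀ᶠ x in 𝓝 p, (F' x).1 = F x := h.mono fun x hx =>
    congrArg Subtype.val (dif_pos hx : F' x = ⟨F x, hx⟩)
  exact ⟨F', morphAt_restrict_iff.2 (hF.congr (he.mono fun _ h => h.symm)), he⟩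

theorem MorphAt.restrict {X Y : SpaceWithFunctions K} {φ : X → Y} {S : Set X} {p : X.restrict S}
    (h : MorphAt φ p.1) : MorphAt (X := X.restrict S) (Y := Y) (fun x => φ x.1) p :=
  MorphAt.comp (Y := X) h ((isMorphism_val S).morphAt p)

/-- An open inclusion identifies neighbourhood filters, so it is enough to work on an open
neighbourhood. -/
theorem morphAt_of_restrict {X Y : SpaceWithFunctions K} {φ : X → Y} {U : Set X} (hU : IsOpen U)
    {p : X} (hp : p ∈ U)
    (h : MorphAt (X := X.restrict U) (Y := Y) (fun x => φ x.1) ⟨p, hp⟩) : MorphAt φ p := by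
  have hm : map (Subtype.val : U → X) (𝓝 ⟨p, hp⟩) = 𝓝 p :=
    map_nhds_subtype_coe_eq_nhds hp (hU.mem_nhds hp)
  refine ⟨?_, fun f hf => ?_⟩
  · rw [ContinuousAt, ← hm, tendsto_map'_iff]
    exact h.1
  · obtain ⟨g, hg, hfg⟩ := h.2 f hf
    refine X.regAt_congr _ _ _ hg ?_
    rw [EventuallyEq, ← hm, eventually_map]
    exact hfg.symm

theorem regAt_restrict_iff_of_isOpen {X : SpaceWithFunctions K} {U : Set X} (hU : IsOpen U)
    {f : X → K} {p : X.restrict U} :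
    (X.restrict U).RegAt (fun x => f x.1) p ↔ X.RegAt f p.1 := by
  refine ⟨?_, fun h => ⟨f, h, EventuallyEq.rfl⟩⟩
  rintro ⟨g, hg, hfg⟩
  refine X.regAt_congr _ _ _ hg ?_
  have hm : map (Subtype.val : U → X) (𝓝 p) = 𝓝 p.1 :=
    map_nhds_subtype_coe_eq_nhds p.2 (hU.mem_nhds p.2)
  rw [EventuallyEq, ← hm, eventually_map]
  exact hfg.symm

/-! ### Structures given by fractions: neighbourhoods and a criterion for morphisms -/

section OfFractions

variable {X : Type u} {ι : Type u} {U : ι → Set X} {A : ι → Subalgebra K (X → K)}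
  {hcover : ∀ p, ∃ i, p ∈ U i} {hdir : ∀ i j, ∃ l, U l = U i ∩ U j ∧ A i ≤ A l ∧ A j ≤ A l}

/-- The generating sets form a basis and not only a subbasis: by `hdir`, two of them meet in the set
given by the product of their functions. -/
theorem exists_basic_of_mem_nhds {p : X} {s : Set X}
    (hs : s ∈ @nhds (ofFractions X U A hcover hdir) _ p) :
    ∃ i, ∃ a ∈ A i, p ∈ U i ∧ a p ≠ 0 ∧ {q | q ∈ U i ∧ a q ≠ 0} ⊆ s := by
  have hb : @TopologicalSpace.IsTopologicalBasis (ofFractions X U A hcover hdir) _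
      {S | ∃ i, ∃ a ∈ A i, S = {q | q ∈ U i ∧ a q ≠ 0}} := by
    refine ⟨?_, ?_, rfl⟩
    · rintro _ ⟨i, a, ha, rfl⟩ _ ⟨j, b, hb, rfl⟩ x ⟨hx1, hx2⟩
      obtain ⟨l, hl, h1, h2⟩ := hdir i j
      refine ⟨_, ⟨l, a * b, mul_mem (h1 ha) (h2 hb), rfl⟩, ?_, ?_⟩
      · exact ⟨hl ▸ ⟨hx1.1, hx2.1⟩, mul_ne_zero hx1.2 hx2.2⟩
      · rintro y ⟨hy1, hy2⟩
        rw [hl] at hy1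
        exact ⟨⟨hy1.1, left_ne_zero_of_mul hy2⟩, ⟨hy1.2, right_ne_zero_of_mul hy2⟩⟩
    · refine Set.eq_univ_of_forall fun x => ?_
      obtain ⟨i, hi⟩ := hcover x
      exact ⟨_, ⟨i, 1, (A i).one_mem, rfl⟩, hi, one_ne_zero⟩
  obtain ⟨_, ⟨i, a, ha, rfl⟩, hp, hsub⟩ := hb.mem_nhds_iff.1 hs
  exact ⟨i, a, ha, hp.1, hp.2, hsub⟩

theorem regAt_ofFractions {i : ι} {a : X → K} (ha : a ∈ A i) {p : X} (hp : p ∈ U i) :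
    (ofFractions X U A hcover hdir).RegAt a p :=
  ⟨i, hp, a, ha, 1, (A i).one_mem, by simp, Eventually.of_forall fun q => by simp⟩

/-- Basic open sets are nonvanishing loci of elements of `A i`, and regular functions are quotients
of such elements. So continuity and the pullback of regular functions both reduce to pulling back
the elements of `A i`. -/
theorem morphAt_ofFractions {Z : SpaceWithFunctions K} {φ : Z → ofFractions X U A hcover hdir}
    {p : Z} (h : ∀ i, φ p ∈ U i → (∀ᶠ z in 𝓝 p, φ z ∈ U i) ∧ ∀ a ∈ A i, Z.RegAt (a ∘ φ) p) :
    MorphAt φ p := by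
  have hc : ContinuousAt φ p := by
    intro s hs
    obtain ⟨i, a, ha, hp, hap, hsub⟩ := exists_basic_of_mem_nhds hs
    obtain ⟨h1, h2⟩ := h i hp
    rw [mem_map]
    filter_upwards [h1, Z.regAt_ne_zero _ _ (h2 a ha) hap] with z hz1 hz2
    exact hsub ⟨hz1, hz2⟩
  refine ⟨hc, ?_⟩
  rintro f ⟨i, hi, a, ha, b, hb, hbp, hf⟩
  exact Z.regAt_congr _ _ _ (regAt_div ((h i hi).2 a ha) ((h i hi).2 b hb) hbp)
    ((Tendsto.eventually (p := fun y => f y = (a / b) y) hc hf).mono fun _ h => h.symm)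

end OfFractions

theorem morphAt_affineSpace {V : Type u} [AddCommGroup V] [Module K V] {Z : SpaceWithFunctions K}
    {φ : Z → affineSpace K V} {p : Z}
    (h : ∀ l : Module.Dual K V, Z.RegAt (fun z => l (φ z)) p) : MorphAt φ p := by
  refine morphAt_ofFractions fun _ _ => ⟨Eventually.of_forall fun _ => Set.mem_univ _, ?_⟩
  intro a ha
  refine Algebra.adjoin_induction (p := fun a _ => Z.RegAt (a ∘ φ) p) ?_ ?_ ?_ ?_ ha
  · rintro _ ⟨l, rfl⟩
    exact h l
  · exact fun c => Z.regAt_const c p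
  · exact fun a b _ _ ha hb => Z.regAt_add _ _ _ ha hb
  · exact fun a b _ _ ha hb => Z.regAt_mul _ _ _ ha hb

theorem dual_mem_polynomialFunctions {V : Type u} [AddCommGroup V] [Module K V]
    (l : Module.Dual K V) : (l : V → K) ∈ polynomialFunctions K V :=
  Algebra.subset_adjoin ⟨l, rfl⟩

theorem regAt_polynomialFunctions {V : Type u} [AddCommGroup V] [Module K V]
    {a : V → K} (ha : a ∈ polynomialFunctions K V) (v : V) : (affineSpace K V).RegAt a v :=
  regAt_ofFractions (i := PUnit.unit) ha (Set.mem_univ _)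

theorem regAt_dual {V : Type u} [AddCommGroup V] [Module K V]
    (l : Module.Dual K V) (v : V) : (affineSpace K V).RegAt l v :=
  regAt_polynomialFunctions (dual_mem_polynomialFunctions l) v

theorem isMorphism_linearMap {V W : Type u} [AddCommGroup V] [Module K V] [AddCommGroup W]
    [Module K W] (T : V →ₗ[K] W) : IsMorphism (X := affineSpace K V) (Y := affineSpace K W) T :=
  isMorphism_iff.2 fun p => morphAt_affineSpace fun l => regAt_dual (l ∘ₗ T) p

/-! ### Products and their universal property -/

theorem isOpen_prod_basic {X Y : SpaceWithFunctions K} {U : Set X} {V : Set Y} (hU : IsOpen U)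
    (hV : IsOpen V) {a : X × Y → K} (ha : a ∈ productFunctions X Y U V) :
    IsOpen {q : prod X Y | fst q ∈ U ∧ snd q ∈ V ∧ a q ≠ 0} :=
  TopologicalSpace.isOpen_generateFrom_of_mem
    ⟨(⟨U, hU⟩, ⟨V, hV⟩), a, ha, by ext q; exact and_assoc.symm⟩

theorem exists_prod_basic_of_mem_nhds {X Y : SpaceWithFunctions K} {p : prod X Y}
    {s : Set (prod X Y)} (hs : s ∈ 𝓝 p) : ∃ (U : Set X) (V : Set Y), IsOpen U ∧ IsOpen V ∧
      fst p ∈ U ∧ snd p ∈ V ∧ ∃ a ∈ productFunctions X Y U V, a p ≠ 0 ∧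
        ∀ q : prod X Y, fst q ∈ U → snd q ∈ V → a q ≠ 0 → q ∈ s := by
  obtain ⟨⟨U, V⟩, a, ha, hp, hap, hsub⟩ := exists_basic_of_mem_nhds hs
  exact ⟨U, V, U.isOpen, V.isOpen, hp.1, hp.2, a, ha, hap, fun q h1 h2 h3 => hsub ⟨⟨h1, h2⟩, h3⟩⟩

theorem morphAt_fst {X Y : SpaceWithFunctions K} (p : prod X Y) :
    MorphAt (X := prod X Y) (Y := X) fst p := by
  refine ⟨?_, ?_⟩
  · intro s hs
    obtain ⟨U, hU, ho, hp⟩ := mem_nhds_iff.1 hs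
    rw [mem_map]
    filter_upwards [(isOpen_prod_basic ho isOpen_univ (one_mem _)).mem_nhds
      (show p ∈ _ from ⟨hp, trivial, one_ne_zero⟩)] with q hq
    exact hU hq.1
  · intro f hf
    obtain ⟨U, hU, ho, hp⟩ := eventually_nhds_iff.1 (X.regAt_eventually f _ hf)
    exact regAt_ofFractions (U := fun i : TopologicalSpace.Opens X × TopologicalSpace.Opens Y =>
        (i.1 : Set X) ×ˢ (i.2 : Set Y)) (A := fun i => productFunctions X Y i.1 i.2)
      (i := (⟨U, ho⟩, ⊤)) (Algebra.subset_adjoin (Or.inl ⟨f, hU, rfl⟩)) ⟨hp, trivial⟩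

theorem morphAt_snd {X Y : SpaceWithFunctions K} (p : prod X Y) :
    MorphAt (X := prod X Y) (Y := Y) snd p := by
  refine ⟨?_, ?_⟩
  · intro s hs
    obtain ⟨U, hU, ho, hp⟩ := mem_nhds_iff.1 hs
    rw [mem_map]
    filter_upwards [(isOpen_prod_basic isOpen_univ ho (one_mem _)).mem_nhds
      (show p ∈ _ from ⟨trivial, hp, one_ne_zero⟩)] with q hq
    exact hU hq.2.1
  · intro f hf
    obtain ⟨U, hU, ho, hp⟩ := eventually_nhds_iff.1 (Y.regAt_eventually f _ hf)
    exact regAt_ofFractions (U := fun i : TopologicalSpace.Opens X × TopologicalSpace.Opens Y =>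
        (i.1 : Set X) ×ˢ (i.2 : Set Y)) (A := fun i => productFunctions X Y i.1 i.2)
      (i := (⊤, ⟨U, ho⟩)) (Algebra.subset_adjoin (Or.inr ⟨f, hU, rfl⟩)) ⟨trivial, hp⟩

theorem continuous_fst {X Y : SpaceWithFunctions K} : Continuous (fst : prod X Y → X) :=
  continuous_iff_continuousAt.2 fun p => (morphAt_fst p).1

theorem MorphAt.fst {X Y Z : SpaceWithFunctions K} {φ : Z → prod X Y} {p : Z}
    (h : MorphAt φ p) : MorphAt (X := Z) (Y := X) (fun z => SpaceWithFunctions.fst (φ z)) p :=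
  (morphAt_fst _).comp h

theorem MorphAt.snd {X Y Z : SpaceWithFunctions K} {φ : Z → prod X Y} {p : Z}
    (h : MorphAt φ p) : MorphAt (X := Z) (Y := Y) (fun z => SpaceWithFunctions.snd (φ z)) p :=
  (morphAt_snd _).comp h

/-- The pair `(x, y)` as a point of the product. -/
def pair {X Y : SpaceWithFunctions K} (x : X) (y : Y) : prod X Y := (show X × Y from (x, y))

@[simp] theorem fst_pair {X Y : SpaceWithFunctions K} (x : X) (y : Y) : fst (pair x y) = x := rfl

@[simp] theorem snd_pair {X Y : SpaceWithFunctions K} (x : X) (y : Y) : snd (pair x y) = y := rfl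

theorem pair_fst_snd {X Y : SpaceWithFunctions K} (q : prod X Y) : pair (fst q) (snd q) = q := rfl

theorem prod_ext {X Y : SpaceWithFunctions K} {q q' : prod X Y} (h1 : fst q = fst q')
    (h2 : snd q = snd q') : q = q' := by
  rw [← pair_fst_snd q, ← pair_fst_snd q', h1, h2]

/-- The topology is not the product topology, but the functions that define it are generated by
functions of one factor, and these pull back along `φ` or `ψ`. -/
theorem MorphAt.pair {X Y Z : SpaceWithFunctions K} {φ : Z → X} {ψ : Z → Y} {p : Z}
    (hφ : MorphAt φ p) (hψ : MorphAt ψ p) :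
    MorphAt (X := Z) (Y := prod X Y) (fun z => SpaceWithFunctions.pair (φ z) (ψ z)) p := by
  refine morphAt_ofFractions ?_
  rintro ⟨U, V⟩ ⟨hU, hV⟩
  refine ⟨?_, ?_⟩
  · filter_upwards [hφ.eventually (U.isOpen.mem_nhds hU), hψ.eventually (V.isOpen.mem_nhds hV)]
      with z h1 h2
    exact ⟨h1, h2⟩
  · intro a ha
    refine Algebra.adjoin_induction
      (p := fun a _ => Z.RegAt (a ∘ fun z => SpaceWithFunctions.pair (φ z) (ψ z)) p) ?_ ?_ ?_ ?_ ha
    · rintro _ (⟨f, hf, rfl⟩ | ⟨f, hf, rfl⟩)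
      · exact hφ.regAt (hf _ hU)
      · exact hψ.regAt (hf _ hV)
    · exact fun c => Z.regAt_const c p
    · exact fun a b _ _ ha hb => Z.regAt_add _ _ _ ha hb
    · exact fun a b _ _ ha hb => Z.regAt_mul _ _ _ ha hb

/-! ### The universal property of the final structure -/

section Final

variable {ι : Type u} {X : ι → SpaceWithFunctions K} {Y : Type u} {π : ∀ i, X i → Y}

theorem regAt_final_iff {f : final X Y π → K} {y : final X Y π} :
    (final X Y π).RegAt f y ↔ ∀ᶠ y' in @nhds _ (final X Y π).top y,
      ∀ i (x : X i), π i x = y' → (X i).RegAt (fun z => f (π i z)) x := Iff.rfl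

theorem morphAt_final (π : ∀ i, X i → Y) (i : ι) (x : X i) :
    MorphAt (X := X i) (Y := final X Y π) (π i) x := by
  have hc : @Continuous (X i) (final X Y π) (X i).top (final X Y π).top (π i) :=
    continuous_iff_coinduced_le.2 (le_iSup (fun i => TopologicalSpace.coinduced (π i) (X i).top) i)
  exact ⟨@Continuous.continuousAt (X i) (final X Y π) _ _ _ _ hc, fun f hf =>
    (@Eventually.self_of_nhds _ (final X Y π).top _ _ (regAt_final_iff.1 hf)) i x rfl⟩

theorem isMorphism_of_final {Z : SpaceWithFunctions K} {φ : final X Y π → Z}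
    (h : ∀ i, IsMorphism (X := X i) (Y := Z) (fun x => φ (π i x))) : IsMorphism φ := by
  have hc : Continuous φ := continuous_iSup_dom.2 fun i => continuous_coinduced_dom.2 (h i).1
  refine ⟨hc, fun f p hf => ?_⟩
  -- Regularity for the final structure is a condition at all points near `p`, so the regularity of
  -- `f` is first spread to a neighbourhood.
  filter_upwards [hc.continuousAt.eventually (Z.regAt_eventually _ _ hf)]
  rintro _ hy i x rfl
  exact (h i).2 f x hy

theorem isOpen_final {S : Set (final X Y π)} :
    IsOpen S ↔ ∀ i, IsOpen {x : X i | π i x ∈ S} := by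
  exact isOpen_iSup_iff.trans (forall_congr' fun i => isOpen_coinduced)

end Final

/-- A set is closed if each point outside of it is separated from it by a function that is
regular at the point. -/
theorem isClosed_of_separating {X : SpaceWithFunctions K} {T : Set X}
    (h : ∀ p ∉ T, ∃ f, X.RegAt f p ∧ f p ≠ 0 ∧ ∀ᶠ q in 𝓝 p, q ∈ T → f q = 0) : IsClosed T := by
  rw [← isOpen_compl_iff, isOpen_iff_mem_nhds]
  intro p hp
  obtain ⟨f, hf, hfp, hfT⟩ := h p hp
  filter_upwards [X.regAt_ne_zero f p hf hfp, hfT] with q h1 h2 h3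
  exact h1 (h2 h3)

/-! ### Regular maps in coordinates -/

theorem morphAt_of_basis {V : Type u} [AddCommGroup V] [Module K V] {ι : Type*} [Finite ι]
    (b : Module.Basis ι K V) {Z : SpaceWithFunctions K} {φ : Z → affineSpace K V} {p : Z}
    (h : ∀ i, Z.RegAt (fun z => b.repr (φ z) i) p) : MorphAt φ p := by
  have := Fintype.ofFinite ι
  refine morphAt_affineSpace fun l => ?_
  have : (fun z => l (φ z)) = fun z => ∑ i, b.repr (φ z) i * l (b i) := by
    funext z
    conv_lhs => rw [← b.sum_repr (φ z)]
    simp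
  rw [this]
  exact regAt_sum _ _ fun i _ => Z.regAt_mul _ _ _ (h i) (Z.regAt_const _ p)

theorem morphAt_matrix {ι κ : Type} [Fintype ι] [Fintype κ] [DecidableEq ι] [DecidableEq κ]
    {Z : SpaceWithFunctions K} {φ : Z → Matrix ι κ K} {p : Z}
    (h : ∀ i j, Z.RegAt (fun z => φ z i j) p) :
    MorphAt (X := Z) (Y := affineSpace K (Matrix ι κ K)) φ p :=
  morphAt_of_basis (Matrix.stdBasis K ι κ) fun ij => h ij.1 ij.2

theorem morphAt_pi {ι : Type} [Fintype ι] [DecidableEq ι]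
    {Z : SpaceWithFunctions K} {φ : Z → ι → K} {p : Z}
    (h : ∀ i, Z.RegAt (fun z => φ z i) p) :
    MorphAt (X := Z) (Y := affineSpace K (ι → K)) φ p :=
  morphAt_of_basis (Pi.basisFun K ι) h

theorem morphAt_affineSpace_prod {V W : Type u} [AddCommGroup V] [Module K V] [AddCommGroup W]
    [Module K W] {Z : SpaceWithFunctions K} {φ : Z → V} {ψ : Z → W} {p : Z}
    (h1 : MorphAt (X := Z) (Y := affineSpace K V) φ p)
    (h2 : MorphAt (X := Z) (Y := affineSpace K W) ψ p) :
    MorphAt (X := Z) (Y := affineSpace K (V × W)) (fun z => (φ z, ψ z)) p := by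
  refine morphAt_affineSpace fun l => ?_
  have := Z.regAt_add _ _ _ (h1.regAt (regAt_dual (l ∘ₗ LinearMap.inl K V W) _))
    (h2.regAt (regAt_dual (l ∘ₗ LinearMap.inr K V W) _))
  convert this using 1
  funext z
  simp [← map_add]

theorem MorphAt.regAt_dual {V : Type u} [AddCommGroup V] [Module K V] {Z : SpaceWithFunctions K}
    {φ : Z → affineSpace K V} {p : Z} (h : MorphAt φ p) (l : Module.Dual K V) :
    Z.RegAt (fun z => l (φ z)) p :=
  h.regAt (SpaceWithFunctions.regAt_dual l _)

theorem MorphAt.regAt_entry {ι κ : Type} {Z : SpaceWithFunctions K}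
    {φ : Z → Matrix ι κ K} {p : Z} (h : MorphAt (X := Z) (Y := affineSpace K (Matrix ι κ K)) φ p)
    (i : ι) (j : κ) : Z.RegAt (fun z => φ z i j) p :=
  h.regAt_dual (V := Matrix ι κ K) (Matrix.entryLinearMap K K i j)

theorem regAt_inv_matrix {X : SpaceWithFunctions K} {p : X} {ι : Type*} [Fintype ι] [DecidableEq ι]
    {M : X → Matrix ι ι K} (h : ∀ i j, X.RegAt (fun x => M x i j) p) (hp : (M p).det ≠ 0)
    (i j : ι) : X.RegAt (fun x => (M x)⁻¹ i j) p := by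
  have : (fun x => (M x)⁻¹ i j) = (fun x => (M x).adjugate i j) / fun x => (M x).det := by
    funext x
    simp [Matrix.inv_def, div_eq_inv_mul]
  rw [this]
  exact regAt_div (regAt_adjugate h i j) (regAt_det M h) hp

theorem regAt_mulVec {X : SpaceWithFunctions K} {p : X} {ι κ : Type*} [Fintype κ]
    {M : X → Matrix ι κ K} {v : X → κ → K} (hM : ∀ i j, X.RegAt (fun x => M x i j) p)
    (hv : ∀ j, X.RegAt (fun x => v x j) p) (i : ι) :
    X.RegAt (fun x => ((M x).mulVec (v x)) i) p := by
  simp only [Matrix.mulVec, dotProduct]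
  exact regAt_sum _ _ fun l _ => X.regAt_mul _ _ _ (hM _ _) (hv _)

theorem regAt_sub {X : SpaceWithFunctions K} {p : X} {f g : X → K} (hf : X.RegAt f p)
    (hg : X.RegAt g p) : X.RegAt (fun x => f x - g x) p :=
  (X.regularAt p).sub_mem hf hg

/-- `X` is separated: its diagonal is closed. -/
def IsSeparated (X : SpaceWithFunctions K) : Prop := IsClosed {q : prod X X | fst q = snd q}

/-- The set is the preimage of the diagonal under `(f, g)`. -/
theorem IsSeparated.isClosed_eq {X Z : SpaceWithFunctions K} (h : IsSeparated X) {f g : Z → X}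
    (hf : IsMorphism f) (hg : IsMorphism g) : IsClosed {z | f z = g z} :=
  IsClosed.preimage (X := Z) (Y := prod X X) (f := fun z => pair (f z) (g z))
    (isMorphism_iff.2 fun p => (hf.morphAt p).pair (hg.morphAt p)).1 h

theorem isMorphism_fst {X Y : SpaceWithFunctions K} :
    IsMorphism (X := prod X Y) (Y := X) fst := isMorphism_iff.2 morphAt_fst

theorem isMorphism_snd {X Y : SpaceWithFunctions K} :
    IsMorphism (X := prod X Y) (Y := Y) snd := isMorphism_iff.2 morphAt_snd

theorem IsSeparated.prod {X Y : SpaceWithFunctions K} (hX : IsSeparated X) (hY : IsSeparated Y) :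
    IsSeparated (X.prod Y) := by
  have h1 := hX.isClosed_eq (isMorphism_fst.comp (isMorphism_fst (X := X.prod Y) (Y := X.prod Y)))
    (isMorphism_fst.comp isMorphism_snd)
  have h2 := hY.isClosed_eq (isMorphism_snd.comp (isMorphism_fst (X := X.prod Y) (Y := X.prod Y)))
    (isMorphism_snd.comp isMorphism_snd)
  rw [IsSeparated]
  convert h1.inter h2 using 1
  ext q
  exact ⟨fun h => ⟨congrArg fst h, congrArg snd h⟩, fun h => prod_ext h.1 h.2⟩

theorem IsSeparated.restrict {X : SpaceWithFunctions K} (hX : IsSeparated X) (S : Set X) :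
    IsSeparated (X.restrict S) := by
  have h1 := hX.isClosed_eq ((isMorphism_val S).comp (isMorphism_fst (Y := X.restrict S)))
    ((isMorphism_val S).comp isMorphism_snd)
  rw [IsSeparated]
  convert h1 using 1
  ext q
  exact ⟨fun h => congrArg Subtype.val h, fun h => Subtype.ext h⟩

/-! ### Projective spaces -/

section Projective

variable {V : Type u} [AddCommGroup V] [Module K V]

/-- The point of projective space given by a nonzero vector. -/
def projPoint (v : V) (h : v ≠ 0) : projectiveSpace K V := Projectivization.mk K v h

/-- A representative of a point of projective space. -/
noncomputable def projRep (p : projectiveSpace K V) : V :=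
  Projectivization.rep (K := K) (V := V) p

theorem projRep_ne_zero (p : projectiveSpace K V) : projRep p ≠ 0 := Projectivization.rep_nonzero _

theorem projPoint_projRep (p : projectiveSpace K V) :
    projPoint (projRep p) (projRep_ne_zero p) = p := Projectivization.mk_rep _

theorem exists_projPoint (p : projectiveSpace K V) : ∃ v, ∃ h : v ≠ 0, p = projPoint v h :=
  ⟨_, _, (projPoint_projRep p).symm⟩

theorem projPoint_eq_iff {v w : V} {hv : v ≠ 0} {hw : w ≠ 0} :
    (projPoint v hv : projectiveSpace K V) = projPoint w hw ↔ ∃ c : K, c • w = v :=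
  Projectivization.mk_eq_mk_iff' K v w hv hw

theorem exists_projRep_projPoint (v : V) (h : v ≠ 0) :
    ∃ c : K, c ≠ 0 ∧ projRep (projPoint v h : projectiveSpace K V) = c • v := by
  obtain ⟨c, hc⟩ := Projectivization.exists_smul_eq_mk_rep K v h
  exact ⟨c, c.ne_zero, hc.symm⟩

/-- The vector underlying a point of `V ∖ {0}`. -/
def vecVal (x : (affineSpace K V).restrict {v : V | v ≠ 0}) : V := x.1

theorem vecVal_ne_zero (x : (affineSpace K V).restrict {v : V | v ≠ 0}) : vecVal x ≠ 0 := x.2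

theorem morphAt_vecVal (x : (affineSpace K V).restrict {v : V | v ≠ 0}) :
    MorphAt (X := (affineSpace K V).restrict {v : V | v ≠ 0}) (Y := affineSpace K V) vecVal x :=
  (isMorphism_val _).morphAt x

theorem isOpen_projectiveSpace {S : Set (projectiveSpace K V)} :
    IsOpen S ↔ IsOpen {x : (affineSpace K V).restrict {v : V | v ≠ 0} |
      (projPoint (vecVal x) (vecVal_ne_zero x) : projectiveSpace K V) ∈ S} :=
  isOpen_final.trans ⟨fun h => h PUnit.unit, fun h _ => h⟩

/-- Whether a linear form vanishes does not depend on the representative, so the preimage in `V ∖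
{0}` is a nonvanishing locus. -/
theorem isOpen_projRep_ne_zero (l : Module.Dual K V) :
    IsOpen {p : projectiveSpace K V | l (projRep p) ≠ 0} := by
  rw [isOpen_projectiveSpace]
  have : {x : (affineSpace K V).restrict {v : V | v ≠ 0} |
      (projPoint (vecVal x) (vecVal_ne_zero x) : projectiveSpace K V) ∈
        {p : projectiveSpace K V | l (projRep p) ≠ 0}} =
      {x | l (vecVal x) ≠ 0} := by
    ext x
    obtain ⟨c, hc, h⟩ := exists_projRep_projPoint (K := K) (vecVal x) (vecVal_ne_zero x)
    simp only [Set.mem_ofPred_eq, h, map_smul, smul_eq_mul]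
    exact ⟨right_ne_zero_of_mul, mul_ne_zero hc⟩
  rw [this]
  refine isOpen_iff_mem_nhds.2 fun x hx => ?_
  exact ((affineSpace K V).restrict _).regAt_ne_zero _ x
    ((morphAt_vecVal x).regAt_dual l) hx

/-- The representative of `p` at which the linear form `l` takes the value `1`, where `l` does not
vanish at `p`. -/
noncomputable def projNormalize (l : Module.Dual K V) (p : projectiveSpace K V) : V :=
  (l (projRep p))⁻¹ • projRep p

theorem projNormalize_projPoint (l : Module.Dual K V) (v : V) (h : v ≠ 0) :
    projNormalize l (projPoint v h) = (l v)⁻¹ • v := by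
  obtain ⟨c, hc, h⟩ := exists_projRep_projPoint (K := K) v h
  rw [projNormalize, h, map_smul, smul_smul, smul_eq_mul, mul_inv, mul_comm, ← mul_assoc,
    mul_inv_cancel₀ hc, one_mul]

theorem apply_projNormalize {l : Module.Dual K V} {p : projectiveSpace K V}
    (h : l (projRep p) ≠ 0) : l (projNormalize l p) = 1 := by
  rw [projNormalize, map_smul, smul_eq_mul, inv_mul_cancel₀ h]

theorem projNormalize_ne_zero {l : Module.Dual K V} {p : projectiveSpace K V}
    (h : l (projRep p) ≠ 0) : projNormalize l p ≠ 0 :=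
  smul_ne_zero (inv_ne_zero h) (projRep_ne_zero p)

theorem projPoint_projNormalize {l : Module.Dual K V} {p : projectiveSpace K V}
    (h : l (projRep p) ≠ 0) : projPoint (projNormalize l p) (projNormalize_ne_zero h) = p := by
  conv_rhs => rw [← projPoint_projRep p]
  exact projPoint_eq_iff.2 ⟨_, rfl⟩

theorem exists_dual_projRep_ne_zero (p : projectiveSpace K V) :
    ∃ l : Module.Dual K V, l (projRep p) ≠ 0 := by
  by_contra! h
  exact projRep_ne_zero p ((Module.forall_dual_apply_eq_zero_iff K _).1 h)

/-- A local section of `V ∖ {0} → ℙ(V)`: composed with a linear form `l'` it is the fraction `l' /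
l`. It lets conditions on lines be checked on vectors. -/
theorem morphAt_projNormalize {l : Module.Dual K V} {p : projectiveSpace K V}
    (h : l (projRep p) ≠ 0) :
    MorphAt (X := projectiveSpace K V) (Y := affineSpace K V) (projNormalize l) p := by
  refine morphAt_affineSpace fun l' => ?_
  refine regAt_final_iff.2 ?_
  filter_upwards [(isOpen_projRep_ne_zero l).mem_nhds h]
  rintro _ hy _ x rfl
  have hx : l (vecVal x) ≠ 0 := by
    obtain ⟨c, hc, h⟩ := exists_projRep_projPoint (K := K) (vecVal x) (vecVal_ne_zero x)
    have : l (projRep (projPoint (vecVal x) (vecVal_ne_zero x) : projectiveSpace K V)) ≠ 0 := hy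
    rw [h, map_smul] at this
    exact right_ne_zero_of_mul this
  have := regAt_div ((morphAt_vecVal x).regAt_dual l') ((morphAt_vecVal x).regAt_dual l) hx
  convert this using 1
  funext z
  have (v : V) (hv : v ≠ 0) : l' (projNormalize l (projPoint v hv)) = l' v / l v := by
    rw [projNormalize_projPoint, map_smul, smul_eq_mul, div_eq_inv_mul]
  exact this (vecVal z) (vecVal_ne_zero z)

/-- Projective space is a quotient of `V ∖ {0}`, so a regular lift near the point suffices. -/
theorem morphAt_projectiveSpace {Z : SpaceWithFunctions K} {f : Z → projectiveSpace K V}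
    {F : Z → V} {p : Z} (hF : MorphAt (X := Z) (Y := affineSpace K V) F p)
    (h : ∀ᶠ z in 𝓝 p, ∃ hz : F z ≠ 0, f z = projPoint (F z) hz) : MorphAt f p := by
  obtain ⟨F', hF', he⟩ := hF.exists_restrict (S := {v : V | v ≠ 0}) (h.mono fun z hz => by
    obtain ⟨hz, -⟩ := hz
    exact hz)
  have := (morphAt_final (X := fun _ : PUnit => (affineSpace K V).restrict {v : V | v ≠ 0})
    (fun _ v => Projectivization.mk K (V := V) v.1 v.2) PUnit.unit (F' p)).comp hF'
  refine MorphAt.congr this ?_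
  filter_upwards [h, he] with z ⟨hz, hfz⟩ hFz
  rw [hfz]
  exact projPoint_eq_iff.2 ⟨1, by rw [one_smul]; exact hFz.symm⟩

theorem isSeparated_projectiveSpace : IsSeparated (projectiveSpace K V) := by
  refine isClosed_of_separating fun q hq => ?_
  obtain ⟨l, hl⟩ := exists_dual_projRep_ne_zero (fst q)
  obtain ⟨l', hl'⟩ := exists_dual_projRep_ne_zero (snd q)
  -- With the normalized representatives `v` and `v'`, the vector `v - l'(v) v'` is zero only if the
  -- two lines agree. A linear form that does not kill it provides the function that separates `q`
  -- from the diagonal.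
  have hne : projNormalize l (fst q) -
      l' (projNormalize l (fst q)) • projNormalize l' (snd q) ≠ 0 := by
    intro h
    refine hq (?_ : fst q = snd q)
    rw [← projPoint_projNormalize hl, ← projPoint_projNormalize hl']
    exact projPoint_eq_iff.2 ⟨_, (sub_eq_zero.1 h).symm⟩
  obtain ⟨m, hm⟩ : ∃ m : Module.Dual K V, m (projNormalize l (fst q) -
      l' (projNormalize l (fst q)) • projNormalize l' (snd q)) ≠ 0 := by
    by_contra! h
    exact hne ((Module.forall_dual_apply_eq_zero_iff K _).1 h)
  have h1 := (morphAt_projNormalize hl).comp (morphAt_fst q)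
  have h2 := (morphAt_projNormalize hl').comp (morphAt_snd q)
  refine ⟨fun q => m (projNormalize l (fst q)) -
    l' (projNormalize l (fst q)) * m (projNormalize l' (snd q)), ?_, ?_, ?_⟩
  · exact regAt_sub (h1.regAt_dual m)
      ((prod _ _).regAt_mul _ _ _ (h1.regAt_dual l') (h2.regAt_dual m))
  · simpa using hm
  · filter_upwards [(morphAt_fst q).eventually ((isOpen_projRep_ne_zero l).mem_nhds hl),
      (morphAt_snd q).eventually ((isOpen_projRep_ne_zero l').mem_nhds hl')] with q' h3 h4 h5
    have h5' : fst q' = snd q' := h5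
    rw [← h5'] at h4 ⊢
    simp only [projNormalize, map_smul, smul_eq_mul]
    have h3' : l (projRep (fst q')) ≠ 0 := h3
    have h4' : l' (projRep (fst q')) ≠ 0 := h4
    field_simp
    ring

end Projective

/-! ### The Grassmannian -/

section Grassmannian

variable {k n : ℕ}

theorem finrank_subspace (Λ : grassmannian K k n) : Module.finrank K (subspace K Λ) = k := Λ.2

theorem subspace_injective : Function.Injective (subspace K : grassmannian K k n → _) :=
  Subtype.val_injective

theorem subspace_eq_of_le {Λ Λ' : grassmannian K k n} (h : subspace K Λ ≤ subspace K Λ') :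
    Λ = Λ' :=
  subspace_injective (Submodule.eq_of_le_of_finrank_eq h
    (by rw [finrank_subspace, finrank_subspace]))

/-- The Grassmannian is a quotient of the space of frames, so a basis with regular entries near the
point suffices. -/
theorem morphAt_grassmannian {Z : SpaceWithFunctions K} {f : Z → grassmannian K k n}
    {F : Z → Fin k → Fin n → K} {p : Z} (hF : ∀ i j, Z.RegAt (fun z => F z i j) p)
    (h : ∀ᶠ z in 𝓝 p, LinearIndependent K (F z) ∧
      subspace K (f z) = Submodule.span K (Set.range (F z))) : MorphAt f p := by
  have hF' : MorphAt (X := Z) (Y := affineSpace K (Fin k → Fin n → K)) F p := by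
    refine morphAt_of_basis (Pi.basis fun _ : Fin k => Pi.basisFun K (Fin n)) ?_
    rintro ⟨i, j⟩
    have : (fun z => (Pi.basis fun _ : Fin k => Pi.basisFun K (Fin n)).repr (F z) ⟨i, j⟩) =
        fun z => F z i j := by
      funext z
      rw [Pi.basis_repr, Pi.basisFun_repr]
    exact this ▸ hF i j
  obtain ⟨F', hF', he⟩ := hF'.exists_restrict (S := {a | LinearIndependent K a})
    (h.mono fun z hz => by exact hz.1)
  have := (morphAt_final (X := fun _ : PUnit => frames K k n)
    (fun _ => frameSpan K k n) PUnit.unit (F' p)).comp hF'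
  refine MorphAt.congr this ?_
  filter_upwards [h, he] with z ⟨_, hfz⟩ hFz
  refine subspace_injective ?_
  rw [hfz, ← hFz]
  rfl

/-! ### Coordinates on the charts -/

/-- The linear map `Kⁿ → Kⁿ⁻ᵏ` with kernel `Λ` that is a left inverse of `s`, for `Λ` in the
chart of `s`. -/
noncomputable def quotientCoord (s : (Fin (n - k) → K) →ₗ[K] (Fin n → K))
    (Λ : grassmannian K k n) : (Fin n → K) →ₗ[K] (Fin (n - k) → K) :=
  open Classical in
  if h : Λ ∈ quotientChart K s then
    (LinearEquiv.ofBijective (frameOfQuotient K s Λ) h).symm.toLinearMap ∘ₗ (subspace K Λ).mkQ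
  else 0

variable {s : (Fin (n - k) → K) →ₗ[K] (Fin n → K)} {Λ : grassmannian K k n}

theorem quotientCoord_apply (h : Λ ∈ quotientChart K s) (v : Fin n → K) :
    quotientCoord s Λ v =
      (LinearEquiv.ofBijective (frameOfQuotient K s Λ) h).symm ((subspace K Λ).mkQ v) := by
  rw [quotientCoord, dif_pos h]
  rfl

theorem ker_quotientCoord (h : Λ ∈ quotientChart K s) :
    LinearMap.ker (quotientCoord s Λ) = subspace K Λ := by
  rw [quotientCoord, dif_pos h, LinearMap.ker_comp, LinearEquiv.ker]
  exact Submodule.ker_mkQ _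

theorem quotientCoord_section (h : Λ ∈ quotientChart K s) (u : Fin (n - k) → K) :
    quotientCoord s Λ (s u) = u := by
  rw [quotientCoord_apply h]
  exact (LinearEquiv.ofBijective (frameOfQuotient K s Λ) h).symm_apply_apply u

theorem mem_quotientChart_of_ker {c : (Fin n → K) →ₗ[K] (Fin (n - k) → K)}
    (hc : LinearMap.ker c = subspace K Λ) (hs : ∀ u, c (s u) = u) : Λ ∈ quotientChart K s := by
  refine ⟨fun u v h => ?_, fun y => ?_⟩
  · have : s u - s v ∈ subspace K Λ := (Submodule.Quotient.eq _).1 h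
    rw [← hc, LinearMap.mem_ker, map_sub, hs, hs] at this
    exact sub_eq_zero.1 this
  · obtain ⟨v, rfl⟩ := Submodule.mkQ_surjective _ y
    refine ⟨c v, ?_⟩
    refine (Submodule.Quotient.eq _).2 ?_
    rw [← hc, LinearMap.mem_ker, map_sub, hs, sub_self]

/-- Uniqueness: `v - s (c v)` lies in the common kernel, and both maps are left inverses of `s`.
This recognizes `quotientCoord` from matrices obtained in other ways. -/
theorem quotientCoord_eq_of_ker {c : (Fin n → K) →ₗ[K] (Fin (n - k) → K)}
    (hc : LinearMap.ker c = subspace K Λ) (hs : ∀ u, c (s u) = u) : quotientCoord s Λ = c := by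
  have h := mem_quotientChart_of_ker hc hs
  refine LinearMap.ext fun v => ?_
  have : v - s (c v) ∈ LinearMap.ker (quotientCoord s Λ) := by
    rw [ker_quotientCoord h, ← hc, LinearMap.mem_ker, map_sub, hs, sub_self]
  rw [LinearMap.mem_ker, map_sub, quotientCoord_section h] at this
  exact sub_eq_zero.1 this

theorem regAt_quotientCoord (h : Λ ∈ quotientChart K s) (v : Fin n → K) (c : Fin (n - k)) :
    (grassmannian K k n).RegAt (fun Λ => quotientCoord s Λ v c) Λ := by
  have h1 := regAt_quotient_coordinate s s v c ⟨Λ, h, h⟩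
  refine (regAt_restrict_iff_of_isOpen ((isOpen_quotientChart s).inter (isOpen_quotientChart s))
    (p := ⟨Λ, h, h⟩)).1 ?_
  refine ((grassmannian K k n).restrict _).regAt_congr _ _ _ h1 (Eventually.of_forall fun x => ?_)
  exact (congrFun (quotientCoord_apply x.2.1 v) c).symm

/-- The matrix of `quotientCoord`. -/
noncomputable def quotientMatrix (s : (Fin (n - k) → K) →ₗ[K] (Fin n → K))
    (Λ : grassmannian K k n) : Matrix (Fin (n - k)) (Fin n) K :=
  LinearMap.toMatrix' (quotientCoord s Λ)

theorem quotientMatrix_mulVec (s : (Fin (n - k) → K) →ₗ[K] (Fin n → K))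
    (Λ : grassmannian K k n) (v : Fin n → K) :
    (quotientMatrix s Λ).mulVec v = quotientCoord s Λ v := LinearMap.toMatrix'_mulVec _ _

theorem mulVecLin_quotientMatrix (s : (Fin (n - k) → K) →ₗ[K] (Fin n → K))
    (Λ : grassmannian K k n) : (quotientMatrix s Λ).mulVecLin = quotientCoord s Λ :=
  LinearMap.ext (quotientMatrix_mulVec s Λ)

theorem regAt_quotientMatrix (h : Λ ∈ quotientChart K s) (i : Fin (n - k)) (j : Fin n) :
    (grassmannian K k n).RegAt (fun Λ => quotientMatrix s Λ i j) Λ := by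
  have := regAt_quotientCoord h (Pi.single j 1) i
  convert this using 1
  funext Λ
  rw [quotientMatrix, LinearMap.toMatrix'_apply]

theorem quotientMatrix_mul_section (h : Λ ∈ quotientChart K s) :
    quotientMatrix s Λ * LinearMap.toMatrix' s = 1 := by
  rw [quotientMatrix, ← LinearMap.toMatrix'_comp, ← LinearMap.toMatrix'_id]
  congr 1
  exact LinearMap.ext (quotientCoord_section h)

/-- A vector killed by `v ↦ v - s (c v)` lies in the image of `s`, which meets `ker c₀` only in
zero. So this map is injective on `ker c₀`, whatever `c` is. -/
theorem linearIndependent_sub_section {a : Fin k → Fin n → K} (ha : LinearIndependent K a)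
    {c₀ c : (Fin n → K) →ₗ[K] (Fin (n - k) → K)} (ha₀ : ∀ i, c₀ (a i) = 0)
    (hs₀ : ∀ u, c₀ (s u) = u) : LinearIndependent K fun i => a i - s (c (a i)) := by
  rw [Fintype.linearIndependent_iff] at ha ⊢
  intro g hg
  refine ha g ?_
  have h1 : ∑ i, g i • a i = s (∑ i, g i • c (a i)) := by
    rw [← sub_eq_zero, ← hg, map_sum, ← Finset.sum_sub_distrib]
    simp [smul_sub]
  have h2 : c₀ (∑ i, g i • a i) = 0 := by
    simp [ha₀]
  rw [h1, hs₀] at h2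
  rw [h1, h2, map_zero]

theorem span_sub_section {a : Fin k → Fin n → K}
    {c : (Fin n → K) →ₗ[K] (Fin (n - k) → K)} (hs : ∀ u, c (s u) = u)
    (hc : LinearMap.ker c = subspace K Λ)
    (hli : LinearIndependent K fun i => a i - s (c (a i))) :
    subspace K Λ = Submodule.span K (Set.range fun i => a i - s (c (a i))) := by
  symm
  refine Submodule.eq_of_le_of_finrank_eq ?_ ?_
  · rw [Submodule.span_le]
    rintro _ ⟨i, rfl⟩
    rw [SetLike.mem_coe, ← hc, LinearMap.mem_ker, map_sub, hs, sub_self]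
  · rw [finrank_subspace, finrank_span_eq_card hli, Fintype.card_fin]

/-- On the chart of `s`, subspaces have a basis that depends regularly on them. -/
theorem exists_regular_frame (h : Λ ∈ quotientChart K s) :
    ∃ F : grassmannian K k n → Fin k → Fin n → K,
      (∀ i j, (grassmannian K k n).RegAt (fun Λ => F Λ i j) Λ) ∧
      ∀ Λ' ∈ quotientChart K s, LinearIndependent K (F Λ') ∧
        subspace K Λ' = Submodule.span K (Set.range (F Λ')) := by
  obtain ⟨a, ha⟩ := exists_frame Λ
  -- A fixed basis of `Λ`, projected to `Λ'` along the image of `s`, which is complementary to both.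
  refine ⟨fun Λ' i => frameVal a i - s (quotientCoord s Λ' (frameVal a i)), ?_, ?_⟩
  · intro i j
    simp only [Pi.sub_apply]
    refine regAt_sub ((grassmannian K k n).regAt_const _ _) ?_
    have : (fun Λ' => s (quotientCoord s Λ' (frameVal a i)) j) = fun Λ' =>
        ∑ c, LinearMap.toMatrix' s j c * quotientCoord s Λ' (frameVal a i) c := by
      funext Λ'
      rw [← LinearMap.toMatrix'_mulVec]
      rfl
    rw [this]
    exact regAt_sum _ _ fun c _ => (grassmannian K k n).regAt_mul _ _ _
      ((grassmannian K k n).regAt_const _ _) (regAt_quotientCoord h _ _)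
  · intro Λ' h'
    have hli := linearIndependent_sub_section (frameVal_linearIndependent a)
      (c₀ := quotientCoord s Λ) (c := quotientCoord s Λ') (s := s) ?_ (quotientCoord_section h)
    · exact ⟨hli, span_sub_section (quotientCoord_section h') (ker_quotientCoord h') hli⟩
    · intro i
      rw [← LinearMap.mem_ker, ker_quotientCoord h, ← ha]
      exact Submodule.subset_span ⟨i, rfl⟩

/-- The kernel of a surjective matrix depends regularly on the matrix. -/
theorem morphAt_ker {Z : SpaceWithFunctions K} {f : Z → grassmannian K k n}
    {F : Z → Matrix (Fin (n - k)) (Fin n) K} {p : Z} (hF : ∀ i j, Z.RegAt (fun z => F z i j) p)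
    (h : ∀ᶠ z in 𝓝 p, LinearMap.ker (F z).mulVecLin = subspace K (f z)) : MorphAt f p := by
  obtain ⟨a, ha⟩ := exists_frame (f p)
  have hk := h.self_of_nhds
  have hsurj : LinearMap.range (F p).mulVecLin = ⊤ := by
    refine Submodule.eq_top_of_finrank_eq ?_
    have h1 := LinearMap.finrank_range_add_finrank_ker (F p).mulVecLin
    have h2 := le_of_grassmannian (f p)
    rw [hk, finrank_subspace] at h1
    simp only [Module.finrank_fintype_fun_eq_card, Fintype.card_fin] at h1 ⊢
    omega
  obtain ⟨s, hs⟩ := LinearMap.exists_rightInverse_of_surjective _ hsurj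
  have hone : F p * LinearMap.toMatrix' s = 1 := by
    rw [← LinearMap.toMatrix'_id, ← hs, LinearMap.toMatrix'_comp,
      ← Matrix.toLin'_apply', LinearMap.toMatrix'_toLin']
  have hreg : ∀ i j, Z.RegAt (fun z => (F z * LinearMap.toMatrix' s) i j) p :=
    regAt_matrix_mul hF (N := fun _ => LinearMap.toMatrix' s) fun _ _ => Z.regAt_const _ _
  have hdet : (F p * LinearMap.toMatrix' s).det ≠ 0 := by simp [hone]
  -- `F z` rescaled to be a left inverse of `s`. Where the determinant is nonzero this keeps the
  -- kernel, and `v ↦ v - s (C z v)` carries the fixed basis of `f p` to one of `f z`.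
  let C : Z → Matrix (Fin (n - k)) (Fin n) K := fun z => (F z * LinearMap.toMatrix' s)⁻¹ * F z
  have hC : ∀ i j, Z.RegAt (fun z => C z i j) p :=
    regAt_matrix_mul (regAt_inv_matrix hreg hdet) hF
  have hCs : ∀ z, (F z * LinearMap.toMatrix' s).det ≠ 0 →
      ∀ u, (C z).mulVecLin (s u) = u := by
    intro z hz u
    have : s u = (LinearMap.toMatrix' s).mulVec u := (LinearMap.toMatrix'_mulVec _ _).symm
    rw [Matrix.mulVecLin_apply, this, Matrix.mulVec_mulVec, Matrix.mul_assoc,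
      Matrix.nonsing_inv_mul _ (isUnit_iff_ne_zero.2 hz), Matrix.one_mulVec]
  have hCk : ∀ z, (F z * LinearMap.toMatrix' s).det ≠ 0 →
      LinearMap.ker (C z).mulVecLin = LinearMap.ker (F z).mulVecLin := by
    intro z hz
    ext v
    simp only [LinearMap.mem_ker, Matrix.mulVecLin_apply, C]
    rw [← Matrix.mulVec_mulVec]
    refine ⟨fun h => ?_, fun h => by rw [h, Matrix.mulVec_zero]⟩
    have := congrArg (F z * LinearMap.toMatrix' s).mulVec h
    rwa [Matrix.mulVec_mulVec, Matrix.mul_nonsing_inv _ (isUnit_iff_ne_zero.2 hz),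
      Matrix.one_mulVec, Matrix.mulVec_zero] at this
  refine morphAt_grassmannian
    (F := fun z i => frameVal a i - s ((C z).mulVecLin (frameVal a i))) ?_ ?_
  · intro i j
    have : (fun z => (frameVal a i - s ((C z).mulVecLin (frameVal a i))) j) = fun z =>
        frameVal a i j - ((LinearMap.toMatrix' s * C z).mulVec (frameVal a i)) j := by
      funext z
      rw [← Matrix.mulVec_mulVec, LinearMap.toMatrix'_mulVec]
      rfl
    rw [this]
    exact regAt_sub (Z.regAt_const _ _) (regAt_mulVec (v := fun _ => frameVal a i)
      (regAt_matrix_mul (M := fun _ => LinearMap.toMatrix' s) (fun _ _ => Z.regAt_const _ _) hC)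
      (fun _ => Z.regAt_const _ _) j)
  · filter_upwards [h, Z.regAt_ne_zero _ _ (regAt_det _ hreg) hdet] with z hz hd
    have hli := linearIndependent_sub_section (frameVal_linearIndependent a)
      (c₀ := (C p).mulVecLin) (c := (C z).mulVecLin) (s := s) ?_ (hCs p hdet)
    · exact ⟨hli, span_sub_section (hCs z hd) ((hCk z hd).trans hz) hli⟩
    · intro i
      rw [← LinearMap.mem_ker, hCk p hdet, hk, ← ha]
      exact Submodule.subset_span ⟨i, rfl⟩

/-- The condition `Λ ⊆ ker F` is a closed condition. -/
theorem exists_separating_of_not_le {ι : Type*} {Z : SpaceWithFunctions K}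
    {f : Z → grassmannian K k n} {F : Z → Matrix ι (Fin n) K} {p : Z} (hf : MorphAt f p)
    (hF : ∀ i j, Z.RegAt (fun z => F z i j) p)
    (h : ¬ subspace K (f p) ≤ LinearMap.ker (F p).mulVecLin) :
    ∃ g, Z.RegAt g p ∧ g p ≠ 0 ∧
      ∀ᶠ z in 𝓝 p, subspace K (f z) ≤ LinearMap.ker (F z).mulVecLin → g z = 0 := by
  obtain ⟨s, hs⟩ := exists_mem_quotientChart (f p)
  -- On the chart of `s`, `P z` is the projection of `Kⁿ` onto `f z` along the image of `s`. The
  -- containment thus becomes the system of equations `F z * P z = 0`, and an entry that is nonzero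
  -- at `p` separates.
  let P : Z → Matrix (Fin n) (Fin n) K :=
    fun z => 1 - LinearMap.toMatrix' s * quotientMatrix s (f z)
  have hP : ∀ i j, Z.RegAt (fun z => P z i j) p := fun i j =>
    regAt_sub (Z.regAt_const _ _) (regAt_matrix_mul (M := fun _ => LinearMap.toMatrix' s)
      (N := fun z => quotientMatrix s (f z)) (fun _ _ => Z.regAt_const _ _)
      (fun i j => hf.regAt (regAt_quotientMatrix hs i j)) i j)
  have hPv : ∀ z v, (P z).mulVec v = v - s (quotientCoord s (f z) v) := by
    intro z v
    rw [Matrix.sub_mulVec, ← Matrix.mulVec_mulVec, Matrix.one_mulVec, quotientMatrix_mulVec,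
      LinearMap.toMatrix'_mulVec]
  have hne : F p * P p ≠ 0 := by
    refine fun h0 => h fun v hv => ?_
    rw [← ker_quotientCoord hs, LinearMap.mem_ker] at hv
    have := hPv p v
    rw [hv, map_zero, sub_zero] at this
    rw [LinearMap.mem_ker, Matrix.mulVecLin_apply, ← this, Matrix.mulVec_mulVec, h0,
      Matrix.zero_mulVec]
  obtain ⟨i, j, hij⟩ : ∃ i j, (F p * P p) i j ≠ 0 := by
    by_contra! h0
    exact hne (Matrix.ext h0)
  refine ⟨fun z => (F z * P z) i j, regAt_matrix_mul hF hP i j, hij, ?_⟩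
  filter_upwards [hf.eventually ((isOpen_quotientChart s).mem_nhds hs)] with z hz hle
  have hz' : f z ∈ quotientChart K s := hz
  have h1 : (F z * P z).mulVec (Pi.single j 1) = 0 := by
    rw [← Matrix.mulVec_mulVec]
    refine hle ?_
    rw [hPv, ← ker_quotientCoord hz', LinearMap.mem_ker, map_sub, quotientCoord_section hz',
      sub_self]
  have := congrFun h1 i
  simpa using this

/-- Spaces of equal dimension agree as soon as one contains the other, and locally `snd q` is the
kernel of a regular matrix. So the diagonal is given by a closed condition of the form `Λ ⊆ ker F`.
-/
theorem isSeparated_grassmannian : IsSeparated (grassmannian K k n) := by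
  refine isClosed_of_separating fun q hq => ?_
  obtain ⟨s, hs⟩ := exists_mem_quotientChart (snd q)
  have hle : ¬ subspace K (fst q) ≤ LinearMap.ker (quotientMatrix s (snd q)).mulVecLin := by
    rw [mulVecLin_quotientMatrix, ker_quotientCoord hs]
    exact fun h => hq (subspace_eq_of_le h)
  obtain ⟨g, hg, hgq, h⟩ := exists_separating_of_not_le (morphAt_fst q)
    (fun i j => (morphAt_snd q).regAt (regAt_quotientMatrix hs i j)) hle
  refine ⟨g, hg, hgq, ?_⟩
  filter_upwards [h, (morphAt_snd q).eventually ((isOpen_quotientChart s).mem_nhds hs)]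
    with z hz hz' heq
  refine hz ?_
  rw [mulVecLin_quotientMatrix, ker_quotientCoord hz']
  exact le_of_eq (congrArg (subspace K) heq)

end Grassmannian

/-! ### The incidence correspondence is closed -/

section Incidence

variable {m n k : ℕ}

theorem matrixKer_projPoint (M : Matrix (Fin m) (Fin n) K) (h : M ≠ 0) :
    matrixKer K (projPoint M h : matrixSpace K m n) = LinearMap.ker M.mulVecLin := by
  obtain ⟨c, hc, he⟩ := exists_projRep_projPoint (K := K) M h
  change LinearMap.ker (Matrix.mulVecLin (projRep (projPoint M h : projectiveSpace K _))) = _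
  rw [he]
  ext v
  simp [hc]

theorem matrixKer_eq_ker_projNormalize {l : Module.Dual K (Matrix (Fin m) (Fin n) K)}
    {φ : matrixSpace K m n} (h : l (projRep φ) ≠ 0) :
    matrixKer K φ = LinearMap.ker (projNormalize l φ).mulVecLin := by
  conv_lhs => rw [← projPoint_projNormalize h]
  exact matrixKer_projPoint _ _

/-- The rank condition follows from the containment, because `Λ` has dimension `k`. -/
theorem incidenceLocus_eq : incidenceLocus K m n k =
    {q | subspace K (fst q) ≤ matrixKer K (snd q)} := by
  ext q
  refine ⟨fun h => h.2, fun h => ⟨?_, h⟩⟩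
  have := Submodule.finrank_mono h
  rwa [finrank_subspace] at this

theorem isClosed_incidenceLocus : IsClosed (incidenceLocus K m n k) := by
  rw [incidenceLocus_eq]
  refine isClosed_of_separating fun q hq => ?_
  obtain ⟨l, hl⟩ := exists_dual_projRep_ne_zero (snd q)
  have hle : ¬ subspace K (fst q) ≤ LinearMap.ker (projNormalize l (snd q)).mulVecLin := by
    rwa [← matrixKer_eq_ker_projNormalize hl]
  obtain ⟨g, hg, hgq, h⟩ := exists_separating_of_not_le (morphAt_fst q)
    (fun i j => ((morphAt_projNormalize hl).comp (morphAt_snd q)).regAt_entry i j) hle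
  refine ⟨g, hg, hgq, ?_⟩
  filter_upwards [h, (morphAt_snd q).eventually ((isOpen_projRep_ne_zero l).mem_nhds hl)]
    with z hz hz' heq
  exact hz (le_trans heq (matrixKer_eq_ker_projNormalize hz').le)

end Incidence

/-! ### Polynomial functions and homogeneous components -/

section Polynomials

variable {N : ℕ}

theorem exists_eval_eq_of_mem_polynomialFunctions {a : (Fin N → K) → K}
    (ha : a ∈ polynomialFunctions K (Fin N → K)) :
    ∃ P : MvPolynomial (Fin N) K, ∀ w, a w = MvPolynomial.eval w P := by
  refine Algebra.adjoin_induction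
    (p := fun a _ => ∃ P : MvPolynomial (Fin N) K, ∀ w, a w = MvPolynomial.eval w P)
    ?_ ?_ ?_ ?_ ha
  · rintro _ ⟨l, rfl⟩
    refine ⟨∑ i, MvPolynomial.C (l (Pi.single i 1)) * MvPolynomial.X i, fun w => ?_⟩
    conv_lhs => rw [← (Pi.basisFun K (Fin N)).sum_repr w]
    simp [mul_comm]
  · exact fun c => ⟨MvPolynomial.C c, fun w => by simp⟩
  · rintro a b _ _ ⟨P, hP⟩ ⟨Q, hQ⟩
    exact ⟨P + Q, fun w => by simp [hP, hQ]⟩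
  · rintro a b _ _ ⟨P, hP⟩ ⟨Q, hQ⟩
    exact ⟨P * Q, fun w => by simp [hP, hQ]⟩

/-- The polynomial `P(t w)` in `t`. -/
noncomputable def linePolynomial (w : Fin N → K) : MvPolynomial (Fin N) K →ₐ[K] Polynomial K :=
  MvPolynomial.aeval fun i => Polynomial.C (w i) * Polynomial.X

theorem eval_linePolynomial (w : Fin N → K) (P : MvPolynomial (Fin N) K) (t : K) :
    (linePolynomial w P).eval t = MvPolynomial.eval (t • w) P := by
  have : (Polynomial.evalRingHom t).comp (linePolynomial w).toRingHom =
      MvPolynomial.eval (t • w) := by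
    refine MvPolynomial.ringHom_ext (fun c => ?_) fun i => ?_
    · simp [linePolynomial]
    · change Polynomial.eval t (MvPolynomial.aeval _ (MvPolynomial.X i)) = _
      rw [MvPolynomial.aeval_X, MvPolynomial.eval_X, Polynomial.eval_C_mul, Polynomial.eval_X,
        mul_comm, Pi.smul_apply, smul_eq_mul]
  exact congrArg (fun f => f P) this

/-- Substituting `t w` multiplies the part of degree `d` by `t ^ d`. This is how statements about
lines through the origin are turned into statements about homogeneous polynomials. -/
theorem coeff_linePolynomial (w : Fin N → K) (P : MvPolynomial (Fin N) K) (d : ℕ) :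
    (linePolynomial w P).coeff d =
      MvPolynomial.eval w (MvPolynomial.homogeneousComponent d P) := by
  induction P using MvPolynomial.induction_on' with
  | add P Q hP hQ => rw [map_add, Polynomial.coeff_add, hP, hQ, map_add, map_add]
  | monomial μ c =>
    rw [MvPolynomial.homogeneousComponent_of_mem (MvPolynomial.isHomogeneous_monomial c rfl),
      linePolynomial, MvPolynomial.aeval_monomial]
    have : (μ.prod fun i e => (Polynomial.C (w i) * Polynomial.X) ^ e) =
        Polynomial.C (μ.prod fun i e => w i ^ e) * Polynomial.X ^ μ.degree := by
      simp only [Finsupp.prod, Finsupp.degree_apply, mul_pow, Finset.prod_mul_distrib,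
        Finset.prod_pow_eq_pow_sum, map_prod, map_pow]
    rw [this, Polynomial.algebraMap_eq, ← mul_assoc, ← map_mul, Polynomial.coeff_C_mul_X_pow]
    split_ifs with h <;> simp [MvPolynomial.eval_monomial]

theorem linePolynomial_ne_zero {w : Fin N → K} {P : MvPolynomial (Fin N) K} {d : ℕ}
    (h : MvPolynomial.eval w (MvPolynomial.homogeneousComponent d P) ≠ 0) :
    linePolynomial w P ≠ 0 := by
  intro h0
  rw [← coeff_linePolynomial, h0, Polynomial.coeff_zero] at h
  exact h rfl

theorem exists_eval_homogeneousComponent_ne_zero {w : Fin N → K} {P : MvPolynomial (Fin N) K}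
    (h : MvPolynomial.eval w P ≠ 0) :
    ∃ d, MvPolynomial.eval w (MvPolynomial.homogeneousComponent d P) ≠ 0 := by
  by_contra! h0
  apply h
  rw [← MvPolynomial.sum_homogeneousComponent P, map_sum]
  exact Finset.sum_eq_zero fun d _ => h0 d

theorem eval_homogeneousComponent_eq_zero [Infinite K] {w : Fin N → K} {P : MvPolynomial (Fin N) K}
    (h : ∀ t : K, MvPolynomial.eval (t • w) P = 0) (d : ℕ) :
    MvPolynomial.eval w (MvPolynomial.homogeneousComponent d P) = 0 := by
  have : linePolynomial w P = 0 :=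
    Polynomial.funext fun t => by rw [eval_linePolynomial, h, Polynomial.eval_zero]
  rw [← coeff_linePolynomial, this, Polynomial.coeff_zero]

theorem exists_eval_smul_ne_zero [Infinite K] {w : Fin N → K} {P : MvPolynomial (Fin N) K} {d : ℕ}
    (h : MvPolynomial.eval w (MvPolynomial.homogeneousComponent d P) ≠ 0) :
    ∃ t : K, t ≠ 0 ∧ MvPolynomial.eval (t • w) P ≠ 0 := by
  by_contra! h0
  -- The factor `X` takes care of `t = 0`, about which the assumption says nothing.
  refine mul_ne_zero Polynomial.X_ne_zero (linePolynomial_ne_zero h) (Polynomial.funext fun t => ?_)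
  rw [Polynomial.eval_mul, eval_linePolynomial, Polynomial.eval_X, Polynomial.eval_zero]
  by_cases ht : t = 0
  · rw [ht, zero_mul]
  · rw [h0 t ht, mul_zero]

/-- The sum runs over all monomials of degree `d` and not over the support of `P`, so that the index
set stays fixed when `P` varies with a parameter. -/
theorem eval_homogeneousComponent (w : Fin N → K) (P : MvPolynomial (Fin N) K) (d : ℕ) :
    MvPolynomial.eval w (MvPolynomial.homogeneousComponent d P) =
      ∑ μ ∈ Finset.univ.finsuppAntidiag d, P.coeff μ * ∏ i, w i ^ μ i := by
  rw [MvPolynomial.eval_eq']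
  have hdeg : ∀ μ : Fin N →₀ ℕ, μ ∈ Finset.univ.finsuppAntidiag d ↔ μ.degree = d := by
    intro μ
    simp [Finset.mem_finsuppAntidiag, Finsupp.degree_eq_sum]
  refine (Finset.sum_subset (s₂ := Finset.univ.finsuppAntidiag d) ?_ ?_).trans ?_
  · intro μ hμ
    rw [hdeg]
    by_contra h
    rw [MvPolynomial.mem_support_iff, MvPolynomial.coeff_homogeneousComponent, if_neg h] at hμ
    exact hμ rfl
  · intro μ _ hμ
    rw [MvPolynomial.notMem_support_iff.1 hμ, zero_mul]
  · refine Finset.sum_congr rfl fun μ hμ => ?_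
    rw [MvPolynomial.coeff_homogeneousComponent, if_pos ((hdeg μ).1 hμ)]

end Polynomials

/-! ### The local form of regular functions on projective space -/

section LocalForm

variable [Infinite K] {N : ℕ}

/-- The preimage of `U` is a cone, so one nonzero point of a line decides about the line. If a
homogeneous component of `P` is nonzero at `w`, then `P` is nonzero at some `t w` with `t ≠ 0`. -/
theorem exists_homogeneous_of_isOpen {U : Set (projectiveSpace K (Fin N → K))} (hU : IsOpen U)
    {v : Fin N → K} (hv : v ≠ 0) (hvU : projPoint v hv ∈ U) :
    ∃ (d : ℕ) (b : MvPolynomial (Fin N) K), b.IsHomogeneous d ∧ MvPolynomial.eval v b ≠ 0 ∧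
      ∀ (w : Fin N → K) (hw : w ≠ 0), MvPolynomial.eval w b ≠ 0 → projPoint w hw ∈ U := by
  rw [isOpen_projectiveSpace] at hU
  obtain ⟨O, hO, hOU⟩ := isOpen_induced_iff.1 hU
  have hOw : ∀ (w : Fin N → K) (hw : w ≠ 0), w ∈ O ↔ projPoint w hw ∈ U := fun w hw =>
    Set.ext_iff.1 hOU ⟨w, hw⟩
  obtain ⟨_, a, ha, -, hav, haO⟩ := exists_basic_of_mem_nhds (hO.mem_nhds ((hOw v hv).2 hvU))
  obtain ⟨P, hP⟩ := exists_eval_eq_of_mem_polynomialFunctions ha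
  rw [hP] at hav
  obtain ⟨d, hd⟩ := exists_eval_homogeneousComponent_ne_zero hav
  refine ⟨d, _, MvPolynomial.homogeneousComponent_isHomogeneous d P, hd, fun w hw h => ?_⟩
  obtain ⟨t, ht, htP⟩ := exists_eval_smul_ne_zero h
  have h1 : t • w ∈ O := haO ⟨Set.mem_univ _, by rwa [hP]⟩
  have h2 := (hOw (t • w) (smul_ne_zero ht hw)).1 h1
  rwa [show (projPoint (t • w) (smul_ne_zero ht hw) : projectiveSpace K (Fin N → K)) =
    projPoint w hw from projPoint_eq_iff.2 ⟨t, rfl⟩] at h2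

/-- Near `v` the pullback of `f` is a fraction `A / B` of polynomials. On the line of `w` it has a
constant value `c`, so `A(t w) = c B(t w)` as polynomials in `t`, and the coefficients of `t ^ d`
give `A_d(w) = c B_d(w)`. -/
theorem exists_homogeneous_of_regAt {f : projectiveSpace K (Fin N → K) → K}
    {v : Fin N → K} (hv : v ≠ 0) (hf : (projectiveSpace K (Fin N → K)).RegAt f (projPoint v hv)) :
    ∃ (d : ℕ) (a b : MvPolynomial (Fin N) K), a.IsHomogeneous d ∧ b.IsHomogeneous d ∧
      MvPolynomial.eval v b ≠ 0 ∧ ∀ (w : Fin N → K) (hw : w ≠ 0), MvPolynomial.eval w b ≠ 0 →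
        f (projPoint w hw) = MvPolynomial.eval w a / MvPolynomial.eval w b := by
  obtain ⟨g, ⟨_, -, a, ha, b, hb, hbv, hgab⟩, hfg⟩ :=
    (@Eventually.self_of_nhds _ (projectiveSpace K (Fin N → K)).top _ _ (regAt_final_iff.1 hf))
      PUnit.unit ⟨v, hv⟩ rfl
  have hfg' : ∀ᶠ w : affineSpace K (Fin N → K) in 𝓝 v, ∀ hw : (show Fin N → K from w) ≠ 0,
      f (projPoint w hw) = g w := by
    obtain ⟨O, hO, hO'⟩ := (mem_nhds_induced _ _ _).1 hfg
    filter_upwards [hO] with w hw hw0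
    exact hO' (show (⟨w, hw0⟩ : (affineSpace K (Fin N → K)).restrict {v : Fin N → K | v ≠ 0}) ∈ _
      from hw)
  obtain ⟨_, e, he, -, hev, heO⟩ := exists_basic_of_mem_nhds (hfg'.and hgab)
  obtain ⟨A, hA⟩ := exists_eval_eq_of_mem_polynomialFunctions ha
  obtain ⟨B, hB⟩ := exists_eval_eq_of_mem_polynomialFunctions hb
  obtain ⟨E, hE⟩ := exists_eval_eq_of_mem_polynomialFunctions he
  rw [hB] at hbv
  rw [hE] at hev
  have key : ∀ (w : Fin N → K) (hw : w ≠ 0), MvPolynomial.eval w E ≠ 0 →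
      f (projPoint w hw) = MvPolynomial.eval w A / MvPolynomial.eval w B := by
    intro w hw hwE
    obtain ⟨h1, h2⟩ := heO (show w ∈ _ from ⟨Set.mem_univ _, by rwa [hE]⟩)
    rw [h1 hw, h2, Pi.div_apply, hA, hB]
  obtain ⟨d, hd⟩ := exists_eval_homogeneousComponent_ne_zero hbv
  obtain ⟨i, hi⟩ := exists_eval_homogeneousComponent_ne_zero hev
  -- The common factor from `E` restricts to lines that meet the set `E ≠ 0`, where `f = A / B` is
  -- known.
  refine ⟨d + i, MvPolynomial.homogeneousComponent d A * MvPolynomial.homogeneousComponent i E,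
    MvPolynomial.homogeneousComponent d B * MvPolynomial.homogeneousComponent i E,
    (MvPolynomial.homogeneousComponent_isHomogeneous d A).mul
      (MvPolynomial.homogeneousComponent_isHomogeneous i E),
    (MvPolynomial.homogeneousComponent_isHomogeneous d B).mul
      (MvPolynomial.homogeneousComponent_isHomogeneous i E), ?_, ?_⟩
  · rw [map_mul]
    exact mul_ne_zero hd hi
  · intro w hw h
    rw [map_mul] at h
    have hwB := left_ne_zero_of_mul h
    have hwE := right_ne_zero_of_mul h
    rw [map_mul, map_mul, mul_div_mul_right _ _ hwE, eq_div_iff hwB]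
    -- The first three factors absorb the values of `t` at which `f = A / B` is not available; as
    -- nonzero polynomials they can be cancelled.
    have hzero : (Polynomial.X * linePolynomial w E * linePolynomial w B) *
        (linePolynomial w A - Polynomial.C (f (projPoint w hw)) * linePolynomial w B) = 0 := by
      refine Polynomial.funext fun t => ?_
      simp only [Polynomial.eval_mul, Polynomial.eval_sub, Polynomial.eval_X, Polynomial.eval_C,
        Polynomial.eval_zero, eval_linePolynomial]
      by_contra hne
      have h1 := left_ne_zero_of_mul hne
      have ht := left_ne_zero_of_mul (left_ne_zero_of_mul h1)
      have hEt := right_ne_zero_of_mul (left_ne_zero_of_mul h1)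
      have hBt := right_ne_zero_of_mul h1
      have h2 := key (t • w) (smul_ne_zero ht hw) hEt
      rw [show (projPoint (t • w) (smul_ne_zero ht hw) : projectiveSpace K (Fin N → K)) =
        projPoint w hw from projPoint_eq_iff.2 ⟨t, rfl⟩, eq_div_iff hBt] at h2
      exact right_ne_zero_of_mul hne (by rw [h2, sub_self])
    have h3 := (mul_eq_zero.1 hzero).resolve_left (mul_ne_zero
      (mul_ne_zero Polynomial.X_ne_zero (linePolynomial_ne_zero hwE)) (linePolynomial_ne_zero hwB))
    have h4 := congrArg (fun p => Polynomial.coeff p d) (sub_eq_zero.1 h3)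
    simp only [Polynomial.coeff_C_mul, coeff_linePolynomial] at h4
    exact h4.symm

/-- Only the functions on the projective factor bring in denominators, so one denominator `b`
independent of `z` suffices, and `z` enters through the coefficients of the numerator alone. -/
theorem exists_homogeneous_of_mem_productFunctions {Z : SpaceWithFunctions K}
    {U : Set (projectiveSpace K (Fin N → K))} {W : Set Z}
    {h : projectiveSpace K (Fin N → K) × Z → K} (hh : h ∈ productFunctions _ _ U W)
    {v : Fin N → K} (hv : v ≠ 0) (hvU : projPoint v hv ∈ U) :
    ∃ (d : ℕ) (b : MvPolynomial (Fin N) K) (H : Z → MvPolynomial (Fin N) K),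
      b.IsHomogeneous d ∧ MvPolynomial.eval v b ≠ 0 ∧ (∀ z, (H z).IsHomogeneous d) ∧
      (∀ μ, Z.RegularOn (fun z => (H z).coeff μ) W) ∧
      ∀ (w : Fin N → K) (hw : w ≠ 0), MvPolynomial.eval w b ≠ 0 → ∀ z,
        h (projPoint w hw, z) = MvPolynomial.eval w (H z) / MvPolynomial.eval w b := by
  have hreg_mul : ∀ (A : Z → MvPolynomial (Fin N) K) (B : Z → MvPolynomial (Fin N) K),
      (∀ μ, Z.RegularOn (fun z => (A z).coeff μ) W) →
      (∀ μ, Z.RegularOn (fun z => (B z).coeff μ) W) →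
      ∀ μ, Z.RegularOn (fun z => (A z * B z).coeff μ) W := by
    intro A B hA hB μ p hp
    simp only [MvPolynomial.coeff_mul]
    exact regAt_sum _ _ fun x _ => Z.regAt_mul _ _ _ (hA _ _ hp) (hB _ _ hp)
  have hreg_C : ∀ g : Z → K, Z.RegularOn g W → ∀ μ, Z.RegularOn
      (fun z => (MvPolynomial.C (g z) : MvPolynomial (Fin N) K).coeff μ) W := by
    intro g hg μ p hp
    simp only [MvPolynomial.coeff_C]
    split_ifs
    · exact hg p hp
    · exact Z.regAt_const _ _
  have hreg_const : ∀ a : MvPolynomial (Fin N) K, ∀ μ, Z.RegularOn (fun _ => a.coeff μ) W :=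
    fun a μ p _ => Z.regAt_const _ _
  refine Algebra.adjoin_induction (p := fun h _ => ∃ (d : ℕ) (b : MvPolynomial (Fin N) K)
      (H : Z → MvPolynomial (Fin N) K),
      b.IsHomogeneous d ∧ MvPolynomial.eval v b ≠ 0 ∧ (∀ z, (H z).IsHomogeneous d) ∧
      (∀ μ, Z.RegularOn (fun z => (H z).coeff μ) W) ∧
      ∀ (w : Fin N → K) (hw : w ≠ 0), MvPolynomial.eval w b ≠ 0 → ∀ z,
        h (projPoint w hw, z) = MvPolynomial.eval w (H z) / MvPolynomial.eval w b) ?_ ?_ ?_ ?_ hh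
  · rintro _ (⟨f, hf, rfl⟩ | ⟨g, hg, rfl⟩)
    · obtain ⟨d, a, b, ha, hb, hbv, hab⟩ := exists_homogeneous_of_regAt hv (hf _ hvU)
      exact ⟨d, b, fun _ => a, hb, hbv, fun _ => ha, hreg_const a, fun w hw hwb z => hab w hw hwb⟩
    · exact ⟨0, 1, fun z => MvPolynomial.C (g z), MvPolynomial.isHomogeneous_one _ _, by simp,
        fun z => MvPolynomial.isHomogeneous_C _ _, hreg_C g hg, fun w hw hwb z => by simp⟩
  · exact fun c => ⟨0, 1, fun z => MvPolynomial.C c, MvPolynomial.isHomogeneous_one _ _, by simp,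
      fun z => MvPolynomial.isHomogeneous_C _ _, hreg_const _, fun w hw hwb z => by simp⟩
  · rintro h₁ h₂ _ _ ⟨d₁, b₁, H₁, hb₁, hv₁, hd₁, hr₁, he₁⟩ ⟨d₂, b₂, H₂, hb₂, hv₂, hd₂, hr₂, he₂⟩
    refine ⟨d₁ + d₂, b₁ * b₂, fun z => H₁ z * b₂ + b₁ * H₂ z, hb₁.mul hb₂,
      by simp [hv₁, hv₂], fun z => ((hd₁ z).mul hb₂).add (hb₁.mul (hd₂ z)), ?_, ?_⟩
    · intro μ p hp
      simp only [MvPolynomial.coeff_add]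
      exact Z.regAt_add _ _ _ (hreg_mul H₁ (fun _ => b₂) hr₁ (hreg_const b₂) μ p hp)
        (hreg_mul (fun _ => b₁) H₂ (hreg_const b₁) hr₂ μ p hp)
    · intro w hw hwb z
      rw [map_mul] at hwb
      have h1 := left_ne_zero_of_mul hwb
      have h2 := right_ne_zero_of_mul hwb
      rw [Pi.add_apply, he₁ w hw h1, he₂ w hw h2, map_add, map_mul, map_mul, map_mul,
        div_add_div _ _ h1 h2]
  · rintro h₁ h₂ _ _ ⟨d₁, b₁, H₁, hb₁, hv₁, hd₁, hr₁, he₁⟩ ⟨d₂, b₂, H₂, hb₂, hv₂, hd₂, hr₂, he₂⟩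
    refine ⟨d₁ + d₂, b₁ * b₂, fun z => H₁ z * H₂ z, hb₁.mul hb₂,
      by simp [hv₁, hv₂], fun z => (hd₁ z).mul (hd₂ z), hreg_mul H₁ H₂ hr₁ hr₂, ?_⟩
    intro w hw hwb z
    rw [map_mul] at hwb
    rw [Pi.mul_apply, he₁ w hw (left_ne_zero_of_mul hwb), he₂ w hw (right_ne_zero_of_mul hwb),
      map_mul, map_mul, div_mul_div_comm]

end LocalForm

/-! ### Elimination theory -/

/-- If homogeneous polynomials with coefficients that are regular functions have no common zero
at a point, then finitely many of them have no common zero at all points nearby. -/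
theorem exists_finset_eventually_eval_ne_zero [IsAlgClosed K] {N : ℕ} {ι : Type*}
    {Z : SpaceWithFunctions K} {z₀ : Z} (d : ι → ℕ) (H : ι → Z → MvPolynomial (Fin N) K)
    (hd : ∀ i z, (H i z).IsHomogeneous (d i))
    (hreg : ∀ i μ, Z.RegAt (fun z => (H i z).coeff μ) z₀)
    (hzero : ∀ w ≠ 0, ∃ i, MvPolynomial.eval w (H i z₀) ≠ 0) :
    ∃ s : Finset ι, ∀ᶠ z in 𝓝 z₀, ∀ w ≠ 0, ∃ i ∈ s, MvPolynomial.eval w (H i z) ≠ 0 := by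
  classical
  have : Infinite K := IsAlgClosed.instInfinite
  let J := Ideal.span (Set.range fun i => H i z₀)
  -- Nullstellensatz: the generators have at most the origin as common zero, and the coordinates
  -- vanish there.
  have hX : ∀ j : Fin N, ∃ e, (MvPolynomial.X j : MvPolynomial (Fin N) K) ^ e ∈ J := by
    intro j
    change MvPolynomial.X j ∈ J.radical
    rw [← MvPolynomial.vanishingIdeal_zeroLocus_eq_radical (K := K), MvPolynomial.mem_vanishingIdeal_iff]
    intro x hx
    by_cases h0 : x = 0
    · simp [h0]
    · obtain ⟨i, hi⟩ := hzero x h0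
      refine absurd (hx _ (Ideal.subset_span ⟨i, rfl⟩)) ?_
      rwa [MvPolynomial.aeval_eq_eval]
  choose e he using hX
  let E := ∑ j, e j
  have hE : ∀ j, (MvPolynomial.X j : MvPolynomial (Fin N) K) ^ E ∈ J := fun j =>
    Ideal.mem_of_dvd _ (pow_dvd_pow _ (Finset.single_le_sum (fun _ _ => Nat.zero_le _)
      (Finset.mem_univ j))) (he j)
  -- Pigeonhole: a monomial of degree greater than `N * E` in `N` variables has an exponent at least
  -- `E`, so every monomial of degree `D` lies in `J`.
  let D := N * E + 1
  let T : Finset (Fin N →₀ ℕ) := Finset.univ.finsuppAntidiag D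
  have hT : ∀ μ ∈ T, MvPolynomial.monomial μ (1 : K) ∈ J := by
    intro μ hμ
    obtain ⟨j, hj⟩ : ∃ j, E ≤ μ j := by
      by_contra! h
      have h1 : ∑ j, μ j = D := (Finset.mem_finsuppAntidiag.1 hμ).1
      have h2 : ∑ j, μ j ≤ ∑ _j : Fin N, E := Finset.sum_le_sum fun j _ => (h j).le
      simp only [Finset.sum_const, Finset.card_univ, Fintype.card_fin, smul_eq_mul] at h2
      omega
    refine Ideal.mem_of_dvd _ ?_ (hE j)
    rw [MvPolynomial.X_pow_eq_monomial, MvPolynomial.monomial_dvd_monomial]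
    exact ⟨Or.inr (by simpa using hj), one_dvd _⟩
  have hc : ∀ μ : T, ∃ c : ι →₀ MvPolynomial (Fin N) K,
      (c.sum fun i a => a * H i z₀) = MvPolynomial.monomial μ.1 1 := fun μ =>
    (Finsupp.mem_ideal_span_range_iff_exists_finsupp).1 (hT μ.1 μ.2)
  choose c hc using hc
  let s : Finset ι := Finset.univ.biUnion fun μ => (c μ).support
  -- The expressions of the monomials by the `H i z₀`, with frozen coefficients `c` and varying `z`.
  -- Their coefficients in degree `D` form a matrix that is the identity at `z₀` and hence
  -- invertible nearby.
  let R : T → Z → MvPolynomial (Fin N) K := fun μ z => ∑ i ∈ s, c μ i * H i z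
  have hR : ∀ μ, R μ z₀ = MvPolynomial.monomial μ.1 1 := by
    intro μ
    rw [← hc μ, Finsupp.sum]
    symm
    refine Finset.sum_subset ?_ ?_
    · exact Finset.subset_biUnion_of_mem (fun μ => (c μ).support) (Finset.mem_univ μ)
    · intro i _ hi
      rw [Finsupp.notMem_support_iff.1 hi, zero_mul]
  let M : Z → Matrix T T K := fun z => Matrix.of fun μ ν => (R μ z).coeff ν.1
  have hM : ∀ μ ν, Z.RegAt (fun z => M z μ ν) z₀ := by
    intro μ ν
    simp only [M, R, Matrix.of_apply, MvPolynomial.coeff_sum, MvPolynomial.coeff_mul]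
    exact regAt_sum _ _ fun i _ => regAt_sum _ _ fun x _ =>
      Z.regAt_mul _ _ _ (Z.regAt_const _ _) (hreg _ _)
  have hM₀ : M z₀ = 1 := by
    ext μ ν
    simp only [M, Matrix.of_apply, hR, MvPolynomial.coeff_monomial, Matrix.one_apply]
    exact if_congr Subtype.ext_iff.symm rfl rfl
  refine ⟨s, ?_⟩
  filter_upwards [Z.regAt_ne_zero _ _ (regAt_det M hM) (by simp [hM₀])] with z hz w hw
  by_contra! h0
  -- `R μ z` need not be homogeneous for `z ≠ z₀`. Its vanishing on the whole line of `w` is what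
  -- passes to the part of degree `D`; the matrix then forces all monomials of degree `D` to vanish
  -- at `w`.
  have hsmul : ∀ t : K, ∀ i ∈ s, MvPolynomial.eval (t • w) (H i z) = 0 := by
    intro t i hi
    rw [← eval_linePolynomial]
    have : linePolynomial w (H i z) = 0 := by
      ext e
      rw [coeff_linePolynomial, MvPolynomial.homogeneousComponent_of_mem (hd i z)]
      split_ifs
      · rw [h0 i hi, Polynomial.coeff_zero]
      · rw [map_zero, Polynomial.coeff_zero]
    rw [this, Polynomial.eval_zero]
  have hmul : (M z).mulVec (fun ν => ∏ j, w j ^ ν.1 j) = 0 := by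
    ext μ
    have h1 : MvPolynomial.eval w (MvPolynomial.homogeneousComponent D (R μ z)) = 0 := by
      refine eval_homogeneousComponent_eq_zero (fun t => ?_) D
      simp only [R, map_sum, map_mul]
      exact Finset.sum_eq_zero fun i hi => by rw [hsmul t i hi, mul_zero]
    rw [eval_homogeneousComponent, ← Finset.sum_coe_sort] at h1
    exact h1
  have hvec := Matrix.eq_zero_of_mulVec_eq_zero hz hmul
  apply hw
  funext j
  have hjT : Finsupp.single j D ∈ T := by
    simp [T, Finset.mem_finsuppAntidiag]
  have := congrFun hvec ⟨_, hjT⟩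
  simp only [Pi.zero_apply] at this
  obtain ⟨i, -, hi⟩ := Finset.prod_eq_zero_iff.1 this
  by_cases hij : i = j
  · subst hij
    exact eq_zero_of_pow_eq_zero hi
  · rw [Finsupp.single_eq_of_ne hij, pow_zero] at hi
    exact absurd hi one_ne_zero

/-! ### Complete spaces -/

/-- `X` is complete: the projections `X × Z → Z` are closed. -/
def IsComplete (X : SpaceWithFunctions K) : Prop :=
  ∀ Z : SpaceWithFunctions K, IsClosedMap (snd : prod X Z → Z)

/-- Around each point `(v, z₀)` outside `C`, the complement of `C` contains the nonvanishing locus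
of a form in `w` with coefficients regular in `z`. At `z₀` these forms have no common zero, so by
elimination finitely many of them have none for `z` near `z₀`. -/
theorem isComplete_projectiveSpace_pi [IsAlgClosed K] (N : ℕ) :
    IsComplete (projectiveSpace K (Fin N → K)) := by
  have : Infinite K := IsAlgClosed.instInfinite
  intro Z C hC
  rw [← isOpen_compl_iff, isOpen_iff_mem_nhds]
  intro z₀ hz₀
  have key : ∀ v : {v : Fin N → K // v ≠ 0}, ∃ (d : ℕ) (H : Z → MvPolynomial (Fin N) K)
      (W : Set Z), IsOpen W ∧ z₀ ∈ W ∧ (∀ z, (H z).IsHomogeneous d) ∧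
      (∀ μ, Z.RegularOn (fun z => (H z).coeff μ) W) ∧ MvPolynomial.eval v.1 (H z₀) ≠ 0 ∧
      ∀ (w : Fin N → K) (hw : w ≠ 0), ∀ z ∈ W, MvPolynomial.eval w (H z) ≠ 0 →
        pair (projPoint w hw) z ∉ C := by
    rintro ⟨v, hv⟩
    have hvC : pair (projPoint v hv) z₀ ∉ C := fun h => hz₀ ⟨_, h, rfl⟩
    obtain ⟨U, W, hU, hW, hvU, hzW, h, hh, hne, hsub⟩ :=
      exists_prod_basic_of_mem_nhds (hC.isOpen_compl.mem_nhds hvC)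
    obtain ⟨d, b, H, hb, hbv, hd, hreg, heq⟩ := exists_homogeneous_of_mem_productFunctions hh hv hvU
    obtain ⟨d', b', hb', hbv', hbU⟩ := exists_homogeneous_of_isOpen hU hv hvU
    -- The factors `b` and `b'` make nonvanishing of the form imply that the denominator is nonzero
    -- and that the line of `w` lies in `U`.
    refine ⟨d + (d + d'), fun z => H z * (b * b'), W, hW, hzW,
      fun z => (hd z).mul (hb.mul hb'), ?_, ?_, ?_⟩
    · intro μ p hp
      simp only [MvPolynomial.coeff_mul]
      exact regAt_sum _ _ fun x _ => Z.regAt_mul _ _ _ (hreg _ _ hp) (Z.regAt_const _ _)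
    · have h0 : h (projPoint v hv, z₀) ≠ 0 := hne
      rw [heq v hv hbv] at h0
      simp only [map_mul]
      exact mul_ne_zero (div_ne_zero_iff.1 h0).1 (mul_ne_zero hbv hbv')
    · intro w hw z hz hne
      simp only [map_mul] at hne
      have h1 := left_ne_zero_of_mul hne
      have h2 := left_ne_zero_of_mul (right_ne_zero_of_mul hne)
      have h3 := right_ne_zero_of_mul (right_ne_zero_of_mul hne)
      refine hsub _ (hbU w hw h3) hz ?_
      change h (projPoint w hw, z) ≠ 0
      rw [heq w hw h2]
      exact div_ne_zero h1 h2
  choose d H W hW hzW hd hreg hne hC' using key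
  obtain ⟨s, hs⟩ := exists_finset_eventually_eval_ne_zero (z₀ := z₀) d H hd
    (fun i μ => hreg i μ z₀ (hzW i)) (fun w hw => ⟨⟨w, hw⟩, hne _⟩)
  filter_upwards [hs, (Filter.eventually_all_finset s).2 fun i _ => (hW i).mem_nhds (hzW i)]
    with z hz hzs
  rintro ⟨q, hq, rfl⟩
  obtain ⟨w, hw, hqw⟩ := exists_projPoint (fst q)
  obtain ⟨i, his, hi⟩ := hz w hw
  refine hC' i w hw _ (hzs i his) hi ?_
  rwa [← hqw]

theorem IsComplete.of_surjective {X Y : SpaceWithFunctions K} (hX : IsComplete X) {f : X → Y}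
    (hf : IsMorphism f) (hs : Function.Surjective f) : IsComplete Y := by
  intro Z C hC
  have hc : Continuous fun q : prod X Z => pair (f (fst q)) (snd q) :=
    (isMorphism_iff.2 fun q => ((hf.morphAt _).comp (morphAt_fst q)).pair (morphAt_snd q)).1
  have := hX Z _ (hC.preimage hc)
  convert this using 1
  ext z
  constructor
  · rintro ⟨q, hq, rfl⟩
    obtain ⟨x, hx⟩ := hs (fst q)
    exact ⟨pair x (snd q), by simpa [hx, pair_fst_snd] using hq, rfl⟩
  · rintro ⟨q, hq, rfl⟩
    exact ⟨_, hq, rfl⟩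

/-- After reassociation the projection factors as `X × (Y × Z) → Y × Z → Z`. -/
theorem IsComplete.prod {X Y : SpaceWithFunctions K} (hX : IsComplete X) (hY : IsComplete Y) :
    IsComplete (X.prod Y) := by
  intro Z C hC
  have hc : Continuous fun q : SpaceWithFunctions.prod X (Y.prod Z) =>
      pair (pair (fst q) (fst (snd q))) (snd (snd q)) :=
    (isMorphism_iff.2 fun q => ((morphAt_fst q).pair (morphAt_snd q).fst).pair
      (morphAt_snd q).snd).1
  have := hY Z _ (hX _ _ (hC.preimage hc))
  convert this using 1
  ext z
  constructor
  · rintro ⟨q, hq, rfl⟩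
    exact ⟨pair (snd (fst q)) (snd q), ⟨pair (fst (fst q)) (pair (snd (fst q)) (snd q)), hq, rfl⟩,
      rfl⟩
  · rintro ⟨_, ⟨q, hq, rfl⟩, rfl⟩
    exact ⟨_, hq, rfl⟩

/-- The product with an induced structure is compared with the structure induced from the product;
only the morphism `j` in one direction is needed. -/
theorem isClosed_image_prod_restrict {X Z : SpaceWithFunctions K} {S : Set X} (hS : IsClosed S)
    {C : Set (prod (X.restrict S) Z)} (hC : IsClosed C) :
    IsClosed {q : prod X Z | ∃ h : fst q ∈ S, (pair ⟨fst q, h⟩ (snd q) : prod (X.restrict S) Z) ∈ C} := by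
  let T : Set (prod X Z) := {q | fst q ∈ S}
  have hT : IsClosed T := hS.preimage continuous_fst
  let j : (prod X Z).restrict T → prod (X.restrict S) Z := fun q => pair ⟨fst q.1, q.2⟩ (snd q.1)
  have hj : IsMorphism j := by
    refine isMorphism_iff.2 fun q => MorphAt.pair (morphAt_restrict_iff.2 ?_) ?_
    · exact (morphAt_fst q.1).restrict
    · exact (morphAt_snd q.1).restrict
  have := hT.isClosedMap_subtype_val _ (hC.preimage hj.1)
  convert this using 1
  ext q
  constructor
  · rintro ⟨h, hq⟩
    exact ⟨⟨q, h⟩, hq, rfl⟩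
  · rintro ⟨⟨q, h⟩, hq, rfl⟩
    exact ⟨h, hq⟩

theorem IsComplete.restrict {X : SpaceWithFunctions K} (hX : IsComplete X) {S : Set X}
    (hS : IsClosed S) : IsComplete (X.restrict S) := by
  intro Z C hC
  have := hX Z _ (isClosed_image_prod_restrict hS hC)
  convert this using 1
  ext z
  constructor
  · rintro ⟨q, hq, rfl⟩
    exact ⟨pair (fst q).1 (snd q), ⟨(fst q).2, hq⟩, rfl⟩
  · rintro ⟨q, ⟨h, hq⟩, rfl⟩
    exact ⟨_, hq, rfl⟩

/-- As `Y` is separated, the fibre product is closed in `X × Z`, and completeness of `X` applies to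
its closed subsets. -/
theorem IsComplete.isProperMorphism {X Y : SpaceWithFunctions K} (hX : IsComplete X)
    (hXs : IsSeparated X) (hY : IsSeparated Y) {f : X → Y} (hf : IsMorphism f) :
    IsProperMorphism f := by
  refine ⟨hf, ?_, ?_⟩
  · exact hXs.isClosed_eq (isMorphism_fst.comp (isMorphism_val _))
      (isMorphism_snd.comp (isMorphism_val _))
  · intro Z g _ hg C hC
    have h1 : IsClosed {q : SpaceWithFunctions.prod X Z | f (fst q) = g (snd q)} :=
      hY.isClosed_eq (hf.comp isMorphism_fst) (hg.comp isMorphism_snd)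
    have := hX Z _ (h1.isClosedMap_subtype_val C hC)
    convert this using 1
    ext z
    constructor
    · rintro ⟨q, hq, rfl⟩
      exact ⟨q.1, ⟨q, hq, rfl⟩, rfl⟩
    · rintro ⟨_, ⟨q, hq, rfl⟩, rfl⟩
      exact ⟨q, hq, rfl⟩

theorem isComplete_projectiveSpace [IsAlgClosed K] (V : Type u) [AddCommGroup V] [Module K V]
    [FiniteDimensional K V] : IsComplete (projectiveSpace K V) := by
  let e : (Fin (Module.finrank K V) → K) ≃ₗ[K] V := (Module.finBasis K V).equivFun.symm
  refine (isComplete_projectiveSpace_pi (Module.finrank K V)).of_surjective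
    (f := fun p => projPoint (e (projRep p)) (by simpa using projRep_ne_zero p))
    (isMorphism_iff.2 fun p => ?_) fun p => ?_
  · obtain ⟨l, hl⟩ := exists_dual_projRep_ne_zero p
    refine morphAt_projectiveSpace (F := fun p => e (projNormalize l p))
      (((isMorphism_linearMap e.toLinearMap).morphAt _).comp (morphAt_projNormalize hl)) ?_
    filter_upwards [(isOpen_projRep_ne_zero l).mem_nhds hl] with q hq
    refine ⟨by simpa using projNormalize_ne_zero hq, ?_⟩
    refine projPoint_eq_iff.2 ⟨l (projRep q), ?_⟩
    rw [← map_smul, projNormalize, smul_smul, mul_inv_cancel₀ hq, one_smul]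
  · obtain ⟨v, hv, rfl⟩ := exists_projPoint p
    have hv' : e.symm v ≠ 0 := by simpa using hv
    refine ⟨projPoint (e.symm v) hv', ?_⟩
    obtain ⟨c, hc, h⟩ := exists_projRep_projPoint (K := K) (e.symm v) hv'
    exact projPoint_eq_iff.2 ⟨c, by rw [h, map_smul, e.apply_symm_apply]⟩

/-! ### Grassmannians are complete -/

/-- The start of the induction for Grassmannians, `G(0, n)` being a point. -/
theorem isComplete_of_subsingleton {X : SpaceWithFunctions K} [Subsingleton X] :
    IsComplete X := by
  intro Z C hC
  rcases isEmpty_or_nonempty X with h | ⟨⟨x⟩⟩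
  · convert isClosed_empty
    ext z
    exact ⟨fun ⟨q, _, _⟩ => h.elim (fst q), fun h => h.elim⟩
  · have hc : Continuous fun z : Z => pair x z :=
      (isMorphism_iff.2 fun z => MorphAt.pair
        ⟨continuousAt_const, fun f _ => Z.regAt_const (f x) z⟩ (morphAt_id z)).1
    convert hC.preimage hc using 1
    ext z
    constructor
    · rintro ⟨q, hq, rfl⟩
      have : pair x (snd q) = q := prod_ext (Subsingleton.elim _ _) rfl
      rwa [Set.mem_preimage, this]
    · exact fun h => ⟨_, h, rfl⟩

section Grassmannian

variable {k n : ℕ} {s : (Fin (n - k) → K) →ₗ[K] (Fin n → K)}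

theorem linearIndependent_snoc_section {Λ : grassmannian K k n} (h : Λ ∈ quotientChart K s)
    {F : Fin k → Fin n → K} (hF : LinearIndependent K F)
    (hs : subspace K Λ = Submodule.span K (Set.range F)) {w : Fin (n - k) → K} (hw : w ≠ 0) :
    LinearIndependent K (Fin.snoc F (s w) : Fin (k + 1) → Fin n → K) ∧
      Submodule.span K (Set.range (Fin.snoc F (s w) : Fin (k + 1) → Fin n → K)) =
        subspace K Λ ⊔ Submodule.span K {s w} := by
  constructor
  · rw [linearIndependent_finSnoc, ← hs]
    refine ⟨hF, fun hmem => hw ?_⟩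
    rw [← ker_quotientCoord h, LinearMap.mem_ker, quotientCoord_section h] at hmem
    exact hmem
  · rw [Fin.range_snoc, Submodule.span_insert, hs, sup_comm]

theorem finrank_sup_section {Λ : grassmannian K k n} (h : Λ ∈ quotientChart K s)
    {w : Fin (n - k) → K} (hw : w ≠ 0) :
    Module.finrank K (subspace K Λ ⊔ Submodule.span K {s w} : Submodule K (Fin n → K)) = k + 1 := by
  obtain ⟨a, rfl⟩ := exists_frame Λ
  obtain ⟨h1, h2⟩ := linearIndependent_snoc_section h (frameVal_linearIndependent a) rfl hw
  rw [← h2, finrank_span_eq_card h1, Fintype.card_fin]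

/-- The subspace `Λ + ⟨s w⟩` for `Λ` in the chart of `s` and a line `⟨w⟩`. -/
noncomputable def extendSubspace (p : projectiveSpace K (Fin (n - k) → K))
    (Λ : (grassmannian K k n).restrict (quotientChart K s)) : grassmannian K (k + 1) n :=
  ⟨subspace K Λ.1 ⊔ Submodule.span K {s (projRep p)}, finrank_sup_section Λ.2 (projRep_ne_zero p)⟩

theorem subspace_extendSubspace (p : projectiveSpace K (Fin (n - k) → K))
    (Λ : (grassmannian K k n).restrict (quotientChart K s)) :
    subspace K (extendSubspace p Λ) = subspace K Λ.1 ⊔ Submodule.span K {s (projRep p)} := rfl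

theorem morphAt_extendSubspace {Z : SpaceWithFunctions K}
    {f : Z → projectiveSpace K (Fin (n - k) → K)}
    {g : Z → (grassmannian K k n).restrict (quotientChart K s)} {z : Z} (hf : MorphAt f z)
    (hg : MorphAt g z) : MorphAt (X := Z) (Y := grassmannian K (k + 1) n)
      (fun z => extendSubspace (f z) (g z)) z := by
  obtain ⟨F, hF, hF'⟩ := exists_regular_frame (g z).2
  obtain ⟨l, hl⟩ := exists_dual_projRep_ne_zero (f z)
  have hg' := morphAt_restrict_iff.1 hg
  have hfl := (morphAt_projNormalize hl).comp hf
  refine morphAt_grassmannian (F := fun z => Fin.snoc (F (g z).1) (s (projNormalize l (f z)))) ?_ ?_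
  · intro i j
    refine Fin.lastCases ?_ (fun i => ?_) i
    · simp only [Fin.snoc_last]
      exact hfl.regAt_dual (LinearMap.proj j ∘ₗ s)
    · simp only [Fin.snoc_castSucc]
      exact hg'.regAt (hF i j)
  · filter_upwards [hf.eventually ((isOpen_projRep_ne_zero l).mem_nhds hl)] with z' hz'
    obtain ⟨h1, h2⟩ := hF' _ (g z').2
    obtain ⟨h3, h4⟩ := linearIndependent_snoc_section (g z').2 h1 h2 (projNormalize_ne_zero hz')
    refine ⟨h3, ?_⟩
    rw [h4, subspace_extendSubspace, projNormalize, map_smul,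
      Submodule.span_singleton_smul_eq (isUnit_iff_ne_zero.2 (inv_ne_zero hz'))]

/-- For `v` in `Λ'` outside `Λ`, the coordinate `w` of `v` modulo `Λ` is nonzero, and `v - s w` lies
in `Λ`. Hence `s w` lies in `Λ'`, and dimensions agree. -/
theorem exists_extendSubspace_eq (Λ : (grassmannian K k n).restrict (quotientChart K s))
    {Λ' : grassmannian K (k + 1) n} (h : subspace K Λ.1 ≤ subspace K Λ') :
    ∃ p, extendSubspace p Λ = Λ' := by
  have hlt : subspace K Λ.1 < subspace K Λ' := by
    refine lt_of_le_of_ne h fun he => ?_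
    have := finrank_subspace Λ'
    rw [← he, finrank_subspace] at this
    omega
  obtain ⟨v, hv, hv'⟩ := SetLike.exists_of_lt hlt
  have hw : quotientCoord s Λ.1 v ≠ 0 := by
    rwa [← ker_quotientCoord Λ.2, LinearMap.mem_ker] at hv'
  refine ⟨projPoint _ hw, subspace_eq_of_le ?_⟩
  obtain ⟨c, hc, hrep⟩ := exists_projRep_projPoint (K := K) _ hw
  rw [subspace_extendSubspace, hrep, sup_le_iff, Submodule.span_singleton_le_iff_mem, map_smul]
  refine ⟨h, Submodule.smul_mem _ _ ?_⟩
  have : v - s (quotientCoord s Λ.1 v) ∈ subspace K Λ.1 := by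
    rw [← ker_quotientCoord Λ.2, LinearMap.mem_ker, map_sub, quotientCoord_section Λ.2, sub_self]
  exact (Submodule.sub_mem_iff_right _ hv).1 (h this)

theorem exists_subspace_le (Λ' : grassmannian K (k + 1) n) :
    ∃ Λ : grassmannian K k n, subspace K Λ ≤ subspace K Λ' := by
  obtain ⟨a, rfl⟩ := exists_frame Λ'
  refine ⟨framePoint ⟨fun i => frameVal a i.castSucc,
    (frameVal_linearIndependent a).comp _ (Fin.castSucc_injective k)⟩, ?_⟩
  refine Submodule.span_mono ?_
  rintro _ ⟨i, rfl⟩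
  exact ⟨i.castSucc, rfl⟩

/-- Induction through partial flags `Λ ⊆ Λ'`. A closed set of pairs `(Λ', z)` and the set `D` of all
`(Λ, z)` with some such `Λ'` above `Λ` have the same image in `Z`, so it suffices that `D` is
closed. -/
theorem isComplete_grassmannian [IsAlgClosed K] (k n : ℕ) : IsComplete (grassmannian K k n) := by
  induction k with
  | zero =>
    have : Subsingleton (grassmannian K 0 n) := by
      refine ⟨fun Λ Λ' => subspace_injective ?_⟩
      rw [Submodule.finrank_eq_zero.1 (finrank_subspace Λ),
        Submodule.finrank_eq_zero.1 (finrank_subspace Λ')]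
    exact isComplete_of_subsingleton
  | succ k ih =>
    intro Z C hC
    let D : Set (prod (grassmannian K k n) Z) :=
      {q | ∃ Λ', subspace K (fst q) ≤ subspace K Λ' ∧ pair Λ' (snd q) ∈ C}
    -- Over the chart of `s`, the `Λ'` above `Λ` are the spaces `Λ + ⟨s w⟩`. There `D` is the image
    -- of a closed set under a projection along the complete space of lines `⟨w⟩`.
    have hD : IsClosed D := by
      rw [← isOpen_compl_iff, isOpen_iff_mem_nhds]
      intro q hq
      obtain ⟨s, hs⟩ := exists_mem_quotientChart (fst q)
      let S : Set (prod (grassmannian K k n) Z) := {q | fst q ∈ quotientChart K s}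
      have hS : IsOpen S := (isOpen_quotientChart s).preimage continuous_fst
      let μ : prod (projectiveSpace K (Fin (n - k) → K))
          ((prod (grassmannian K k n) Z).restrict S) → prod (grassmannian K (k + 1) n) Z :=
        fun r => pair (extendSubspace (s := s) (fst r) ⟨fst (snd r).1, (snd r).2⟩) (snd (snd r).1)
      have hμ : IsMorphism μ := by
        refine isMorphism_iff.2 fun r => ?_
        have h1 := ((isMorphism_val S).morphAt (snd r)).comp (morphAt_snd r)
        exact (morphAt_extendSubspace (morphAt_fst r) (morphAt_restrict_iff.2 h1.fst)).pair h1.snd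
      have hE := isComplete_projectiveSpace (K := K) (Fin (n - k) → K) _ _ (hC.preimage hμ.1)
      have hopen := hS.isOpenMap_subtype_val _ hE.isOpen_compl
      have hsub : (Subtype.val '' (snd '' (μ ⁻¹' C))ᶜ : Set (prod (grassmannian K k n) Z)) ⊆ Dᶜ := by
        rintro _ ⟨r, hr, rfl⟩ ⟨Λ', hle, hC'⟩
        obtain ⟨p, hp⟩ := exists_extendSubspace_eq (s := s) ⟨fst r.1, r.2⟩ hle
        refine hr ⟨pair p r, ?_, rfl⟩
        change pair (extendSubspace (s := s) p ⟨fst r.1, r.2⟩) (snd r.1) ∈ C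
        rwa [hp]
      refine mem_of_superset (hopen.mem_nhds ⟨⟨q, hs⟩, ?_, rfl⟩) hsub
      rintro ⟨r, hr, hr'⟩
      have hr1 : (snd r).1 = q := congrArg Subtype.val hr'
      refine hq ⟨extendSubspace (s := s) (fst r) ⟨fst (snd r).1, (snd r).2⟩, ?_, ?_⟩
      · rw [← hr1]
        exact le_sup_left
      · rw [← hr1]
        exact hr
    have := ih Z _ hD
    convert this using 1
    ext z
    constructor
    · rintro ⟨q, hq, rfl⟩
      obtain ⟨Λ, hΛ⟩ := exists_subspace_le (fst q)
      exact ⟨pair Λ (snd q), ⟨fst q, hΛ, hq⟩, rfl⟩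
    · rintro ⟨q, ⟨Λ', -, hq⟩, rfl⟩
      exact ⟨_, hq, rfl⟩

end Grassmannian

/-! ### Affine spaces -/

section Affine

variable {N : ℕ}

theorem eval_mem_polynomialFunctions (P : MvPolynomial (Fin N) K) :
    (fun w => MvPolynomial.eval w P) ∈ polynomialFunctions K (Fin N → K) := by
  induction P using MvPolynomial.induction_on with
  | C c =>
    simp only [MvPolynomial.eval_C]
    exact Subalgebra.algebraMap_mem _ c
  | add P Q hP hQ =>
    simp only [map_add]
    exact Subalgebra.add_mem _ hP hQ
  | mul_X P i hP =>
    simp only [map_mul, MvPolynomial.eval_X]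
    exact Subalgebra.mul_mem _ hP (dual_mem_polynomialFunctions
      (LinearMap.proj i : Module.Dual K (Fin N → K)))

theorem exists_eval_ne_zero_of_mem_nhds {v : Fin N → K}
    {s : Set (affineSpace K (Fin N → K))} (hs : s ∈ @nhds (affineSpace K (Fin N → K)) _ v) : ∃ P : MvPolynomial (Fin N) K,
      MvPolynomial.eval v P ≠ 0 ∧ ∀ w, MvPolynomial.eval w P ≠ 0 → w ∈ s := by
  obtain ⟨_, a, ha, -, hav, hsub⟩ := exists_basic_of_mem_nhds hs
  obtain ⟨P, hP⟩ := exists_eval_eq_of_mem_polynomialFunctions ha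
  exact ⟨P, fun h => hav ((hP v).trans h), fun w hw => hsub ⟨Set.mem_univ _, fun h => hw ((hP w).symm.trans h)⟩⟩

/-- A closed set is determined by its vanishing ideal, and ideals of polynomials satisfy the
ascending chain condition. -/
instance noetherianSpace_affineSpace_pi :
    TopologicalSpace.NoetherianSpace (affineSpace K (Fin N → K)) := by
  refine ((TopologicalSpace.noetherianSpace_TFAE (affineSpace K (Fin N → K))).out 0 1).2 ?_
  have hanti : StrictAnti fun C : TopologicalSpace.Closeds (affineSpace K (Fin N → K)) =>
      MvPolynomial.vanishingIdeal K C.carrier := by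
    refine Antitone.strictAnti_of_injective ?_ ?_
    · exact fun C D h => MvPolynomial.vanishingIdeal_anti_mono h
    · have key : ∀ C D : TopologicalSpace.Closeds (affineSpace K (Fin N → K)),
          MvPolynomial.vanishingIdeal K C.carrier =
            MvPolynomial.vanishingIdeal K D.carrier → C ≤ D := by
        intro C D h v hv
        by_contra hvD
        obtain ⟨P, hPv, hP⟩ := exists_eval_ne_zero_of_mem_nhds (D.isClosed.isOpen_compl.mem_nhds hvD)
        have hPD : P ∈ MvPolynomial.vanishingIdeal K D.carrier := by
          intro w hw
          rw [MvPolynomial.aeval_eq_eval]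
          by_contra h0
          exact hP w h0 hw
        rw [← h] at hPD
        exact hPv (hPD v hv)
      exact fun C D h => le_antisymm (key C D h) (key D C h.symm)
  exact hanti.wellFoundedLT

theorem irreducibleSpace_affineSpace_pi [Infinite K] :
    IrreducibleSpace (affineSpace K (Fin N → K)) := by
  have h1 : PreirreducibleSpace (affineSpace K (Fin N → K)) := by
    refine ⟨fun u v hu hv => ?_⟩
    rintro ⟨x, -, hx⟩ ⟨y, -, hy⟩
    obtain ⟨P, hPx, hP⟩ := exists_eval_ne_zero_of_mem_nhds (hu.mem_nhds hx)
    obtain ⟨Q, hQy, hQ⟩ := exists_eval_ne_zero_of_mem_nhds (hv.mem_nhds hy)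
    have hPQ : P * Q ≠ 0 := by
      refine mul_ne_zero ?_ ?_
      · rintro rfl
        exact hPx (map_zero _)
      · rintro rfl
        exact hQy (map_zero _)
    obtain ⟨w, hw⟩ : ∃ w, MvPolynomial.eval w (P * Q) ≠ 0 := by
      by_contra! h
      exact hPQ (MvPolynomial.funext fun w => by rw [h, map_zero])
    rw [map_mul] at hw
    exact ⟨w, trivial, hP w (left_ne_zero_of_mul hw), hQ w (right_ne_zero_of_mul hw)⟩
  exact { h1 with toNonempty := ⟨(0 : Fin N → K)⟩ }

/-- The germ of a polynomial. -/
noncomputable def polynomialGerm (v : affineSpace K (Fin N → K)) :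
    MvPolynomial (Fin N) K →+* (affineSpace K (Fin N → K)).localRing v :=
  ((Germ.coeRingHom (𝓝 v)).comp
    (RingHom.pi fun w : affineSpace K (Fin N → K) => MvPolynomial.eval w)).codRestrict _ fun P =>
      ⟨fun w => MvPolynomial.eval w P,
        regAt_polynomialFunctions (eval_mem_polynomialFunctions P) v, rfl⟩

/-- The ring of germs at `v` is the localization of the polynomial ring at the ideal of `v`, which
is regular. -/
theorem isRegularLocalRing_affineSpace_pi [Infinite K] (v : affineSpace K (Fin N → K)) :
    IsRegularLocalRing ((affineSpace K (Fin N → K)).localRing v) := by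
  let I : Ideal (MvPolynomial (Fin N) K) := MvPolynomial.vanishingIdeal K {v}
  have hI : ∀ P, P ∈ I ↔ MvPolynomial.eval v P = 0 := fun P => by
    exact MvPolynomial.mem_vanishingIdeal_singleton_iff _ _
  have hprime : I.IsPrime := (fun w => inferInstance : ∀ w : Fin N → K,
    (MvPolynomial.vanishingIdeal K {w} : Ideal (MvPolynomial (Fin N) K)).IsPrime) v
  let : Algebra (MvPolynomial (Fin N) K) ((affineSpace K (Fin N → K)).localRing v) :=
    (polynomialGerm v).toAlgebra
  have hloc : IsLocalization.AtPrime ((affineSpace K (Fin N → K)).localRing v) I := by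
    refine ⟨?_, ?_, ?_⟩
    · rintro ⟨P, hP⟩
      have hPv : MvPolynomial.eval v P ≠ 0 := fun h => hP ((hI P).2 h)
      have hreg := regAt_polynomialFunctions (eval_mem_polynomialFunctions P) v
      refine IsUnit.of_mul_eq_one
        ⟨_, _, (affineSpace K (Fin N → K)).regAt_inv _ v hreg hPv, rfl⟩ ?_
      refine Subtype.ext (Germ.coe_eq.2 ?_)
      filter_upwards [(affineSpace K (Fin N → K)).regAt_ne_zero _ v hreg hPv] with w hw
      exact mul_inv_cancel₀ hw
    · rintro ⟨_, f, ⟨_, -, a, ha, b, hb, hbv, hf⟩, rfl⟩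
      obtain ⟨P, hP⟩ := exists_eval_eq_of_mem_polynomialFunctions ha
      obtain ⟨Q, hQ⟩ := exists_eval_eq_of_mem_polynomialFunctions hb
      refine ⟨⟨P, ⟨Q, fun h => hbv ?_⟩⟩, Subtype.ext (Germ.coe_eq.2 ?_)⟩
      · exact (hQ v).trans ((hI Q).1 h)
      · have hreg := regAt_polynomialFunctions hb v
        filter_upwards [hf, (affineSpace K (Fin N → K)).regAt_ne_zero _ v hreg hbv] with w hw hbw
        change f w * MvPolynomial.eval w Q = MvPolynomial.eval w P
        rw [show MvPolynomial.eval w Q = b w from (hQ w).symm,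
          show MvPolynomial.eval w P = a w from (hP w).symm, show f w = a w / b w from hw,
          div_mul_cancel₀ _ hbw]
    · intro P Q h
      have h' := Germ.coe_eq.1 (congrArg Subtype.val h)
      -- Germs that agree do so off the zero set of some `C` with `C(v) ≠ 0`. Then `C P` and `C Q`
      -- agree at all points, hence as polynomials over the infinite field.
      obtain ⟨C, hCv, hC⟩ := exists_eval_ne_zero_of_mem_nhds h'
      refine ⟨⟨C, fun h => hCv ((hI C).1 h)⟩, MvPolynomial.funext fun w => ?_⟩
      rw [map_mul, map_mul]
      by_cases hw : MvPolynomial.eval w C = 0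
      · rw [hw, zero_mul, zero_mul]
      · congr 1
        exact hC w hw
  exact IsRegularLocalRing.of_ringEquiv
    (IsLocalization.algEquiv I.primeCompl (Localization.AtPrime I)
      ((affineSpace K (Fin N → K)).localRing v)).toRingEquiv

end Affine

/-! ### Local rings and local isomorphisms -/

/-- The pullback of germs. -/
def localRingMap {X Y : SpaceWithFunctions K} {φ : X → Y} {p : X} (h : MorphAt φ p) :
    Y.localRing (φ p) →+* X.localRing p where
  toFun g := ⟨g.1.compTendsto φ h.1, by
    obtain ⟨_, f, hf, rfl⟩ := g
    exact ⟨f ∘ φ, h.2 f hf, rfl⟩⟩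
  map_one' := rfl
  map_zero' := rfl
  map_add' := by
    rintro ⟨_, f, hf, rfl⟩ ⟨_, g, hg, rfl⟩
    rfl
  map_mul' := by
    rintro ⟨_, f, hf, rfl⟩ ⟨_, g, hg, rfl⟩
    rfl

theorem bijective_localRingMap {X Y : SpaceWithFunctions K} {φ : X → Y} {ψ : Y → X} {p : X}
    (h : MorphAt φ p) (h' : MorphAt ψ (φ p)) (h1 : ∀ᶠ x in 𝓝 p, ψ (φ x) = x)
    (h2 : ∀ᶠ y in 𝓝 (φ p), φ (ψ y) = y) : Function.Bijective (localRingMap h) := by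
  constructor
  · rintro ⟨_, f, hf, rfl⟩ ⟨_, g, hg, rfl⟩ hfg
    have h3 : ∀ᶠ x in 𝓝 p, f (φ x) = g (φ x) := Germ.coe_eq.1 (congrArg Subtype.val hfg)
    rw [← h1.self_of_nhds] at h3
    refine Subtype.ext (Germ.coe_eq.2 ?_)
    filter_upwards [h'.eventually h3, h2] with y h4 h5
    rwa [h5] at h4
  · rintro ⟨_, r, hr, rfl⟩
    rw [← h1.self_of_nhds] at hr
    refine ⟨⟨_, _, h'.2 r hr, rfl⟩, Subtype.ext (Germ.coe_eq.2 ?_)⟩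
    filter_upwards [h1] with x hx
    exact congrArg r hx

theorem isSmooth_of_charts [Infinite K] {X : SpaceWithFunctions K}
    (h : ∀ p : X, ∃ U : Set X, IsOpen U ∧ p ∈ U ∧ ∃ (d : ℕ)
      (e : X.restrict U ≃ affineSpace K (Fin d → K)), IsIsomorphism e) : IsSmooth X := by
  classical
  intro p
  obtain ⟨U, hU, hp, d, e, he⟩ := h p
  -- The chart, extended by a constant outside `U` because germs are taken of functions on all of
  -- `X`.
  let ψ : X → affineSpace K (Fin d → K) := fun x => if hx : x ∈ U then e ⟨x, hx⟩ else e ⟨p, hp⟩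
  let φ : affineSpace K (Fin d → K) → X := fun a => (e.symm a).1
  have hψU : ∀ x : X.restrict U, ψ x.1 = e x := fun x => dif_pos x.2
  have hφψ : ∀ x ∈ U, φ (ψ x) = x := by
    intro x hx
    change (e.symm (ψ x)).1 = x
    exact congrArg Subtype.val
      ((congrArg e.symm (hψU ⟨x, hx⟩)).trans (e.symm_apply_apply ⟨x, hx⟩))
  have hψφ : ∀ a, ψ (φ a) = a := fun a => (hψU (e.symm a)).trans (e.apply_symm_apply a)
  have hφ : ∀ a, MorphAt φ a := fun a => ((isMorphism_val U).comp he.2).morphAt a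
  have hψ : MorphAt ψ p := by
    refine morphAt_of_restrict hU hp ?_
    have := he.1.morphAt ⟨p, hp⟩
    exact this.congr (Eventually.of_forall fun x => (hψU x).symm)
  have hbij := bijective_localRingMap hψ (hφ _)
    (by filter_upwards [hU.mem_nhds hp] with x hx using hφψ x hx)
    (Eventually.of_forall fun a => hψφ a)
  have := isRegularLocalRing_affineSpace_pi (ψ p)
  exact IsRegularLocalRing.of_ringEquiv (RingEquiv.ofBijective _ hbij)

/-! ### Affine varieties -/

theorem isIsomorphism_linearEquiv {V W : Type u} [AddCommGroup V] [Module K V] [AddCommGroup W]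
    [Module K W] (e : V ≃ₗ[K] W) :
    IsIsomorphism (X := affineSpace K V) (Y := affineSpace K W) e.toEquiv :=
  ⟨isMorphism_linearMap e.toLinearMap, isMorphism_linearMap e.symm.toLinearMap⟩

/-- The restriction of a bijection to a subset. -/
def restrictEquiv {X Y : SpaceWithFunctions K} (e : X ≃ Y) (S : Set X) (T : Set Y)
    (h : ∀ x, x ∈ S ↔ e x ∈ T) : X.restrict S ≃ Y.restrict T where
  toFun x := ⟨e x.1, (h _).1 x.2⟩
  invFun y := ⟨e.symm y.1, (h _).2 (by simpa using y.2)⟩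
  left_inv x := Subtype.ext (e.symm_apply_apply _)
  right_inv y := Subtype.ext (e.apply_symm_apply _)

theorem isIsomorphism_restrictEquiv {X Y : SpaceWithFunctions K} {e : X ≃ Y}
    (he : IsIsomorphism e) {S : Set X} {T : Set Y} (h : ∀ x, x ∈ S ↔ e x ∈ T) :
    IsIsomorphism (restrictEquiv e S T h) :=
  ⟨isMorphism_iff.2 fun _ => morphAt_restrict_iff.2 (he.1.morphAt _).restrict,
    isMorphism_iff.2 fun _ => morphAt_restrict_iff.2 (he.2.morphAt _).restrict⟩

theorem IsAffineVariety.of_isIsomorphism {X Y : SpaceWithFunctions K} (h : IsAffineVariety Y)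
    {e : X ≃ Y} (he : IsIsomorphism e) : IsAffineVariety X := by
  obtain ⟨N, S, hS, e', he'⟩ := h
  exact ⟨N, S, hS, e.trans e', he.trans he'⟩

theorem isAffineVariety_restrict_affineSpace {V : Type u} [AddCommGroup V] [Module K V]
    [FiniteDimensional K V] {S : Set (affineSpace K V)} (hS : IsClosed S) :
    IsAffineVariety ((affineSpace K V).restrict S) := by
  let e := (Module.finBasis K V).equivFun
  have he := isIsomorphism_linearEquiv e
  refine ⟨_, e.symm ⁻¹' S, hS.preimage he.2.1, _,
    isIsomorphism_restrictEquiv he (S := S) (T := e.symm ⁻¹' S) fun x => ?_⟩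
  exact (iff_of_eq (congrArg (· ∈ S) (e.symm_apply_apply x))).symm

theorem isAffineVariety_affineSpace_pi (N : ℕ) : IsAffineVariety (affineSpace K (Fin N → K)) := by
  refine ⟨N, Set.univ, isClosed_univ, (Equiv.Set.univ _).symm, ?_, ?_⟩
  · exact isMorphism_iff.2 fun p => morphAt_restrict_iff.2 (morphAt_id p)
  · exact isMorphism_val _

/-- An affine subspace of a vector space is isomorphic to an affine space. -/
theorem exists_isIsomorphism_affineSubspace {V W : Type u} [AddCommGroup V] [Module K V]
    [FiniteDimensional K V] [AddCommGroup W] [Module K W] (L : V →ₗ[K] W) {w : W} {v₀ : V}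
    (hv₀ : L v₀ = w) : ∃ (d : ℕ)
      (e : (affineSpace K V).restrict {v : V | L v = w} ≃ affineSpace K (Fin d → K)),
      IsIsomorphism e := by
  obtain ⟨P, hP⟩ := (LinearMap.ker L).subtype.exists_leftInverse_of_injective
    (LinearMap.ker L).ker_subtype
  have hP' : ∀ x : LinearMap.ker L, P x = x := fun x => congrArg (fun f => f x) hP
  let b := (Module.finBasis K (LinearMap.ker L)).equivFun
  let e : {v : V // L v = w} ≃ (Fin (Module.finrank K (LinearMap.ker L)) → K) :=
    { toFun := fun v => b (P (v.1 - v₀))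
      invFun := fun x => ⟨v₀ + (b.symm x : V), by rw [map_add, hv₀, (b.symm x).2, add_zero]⟩
      left_inv := fun v => by
        have : v.1 - v₀ ∈ LinearMap.ker L := by
          rw [LinearMap.mem_ker, map_sub, hv₀, v.2, sub_self]
        ext
        simp [hP' ⟨_, this⟩]
      right_inv := fun x => by simp [hP'] }
  refine ⟨_, e, ?_, ?_⟩
  · refine isMorphism_iff.2 fun p => morphAt_affineSpace fun l => ?_
    have h1 := ((isMorphism_val _).morphAt p).regAt_dual
      (l ∘ₗ b.toLinearMap ∘ₗ P)
    have := regAt_sub h1 (((affineSpace K V).restrict _).regAt_const (l (b (P v₀))) p)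
    convert this using 1
    funext v
    have (v : V) : l (b (P (v - v₀))) = l (b (P v)) - l (b (P v₀)) := by simp only [map_sub]
    exact this v.1
  · refine isMorphism_iff.2 fun x => morphAt_restrict_iff.2 (morphAt_affineSpace fun l => ?_)
    have := (affineSpace K _).regAt_add _ _ _ ((affineSpace K _).regAt_const (l v₀) x)
      (regAt_dual (l ∘ₗ (LinearMap.ker L).subtype ∘ₗ b.symm.toLinearMap) x)
    convert this using 1
    funext x
    exact map_add l _ _

/-! ### Points of the incidence variety -/

section Incidence

variable {m n k : ℕ}

/-- The point of projective space given by a nonzero matrix. -/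
def matrixPoint (M : Matrix (Fin m) (Fin n) K) (h : M ≠ 0) : matrixSpace K m n := projPoint M h

/-- A matrix representing a point of projective space. -/
noncomputable def matrixRep (φ : matrixSpace K m n) : Matrix (Fin m) (Fin n) K :=
  projRep (V := Matrix (Fin m) (Fin n) K) φ

/-- The matrix representing a point of projective space at which `l` takes the value `1`. -/
noncomputable def matrixNormalize (l : Module.Dual K (Matrix (Fin m) (Fin n) K))
    (φ : matrixSpace K m n) : Matrix (Fin m) (Fin n) K :=
  projNormalize (V := Matrix (Fin m) (Fin n) K) l φ

theorem matrixKer_eq_ker_matrixRep (φ : matrixSpace K m n) :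
    matrixKer K φ = LinearMap.ker (matrixRep φ).mulVecLin := rfl

theorem matrixRep_ne_zero (φ : matrixSpace K m n) : matrixRep φ ≠ 0 :=
  projRep_ne_zero (V := Matrix (Fin m) (Fin n) K) φ

theorem matrixKer_matrixPoint (M : Matrix (Fin m) (Fin n) K) (h : M ≠ 0) :
    matrixKer K (matrixPoint M h) = LinearMap.ker M.mulVecLin := matrixKer_projPoint M h

theorem ker_matrixNormalize {l : Module.Dual K (Matrix (Fin m) (Fin n) K)}
    {φ : matrixSpace K m n} (h : l (matrixRep φ) ≠ 0) :
    LinearMap.ker (matrixNormalize l φ).mulVecLin = matrixKer K φ :=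
  (matrixKer_eq_ker_projNormalize h).symm

theorem matrixNormalize_ne_zero {l : Module.Dual K (Matrix (Fin m) (Fin n) K)}
    {φ : matrixSpace K m n} (h : l (matrixRep φ) ≠ 0) : matrixNormalize l φ ≠ 0 :=
  projNormalize_ne_zero h

theorem matrixPoint_matrixNormalize {l : Module.Dual K (Matrix (Fin m) (Fin n) K)}
    {φ : matrixSpace K m n} (h : l (matrixRep φ) ≠ 0) :
    matrixPoint (matrixNormalize l φ) (matrixNormalize_ne_zero h) = φ :=
  projPoint_projNormalize h

theorem matrixPoint_matrixRep (φ : matrixSpace K m n) :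
    matrixPoint (matrixRep φ) (matrixRep_ne_zero φ) = φ :=
  projPoint_projRep (V := Matrix (Fin m) (Fin n) K) φ

theorem matrixNormalize_matrixPoint (l : Module.Dual K (Matrix (Fin m) (Fin n) K))
    (M : Matrix (Fin m) (Fin n) K) (h : M ≠ 0) :
    matrixNormalize l (matrixPoint M h) = (l M)⁻¹ • M := projNormalize_projPoint l M h

theorem isOpen_matrixRep_ne_zero (l : Module.Dual K (Matrix (Fin m) (Fin n) K)) :
    IsOpen {φ : matrixSpace K m n | l (matrixRep φ) ≠ 0} := isOpen_projRep_ne_zero l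

theorem exists_dual_matrixRep_ne_zero (φ : matrixSpace K m n) :
    ∃ l : Module.Dual K (Matrix (Fin m) (Fin n) K), l (matrixRep φ) ≠ 0 :=
  exists_dual_projRep_ne_zero (V := Matrix (Fin m) (Fin n) K) φ

theorem regAt_matrixNormalize {l : Module.Dual K (Matrix (Fin m) (Fin n) K)}
    {φ : matrixSpace K m n} (h : l (matrixRep φ) ≠ 0) (i : Fin m) (j : Fin n) :
    (matrixSpace K m n).RegAt (fun φ => matrixNormalize l φ i j) φ :=
  (morphAt_projNormalize h).regAt_entry i j

theorem morphAt_matrixSpace {Z : SpaceWithFunctions K} {f : Z → matrixSpace K m n}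
    {F : Z → Matrix (Fin m) (Fin n) K} {p : Z} (hF : ∀ i j, Z.RegAt (fun z => F z i j) p)
    (h : ∀ᶠ z in 𝓝 p, ∃ hz : F z ≠ 0, f z = matrixPoint (F z) hz) : MorphAt f p :=
  morphAt_projectiveSpace (morphAt_matrix hF) h

theorem isSeparated_matrixSpace : IsSeparated (matrixSpace K m n) :=
  isSeparated_projectiveSpace

theorem isComplete_matrixSpace [IsAlgClosed K] : IsComplete (matrixSpace K m n) :=
  isComplete_projectiveSpace _

/-- The matrix of a point of the incidence variety, up to scalars. -/
def incidencePhi (q : incidenceVariety K m n k) : matrixSpace K m n := snd q.1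

theorem subspace_incidenceRho_le (q : incidenceVariety K m n k) :
    subspace K (incidenceRho K q) ≤ matrixKer K (incidencePhi q) := q.2.2

theorem incidence_ext {q q' : incidenceVariety K m n k}
    (h1 : incidenceRho K q = incidenceRho K q') (h2 : incidencePhi q = incidencePhi q') : q = q' :=
  Subtype.ext (prod_ext h1 h2)

/-- The point `(Λ, φ)` of the incidence variety. -/
def incidencePoint (Λ : grassmannian K k n) (φ : matrixSpace K m n)
    (h : subspace K Λ ≤ matrixKer K φ) : incidenceVariety K m n k :=
  ⟨pair Λ φ, by rw [incidenceLocus_eq]; exact h⟩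

theorem isMorphism_incidenceRho :
    IsMorphism (X := incidenceVariety K m n k) (Y := grassmannian K k n) (incidenceRho K) :=
  isMorphism_fst.comp (isMorphism_val _)

theorem isMorphism_incidencePhi :
    IsMorphism (X := incidenceVariety K m n k) (Y := matrixSpace K m n) incidencePhi :=
  isMorphism_snd.comp (isMorphism_val _)

theorem morphAt_incidenceVariety {Z : SpaceWithFunctions K} {f : Z → incidenceVariety K m n k}
    {p : Z} (h1 : MorphAt (X := Z) (Y := grassmannian K k n) (fun z => incidenceRho K (f z)) p)
    (h2 : MorphAt (X := Z) (Y := matrixSpace K m n) (fun z => incidencePhi (f z)) p) :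
    MorphAt f p :=
  morphAt_restrict_iff.2 (h1.pair h2)

theorem isMorphism_incidenceNu :
    IsMorphism (X := incidenceVariety K m n k) (Y := detVariety K m n k) (incidenceNu K) :=
  isMorphism_iff.2 fun p => morphAt_restrict_iff.2 (isMorphism_incidencePhi.morphAt p)

theorem exists_grassmannian_le {W : Submodule K (Fin n → K)} (h : k ≤ Module.finrank K W) :
    ∃ Λ : grassmannian K k n, subspace K Λ ≤ W := by
  obtain ⟨f, hf⟩ := exists_linearIndependent_of_le_finrank h
  refine ⟨framePoint ⟨fun i => (f i : Fin n → K), hf.map' W.subtype W.ker_subtype⟩, ?_⟩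
  change Submodule.span K (Set.range fun i => (f i : Fin n → K)) ≤ W
  rw [Submodule.span_le]
  rintro _ ⟨i, rfl⟩
  exact (f i).2

/-- Through this surjection the determinantal variety inherits quasi-compactness and irreducibility.
-/
theorem surjective_incidenceNu :
    Function.Surjective (incidenceNu K (m := m) (n := n) (k := k)) := by
  intro y
  obtain ⟨Λ, hΛ⟩ := exists_grassmannian_le (show k ≤ Module.finrank K (matrixKer K y.1) from y.2)
  exact ⟨incidencePoint Λ y.1 hΛ, rfl⟩

/-- The locus is the image of the closed incidence locus under the projection along the complete
Grassmannian. -/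
theorem isClosed_detLocus [IsAlgClosed K] : IsClosed (detLocus K m n k) := by
  have := isComplete_grassmannian k n (matrixSpace K m n) _ (isClosed_incidenceLocus (k := k))
  convert this using 1
  ext φ
  constructor
  · intro h
    obtain ⟨Λ, hΛ⟩ := exists_grassmannian_le (show k ≤ Module.finrank K (matrixKer K φ) from h)
    exact ⟨pair Λ φ, ⟨h, hΛ⟩, rfl⟩
  · rintro ⟨q, hq, rfl⟩
    exact hq.1

/-! ### Kernels of surjective matrices -/

/-- The kernel of a surjective matrix, as a point of the Grassmannian. -/
def kerPoint (hk : k ≤ n) (c : Matrix (Fin (n - k)) (Fin n) K)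
    (hc : LinearMap.range c.mulVecLin = ⊤) : grassmannian K k n :=
  ⟨LinearMap.ker c.mulVecLin, by
    have := LinearMap.finrank_range_add_finrank_ker c.mulVecLin
    rw [hc, finrank_top] at this
    simp only [Module.finrank_fintype_fun_eq_card, Fintype.card_fin] at this
    omega⟩

@[simp] theorem subspace_kerPoint (hk : k ≤ n) (c : Matrix (Fin (n - k)) (Fin n) K)
    (hc : LinearMap.range c.mulVecLin = ⊤) :
    subspace K (kerPoint hk c hc) = LinearMap.ker c.mulVecLin := rfl

theorem range_eq_top_of_mul_eq_one {c : Matrix (Fin (n - k)) (Fin n) K}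
    {S : Matrix (Fin n) (Fin (n - k)) K} (h : c * S = 1) : LinearMap.range c.mulVecLin = ⊤ := by
  refine LinearMap.range_eq_top.2 fun u => ⟨S.mulVec u, ?_⟩
  rw [Matrix.mulVecLin_apply, Matrix.mulVec_mulVec, h, Matrix.one_mulVec]

theorem exists_mul_eq_one_of_range_eq_top {c : Matrix (Fin (n - k)) (Fin n) K}
    (h : LinearMap.range c.mulVecLin = ⊤) : ∃ S : Matrix (Fin n) (Fin (n - k)) K, c * S = 1 := by
  obtain ⟨s, hs⟩ := LinearMap.exists_rightInverse_of_surjective _ h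
  refine ⟨LinearMap.toMatrix' s, ?_⟩
  rw [← LinearMap.toMatrix'_id, ← hs, LinearMap.toMatrix'_comp,
    ← Matrix.toLin'_apply', LinearMap.toMatrix'_toLin']

theorem range_eq_top_of_det_ne_zero {c : Matrix (Fin (n - k)) (Fin n) K}
    {S : Matrix (Fin n) (Fin (n - k)) K} (h : (c * S).det ≠ 0) :
    LinearMap.range c.mulVecLin = ⊤ :=
  range_eq_top_of_mul_eq_one (S := S * (c * S)⁻¹) (by
    rw [← Matrix.mul_assoc, Matrix.mul_nonsing_inv _ (isUnit_iff_ne_zero.2 h)])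

theorem eventually_range_eq_top {Z : SpaceWithFunctions K}
    {F : Z → Matrix (Fin (n - k)) (Fin n) K} {p : Z} (hF : ∀ i j, Z.RegAt (fun z => F z i j) p)
    (hp : LinearMap.range (F p).mulVecLin = ⊤) :
    ∀ᶠ z in 𝓝 p, LinearMap.range (F z).mulVecLin = ⊤ := by
  obtain ⟨S, hS⟩ := exists_mul_eq_one_of_range_eq_top hp
  have hreg : Z.RegAt (fun z => (F z * S).det) p :=
    regAt_det _ (regAt_matrix_mul hF (N := fun _ => S) fun _ _ => Z.regAt_const _ _)
  filter_upwards [Z.regAt_ne_zero _ _ hreg (by simp [hS])] with z hz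
  exact range_eq_top_of_det_ne_zero hz

/-- A matrix that vanishes on `Λ` factors through the coordinates of the quotient. -/
theorem mul_section_mul_quotientMatrix {s : (Fin (n - k) → K) →ₗ[K] (Fin n → K)}
    {Λ : grassmannian K k n} (hΛ : Λ ∈ quotientChart K s) {M : Matrix (Fin m) (Fin n) K}
    (h : subspace K Λ ≤ LinearMap.ker M.mulVecLin) :
    M * LinearMap.toMatrix' s * quotientMatrix s Λ = M := by
  refine Matrix.ext_of_mulVec_single fun j => ?_
  have h1 : Pi.single j 1 - s (quotientCoord s Λ (Pi.single j 1)) ∈ subspace K Λ := by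
    rw [← ker_quotientCoord hΛ, LinearMap.mem_ker, map_sub, quotientCoord_section hΛ, sub_self]
  have h2 := h h1
  rw [LinearMap.mem_ker, map_sub, sub_eq_zero] at h2
  rw [← Matrix.mulVec_mulVec, ← Matrix.mulVec_mulVec, quotientMatrix_mulVec,
    LinearMap.toMatrix'_mulVec]
  exact h2.symm

/-! ### A parametrization of the incidence variety -/

theorem mul_ne_zero_of_range_eq_top {c : Matrix (Fin (n - k)) (Fin n) K}
    {ψ : Matrix (Fin m) (Fin (n - k)) K} (hc : LinearMap.range c.mulVecLin = ⊤) (hψ : ψ ≠ 0) :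
    ψ * c ≠ 0 := by
  obtain ⟨S, hS⟩ := exists_mul_eq_one_of_range_eq_top hc
  intro h
  apply hψ
  rw [← Matrix.mul_one ψ, ← hS, ← Matrix.mul_assoc, h, Matrix.zero_mul]

/-- The point `(ker c, ψ c)` of the incidence variety. -/
def incidenceOfFactors (hk : k ≤ n) (c : Matrix (Fin (n - k)) (Fin n) K)
    (ψ : Matrix (Fin m) (Fin (n - k)) K) (hc : LinearMap.range c.mulVecLin = ⊤) (hψ : ψ ≠ 0) :
    incidenceVariety K m n k :=
  incidencePoint (kerPoint hk c hc) (matrixPoint (ψ * c) (mul_ne_zero_of_range_eq_top hc hψ)) (by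
    rw [matrixKer_matrixPoint, subspace_kerPoint]
    intro v hv
    rw [LinearMap.mem_ker, Matrix.mulVecLin_apply] at hv ⊢
    rw [← Matrix.mulVec_mulVec, hv, Matrix.mulVec_zero])

theorem morphAt_incidenceOfFactors (hk : k ≤ n) {Z : SpaceWithFunctions K}
    {C : Z → Matrix (Fin (n - k)) (Fin n) K} {Ψ : Z → Matrix (Fin m) (Fin (n - k)) K}
    (hC : ∀ z, LinearMap.range (C z).mulVecLin = ⊤) (hΨ : ∀ z, Ψ z ≠ 0) {p : Z}
    (hC' : ∀ i j, Z.RegAt (fun z => C z i j) p) (hΨ' : ∀ i j, Z.RegAt (fun z => Ψ z i j) p) :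
    MorphAt (X := Z) (Y := incidenceVariety K m n k)
      (fun z => incidenceOfFactors hk (C z) (Ψ z) (hC z) (hΨ z)) p := by
  refine morphAt_incidenceVariety ?_ ?_
  · exact morphAt_ker hC' (Eventually.of_forall fun z => rfl)
  · exact morphAt_matrixSpace (regAt_matrix_mul hΨ' hC')
      (Eventually.of_forall fun z => ⟨mul_ne_zero_of_range_eq_top (hC z) (hΨ z), rfl⟩)

theorem exists_incidenceOfFactors_eq (hk : k ≤ n) (q : incidenceVariety K m n k) :
    ∃ c ψ hc hψ, incidenceOfFactors hk c ψ hc hψ = q := by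
  obtain ⟨s, hs⟩ := exists_mem_quotientChart (incidenceRho K q)
  have hM := mul_section_mul_quotientMatrix hs
    ((subspace_incidenceRho_le q).trans_eq (matrixKer_eq_ker_matrixRep _))
  refine ⟨quotientMatrix s (incidenceRho K q),
    matrixRep (incidencePhi q) * LinearMap.toMatrix' s,
    range_eq_top_of_mul_eq_one (quotientMatrix_mul_section hs), ?_, incidence_ext ?_ ?_⟩
  · intro h
    rw [h, Matrix.zero_mul] at hM
    exact matrixRep_ne_zero _ hM.symm
  · refine subspace_injective ?_
    change LinearMap.ker (quotientMatrix s (incidenceRho K q)).mulVecLin = _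
    rw [mulVecLin_quotientMatrix, ker_quotientCoord hs]
  · conv_rhs => rw [← matrixPoint_matrixRep (incidencePhi q)]
    change matrixPoint _ _ = _
    congr 1

theorem exists_range_eq_top (k n : ℕ) :
    ∃ c : Matrix (Fin (n - k)) (Fin n) K, LinearMap.range c.mulVecLin = ⊤ := by
  refine ⟨LinearMap.toMatrix' (LinearMap.funLeft K K (Fin.castLE (Nat.sub_le n k))), ?_⟩
  rw [← Matrix.toLin'_apply', Matrix.toLin'_toMatrix', LinearMap.range_eq_top]
  exact LinearMap.funLeft_surjective_of_injective _ _ _ (Fin.castLE_injective _)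

theorem exists_injective_matrix {r : ℕ} (hr : r ≤ m) :
    ∃ ψ : Matrix (Fin m) (Fin r) K, LinearMap.ker ψ.mulVecLin = ⊥ := by
  obtain ⟨g, hg⟩ := LinearMap.exists_rightInverse_of_surjective
    (LinearMap.funLeft K K (Fin.castLE hr)) (LinearMap.range_eq_top.2
      (LinearMap.funLeft_surjective_of_injective _ _ _ (Fin.castLE_injective hr)))
  refine ⟨LinearMap.toMatrix' g, ?_⟩
  rw [← Matrix.toLin'_apply', Matrix.toLin'_toMatrix']
  exact LinearMap.ker_eq_bot_of_inverse hg

theorem noetherianSpace_affineSpace {V : Type u} [AddCommGroup V] [Module K V]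
    [FiniteDimensional K V] : TopologicalSpace.NoetherianSpace (affineSpace K V) :=
  (isIsomorphism_linearEquiv (Module.finBasis K V).equivFun).homeomorph.isInducing.noetherianSpace

theorem irreducibleSpace_affineSpace [Infinite K] {V : Type u} [AddCommGroup V] [Module K V]
    [FiniteDimensional K V] : IrreducibleSpace (affineSpace K V) :=
  (isIsomorphism_linearEquiv (Module.finBasis K V).equivFun).homeomorph.irreducibleSpace_iff.2
    irreducibleSpace_affineSpace_pi

/-- The pairs `(c, ψ)` with `c` surjective and `ψ ≠ 0` form a nonempty open subset of a vector
space, hence an irreducible quasi-compact space. It maps onto the incidence variety by `(c, ψ) ↦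
(ker c, ψ c)`. -/
theorem compactSpace_and_irreducibleSpace_incidenceVariety [Infinite K] (hkn : k < n)
    (hm : 0 < m) : CompactSpace (incidenceVariety K m n k) ∧
      IrreducibleSpace (incidenceVariety K m n k) := by
  let V := Matrix (Fin (n - k)) (Fin n) K × Matrix (Fin m) (Fin (n - k)) K
  let A := affineSpace K V
  let E : Set A := {x : V | LinearMap.range x.1.mulVecLin = ⊤ ∧ x.2 ≠ 0}
  have hreg1 : ∀ (p : A) i j, A.RegAt (fun x : V => x.1 i j) p := fun p i j =>
    regAt_dual (Matrix.entryLinearMap K K i j ∘ₗ LinearMap.fst K _ _ : Module.Dual K V) p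
  have hreg2 : ∀ (p : A) i j, A.RegAt (fun x : V => x.2 i j) p := fun p i j =>
    regAt_dual (Matrix.entryLinearMap K K i j ∘ₗ LinearMap.snd K _ _ : Module.Dual K V) p
  have hE : IsOpen E := by
    refine isOpen_iff_mem_nhds.2 ?_
    rintro p ⟨hp1, hp2⟩
    obtain ⟨i, j, hij⟩ : ∃ i j, (show V from p).2 i j ≠ 0 := by
      by_contra! h
      exact hp2 (Matrix.ext h)
    filter_upwards [eventually_range_eq_top (hreg1 p) hp1,
      A.regAt_ne_zero _ p (hreg2 p i j) hij] with x hx1 hx2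
    exact ⟨hx1, fun h => hx2 (congrFun (congrFun h i) j)⟩
  have hne : E.Nonempty := by
    obtain ⟨c, hc⟩ := exists_range_eq_top (K := K) k n
    -- A nonzero `ψ` needs at least one entry; this uses `0 < m` and `k < n`.
    refine ⟨(c, fun _ _ => 1), hc, fun h => ?_⟩
    exact one_ne_zero (congrFun (congrFun h ⟨0, hm⟩) ⟨0, Nat.sub_pos_of_lt hkn⟩)
  have := noetherianSpace_affineSpace (K := K) (V := V)
  have := irreducibleSpace_affineSpace (K := K) (V := V)
  have hirr : IsIrreducible E := ⟨hne,
    (IrreducibleSpace.isIrreducible_univ A).isPreirreducible.open_subset hE (Set.subset_univ _)⟩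
  have h1 : IrreducibleSpace (A.restrict E) := Subtype.irreducibleSpace hirr
  have h2 : CompactSpace (A.restrict E) :=
    isCompact_iff_compactSpace.1 (TopologicalSpace.NoetherianSpace.isCompact E)
  let f : A.restrict E → incidenceVariety K m n k := fun x =>
    incidenceOfFactors hkn.le (show V from x.1).1 (show V from x.1).2 x.2.1 x.2.2
  have hf : IsMorphism f := isMorphism_iff.2 fun p =>
    morphAt_incidenceOfFactors hkn.le (fun x : A.restrict E => x.2.1) (fun x => x.2.2)
      (fun i j => ((isMorphism_val E).morphAt p).regAt (hreg1 p.1 i j))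
      (fun i j => ((isMorphism_val E).morphAt p).regAt (hreg2 p.1 i j))
  have hs : Function.Surjective f := fun q => by
    obtain ⟨c, ψ, hc, hψ, h⟩ := exists_incidenceOfFactors_eq hkn.le q
    exact ⟨⟨(c, ψ), hc, hψ⟩, h⟩
  exact ⟨hs.compactSpace hf.1, hs.irreducibleSpace hf.1⟩

/-! ### Charts of the incidence variety -/

/-- The linear form `M ↦ (M s)ᵢⱼ` on matrices. -/
noncomputable def sectionEntry (s : (Fin (n - k) → K) →ₗ[K] (Fin n → K)) (i : Fin m)
    (j : Fin (n - k)) : Module.Dual K (Matrix (Fin m) (Fin n) K) :=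
  LinearMap.proj i ∘ₗ (Matrix.mulVecBilin K K).flip (s (Pi.single j 1))

theorem sectionEntry_apply (s : (Fin (n - k) → K) →ₗ[K] (Fin n → K)) (i : Fin m)
    (j : Fin (n - k)) (M : Matrix (Fin m) (Fin n) K) :
    sectionEntry s i j M = (M * LinearMap.toMatrix' s) i j := by
  have : (M * LinearMap.toMatrix' s) i j =
      ((M * LinearMap.toMatrix' s).mulVec (Pi.single j 1)) i := by simp
  rw [this, ← Matrix.mulVec_mulVec, LinearMap.toMatrix'_mulVec]
  rfl

/-- In a point given by `(c, ψ)`, `c` is determined up to an invertible factor that `ψ` absorbs, and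
`ψ` up to a scalar. The conditions `c S = 1` and `ψ i j = 1` remove both ambiguities and are affine
linear. -/
theorem exists_chart_incidenceVariety (hk : k ≤ n) (p : incidenceVariety K m n k) :
    ∃ U : Set (incidenceVariety K m n k), IsOpen U ∧ p ∈ U ∧ ∃ (d : ℕ)
      (e : (incidenceVariety K m n k).restrict U ≃ affineSpace K (Fin d → K)),
        IsIsomorphism e := by
  obtain ⟨s, hs⟩ := exists_mem_quotientChart (incidenceRho K p)
  let S := LinearMap.toMatrix' s
  -- A representative `M` equals `(M S) c`, so `M S` has a nonzero entry.
  obtain ⟨i, j, hij⟩ : ∃ i j, sectionEntry s i j (matrixRep (incidencePhi p)) ≠ 0 := by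
    by_contra! h
    have hM := mul_section_mul_quotientMatrix hs
      ((subspace_incidenceRho_le p).trans_eq (matrixKer_eq_ker_matrixRep _))
    rw [show matrixRep (incidencePhi p) * LinearMap.toMatrix' s = 0 from
      Matrix.ext fun i j => (sectionEntry_apply s i j _).symm.trans (h i j), Matrix.zero_mul] at hM
    exact matrixRep_ne_zero _ hM.symm
  let l := sectionEntry (m := m) s i j
  let U : Set (incidenceVariety K m n k) :=
    {q | incidenceRho K q ∈ quotientChart K s ∧ l (matrixRep (incidencePhi q)) ≠ 0}
  have hU : IsOpen U := ((isOpen_quotientChart s).preimage isMorphism_incidenceRho.1).inter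
    ((isOpen_matrixRep_ne_zero l).preimage isMorphism_incidencePhi.1)
  let V := Matrix (Fin (n - k)) (Fin n) K × Matrix (Fin m) (Fin (n - k)) K
  let L : V →ₗ[K] Matrix (Fin (n - k)) (Fin (n - k)) K × K :=
    LinearMap.prodMap (mulRightLinearMap (Fin (n - k)) K S) (Matrix.entryLinearMap K K i j)
  let w : Matrix (Fin (n - k)) (Fin (n - k)) K × K := (1, 1)
  have hL : ∀ x : V, L x = w ↔ x.1 * S = 1 ∧ x.2 i j = 1 := fun x =>
    Prod.ext_iff (x := L x) (y := w)
  have hcs : ∀ c : Matrix (Fin (n - k)) (Fin n) K, c * S = 1 → ∀ u, c.mulVecLin (s u) = u := by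
    intro c hc u
    rw [Matrix.mulVecLin_apply, show s u = S.mulVec u from (LinearMap.toMatrix'_mulVec s u).symm,
      Matrix.mulVec_mulVec, hc, Matrix.one_mulVec]
  have hl : ∀ (c : Matrix (Fin (n - k)) (Fin n) K) (ψ : Matrix (Fin m) (Fin (n - k)) K),
      c * S = 1 → l (ψ * c) = ψ i j := by
    intro c ψ hc
    rw [sectionEntry_apply, Matrix.mul_assoc, hc, Matrix.mul_one]
  have hne : ∀ ψ : Matrix (Fin m) (Fin (n - k)) K, ψ i j = 1 → ψ ≠ 0 := by
    rintro ψ h rfl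
    exact zero_ne_one h
  have hfwd : ∀ q ∈ U, L (quotientMatrix s (incidenceRho K q),
      matrixNormalize l (incidencePhi q) * S) = w := by
    rintro q ⟨h1, h2⟩
    refine (hL _).2 ⟨quotientMatrix_mul_section h1, ?_⟩
    exact (sectionEntry_apply s i j _).symm.trans (apply_projNormalize h2)
  have hbwd : ∀ (c : Matrix (Fin (n - k)) (Fin n) K) (ψ : Matrix (Fin m) (Fin (n - k)) K)
      (hc : c * S = 1) (hψ : ψ i j = 1),
      incidenceOfFactors hk c ψ (range_eq_top_of_mul_eq_one hc) (hne ψ hψ) ∈ U := by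
    intro c ψ hc hψ
    refine ⟨mem_quotientChart_of_ker (c := c.mulVecLin) rfl (hcs c hc), ?_⟩
    have hM := mul_ne_zero_of_range_eq_top (range_eq_top_of_mul_eq_one hc) (hne ψ hψ)
    obtain ⟨a, ha, hrep⟩ := exists_projRep_projPoint (K := K) (ψ * c) hM
    change l (matrixRep (matrixPoint (ψ * c) hM)) ≠ 0
    rw [show matrixRep (matrixPoint (ψ * c) hM) = a • (ψ * c) from hrep, map_smul, hl c ψ hc, hψ,
      smul_eq_mul, mul_one]
    exact ha
  let e : (incidenceVariety K m n k).restrict U ≃ (affineSpace K V).restrict {v : V | L v = w} :=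
    { toFun := fun q => ⟨_, hfwd q.1 q.2⟩
      invFun := fun x => ⟨_, hbwd _ _ ((hL _).1 x.2).1 ((hL _).1 x.2).2⟩
      left_inv := by
        rintro ⟨q, hq1, hq2⟩
        refine Subtype.ext (incidence_ext (subspace_injective ?_) ?_)
        · change LinearMap.ker (quotientMatrix s (incidenceRho K q)).mulVecLin = _
          rw [mulVecLin_quotientMatrix, ker_quotientCoord hq1]
        · conv_rhs => rw [← matrixPoint_matrixNormalize hq2]
          change matrixPoint (matrixNormalize l (incidencePhi q) * S *
            quotientMatrix s (incidenceRho K q)) _ = _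
          congr 1
          refine mul_section_mul_quotientMatrix hq1 ?_
          rw [ker_matrixNormalize hq2]
          exact subspace_incidenceRho_le q
      right_inv := by
        rintro ⟨⟨c, ψ⟩, hx⟩
        obtain ⟨hc, hψ⟩ := (hL _).1 hx
        refine Subtype.ext (Prod.ext ?_ ?_)
        · change LinearMap.toMatrix' (quotientCoord s (kerPoint hk c (range_eq_top_of_mul_eq_one hc))) = c
          rw [quotientCoord_eq_of_ker (c := c.mulVecLin) rfl (hcs c hc), ← Matrix.toLin'_apply',
            LinearMap.toMatrix'_toLin']
        · change matrixNormalize l (matrixPoint (ψ * c)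
            (mul_ne_zero_of_range_eq_top (range_eq_top_of_mul_eq_one hc) (hne ψ hψ))) * S = ψ
          have hψ' : ψ i j = 1 := hψ
          rw [matrixNormalize_matrixPoint, hl c ψ hc, hψ', inv_one, one_smul, Matrix.mul_assoc, hc,
            Matrix.mul_one] }
  have he : IsIsomorphism e := by
    constructor
    · refine isMorphism_iff.2 fun q => morphAt_restrict_iff.2 ?_
      have h1 := (isMorphism_incidenceRho.morphAt q.1).restrict
      have h2 := (isMorphism_incidencePhi.morphAt q.1).restrict
      exact morphAt_affineSpace_prod
        (morphAt_matrix fun a b => h1.regAt (regAt_quotientMatrix q.2.1 a b))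
        (morphAt_matrix (regAt_matrix_mul (fun a b => h2.regAt (regAt_matrixNormalize q.2.2 a b))
          (N := fun _ => S) fun _ _ => SpaceWithFunctions.regAt_const _ _ _))
    · refine isMorphism_iff.2 fun x => morphAt_restrict_iff.2 ?_
      have hx := (isMorphism_val (X := affineSpace K V) {v : V | L v = w}).morphAt x
      exact morphAt_incidenceOfFactors hk
        (Z := (affineSpace K V).restrict {v : V | L v = w})
        (C := fun z => (show V from z.1).1) (Ψ := fun z => (show V from z.1).2)
        (fun z => range_eq_top_of_mul_eq_one ((hL _).1 z.2).1)
        (fun z => hne _ ((hL _).1 z.2).2)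
        (fun a b => hx.regAt (regAt_dual
          (Matrix.entryLinearMap K K a b ∘ₗ LinearMap.fst K _ _ : Module.Dual K V) x.1))
        (fun a b => hx.regAt (regAt_dual
          (Matrix.entryLinearMap K K a b ∘ₗ LinearMap.snd K _ _ : Module.Dual K V) x.1))
  obtain ⟨d, e', he'⟩ := exists_isIsomorphism_affineSubspace L (hfwd p ⟨hs, hij⟩)
  exact ⟨U, hU, ⟨hs, hij⟩, d, e.trans e', he.trans he'⟩

theorem isSmooth_incidenceVariety [Infinite K] (hk : k ≤ n) :
    IsSmooth (incidenceVariety K m n k) :=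
  isSmooth_of_charts (exists_chart_incidenceVariety hk)

theorem isVariety_incidenceVariety [Infinite K] (hkn : k < n) (hm : 0 < m) :
    IsVariety (incidenceVariety K m n k) := by
  obtain ⟨h1, h2⟩ := compactSpace_and_irreducibleSpace_incidenceVariety (K := K) hkn hm
  refine ⟨⟨h1, fun p => ?_⟩, ?_, h2⟩
  · obtain ⟨U, hU, hp, d, e, he⟩ := exists_chart_incidenceVariety hkn.le p
    exact ⟨U, hU, hp, (isAffineVariety_affineSpace_pi d).of_isIsomorphism he⟩
  · exact (isSeparated_grassmannian.prod isSeparated_matrixSpace).restrict _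

end Incidence

/-! ### Closed subsets of projective spaces -/

theorem eventually_ne_zero {V : Type u} [AddCommGroup V] [Module K V] {v : V} (hv : v ≠ 0) :
    ∀ᶠ w in @nhds _ (affineSpace K V).top v, (show V from w) ≠ 0 := by
  obtain ⟨l, hl⟩ : ∃ l : Module.Dual K V, l v ≠ 0 := by
    by_contra! h
    exact hv ((Module.forall_dual_apply_eq_zero_iff K _).1 h)
  have := (affineSpace K V).regAt_ne_zero _ v (regAt_dual l v) hl
  refine Eventually.mono this fun w hw h => hw ?_
  exact (congrArg l h).trans (map_zero l)

/-- The part of `T` where `l` does not vanish is a closed subset of the affine hyperplane `l = 1`.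
-/
theorem exists_isAffineVariety_of_isClosed {V : Type u} [AddCommGroup V] [Module K V]
    [FiniteDimensional K V] {T : Set (projectiveSpace K V)} (hT : IsClosed T)
    (p : (projectiveSpace K V).restrict T) :
    ∃ U, IsOpen U ∧ p ∈ U ∧ IsAffineVariety (((projectiveSpace K V).restrict T).restrict U) := by
  classical
  obtain ⟨l, hl⟩ := exists_dual_projRep_ne_zero p.1
  -- The value at zero is a dummy, since only vectors with `l v = 1` matter.
  let g : V → projectiveSpace K V := fun v => if h : v ≠ 0 then projPoint v h else p.1
  have hg : ∀ v (h : v ≠ 0), g v = projPoint v h := fun v h => dif_pos h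
  have hg' : ∀ v : V, v ≠ 0 → MorphAt (X := affineSpace K V) (Y := projectiveSpace K V) g v :=
    fun v hv => morphAt_projectiveSpace (F := fun v : V => v) (morphAt_id _)
      ((eventually_ne_zero hv).mono fun w hw => ⟨(hw : (show V from w) ≠ 0), hg w hw⟩)
  have hne : ∀ v : V, l v = 1 → v ≠ 0 := by
    rintro _ h rfl
    rw [map_zero] at h
    exact zero_ne_one h
  let S : Set (affineSpace K V) := {v : V | l v = 1 ∧ g v ∈ T}
  have hS : IsClosed S := by
    rw [← isOpen_compl_iff, isOpen_iff_mem_nhds]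
    intro v hv
    by_cases h1 : l v = 1
    · have h2 : ∀ᶠ x in 𝓝 (g v), x ∈ Tᶜ := hT.isOpen_compl.mem_nhds fun h => hv ⟨h1, h⟩
      filter_upwards [(hg' v (hne v h1)).eventually h2] with w hw h
      exact hw h.2
    · have := (affineSpace K V).regAt_ne_zero _ v (regAt_sub (regAt_dual l v)
        ((affineSpace K V).regAt_const 1 v)) (sub_ne_zero.2 h1)
      filter_upwards [this] with w hw h
      exact hw (sub_eq_zero.2 h.1)
  let U : Set ((projectiveSpace K V).restrict T) := {q | l (projRep q.1) ≠ 0}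
  have hU : IsOpen U := (isOpen_projRep_ne_zero l).preimage continuous_subtype_val
  have hgU : ∀ v : V, l v = 1 → l (projRep (g v)) ≠ 0 := by
    intro v hv
    obtain ⟨c, hc, h⟩ := exists_projRep_projPoint (K := K) v (hne v hv)
    rw [hg v (hne v hv), h, map_smul, hv, smul_eq_mul, mul_one]
    exact hc
  have hgn : ∀ q : projectiveSpace K V, l (projRep q) ≠ 0 → g (projNormalize l q) = q :=
    fun q hq => (hg _ (projNormalize_ne_zero hq)).trans (projPoint_projNormalize hq)
  let e : ((projectiveSpace K V).restrict T).restrict U ≃ (affineSpace K V).restrict S :=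
    { toFun := fun q => ⟨projNormalize (V := V) l q.1.1, apply_projNormalize q.2,
        (congrArg (· ∈ T) (hgn _ q.2)).mpr q.1.2⟩
      invFun := fun v => ⟨⟨g v.1, v.2.2⟩, hgU _ v.2.1⟩
      left_inv := fun q => Subtype.ext (Subtype.ext (hgn _ q.2))
      right_inv := fun v => Subtype.ext (by
        have (v : V) (hv : l v = 1) : projNormalize l (g v) = v := by
          rw [hg v (hne v hv), projNormalize_projPoint, hv, inv_one, one_smul]
        exact this v.1 v.2.1) }
  have he : IsIsomorphism e := by
    constructor
    · refine isMorphism_iff.2 fun q => morphAt_restrict_iff.2 ?_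
      exact MorphAt.restrict (X := (projectiveSpace K V).restrict T) (Y := affineSpace K V)
        (φ := fun q => projNormalize (V := V) l q.1) ((morphAt_projNormalize q.2).restrict)
    · refine isMorphism_iff.2 fun v => morphAt_restrict_iff.2 (morphAt_restrict_iff.2 ?_)
      exact (hg' v.1 (hne _ v.2.1)).restrict
  exact ⟨U, hU, hl, (isAffineVariety_restrict_affineSpace hS).of_isIsomorphism he⟩

/-! ### The determinantal variety -/

section Determinantal

variable {m n k : ℕ}

theorem isVariety_detVariety [IsAlgClosed K] (hkn : k < n) (hm : 0 < m) :
    IsVariety (detVariety K m n k) := by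
  have := IsAlgClosed.instInfinite (K := K)
  obtain ⟨h1, h2⟩ := compactSpace_and_irreducibleSpace_incidenceVariety (K := K) hkn hm
  refine ⟨⟨?_, ?_⟩, isSeparated_matrixSpace.restrict _, ?_⟩
  · exact surjective_incidenceNu.compactSpace isMorphism_incidenceNu.1
  · exact exists_isAffineVariety_of_isClosed (V := Matrix (Fin m) (Fin n) K) isClosed_detLocus
  · exact surjective_incidenceNu.irreducibleSpace isMorphism_incidenceNu.1

theorem isProperMorphism_incidenceNu [IsAlgClosed K] :
    IsProperMorphism (incidenceNu K (m := m) (n := n) (k := k)) :=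
  (((isComplete_grassmannian k n).prod isComplete_matrixSpace).restrict
    isClosed_incidenceLocus).isProperMorphism
    ((isSeparated_grassmannian.prod isSeparated_matrixSpace).restrict _)
    (isSeparated_matrixSpace.restrict _) isMorphism_incidenceNu

/-- The kernel of a matrix depends regularly on the matrix, as long as its dimension does not
change. -/
theorem morphAt_matrixKer {Z : SpaceWithFunctions K} {f : Z → grassmannian K k n}
    {F : Z → Matrix (Fin m) (Fin n) K} {p : Z} (hF : ∀ i j, Z.RegAt (fun z => F z i j) p)
    (h : ∀ᶠ z in 𝓝 p, LinearMap.ker (F z).mulVecLin = subspace K (f z)) : MorphAt f p := by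
  have hk : k ≤ n := le_of_grassmannian (f p)
  have hrank : ∀ {r : ℕ} (A : Matrix (Fin r) (Fin n) K) (B : Matrix (Fin (n - k)) (Fin r) K),
      LinearMap.range (B * A).mulVecLin = ⊤ →
      Module.finrank K (LinearMap.ker (B * A).mulVecLin) = k := by
    intro r A B hBA
    have := LinearMap.finrank_range_add_finrank_ker (B * A).mulVecLin
    rw [hBA, finrank_top] at this
    simp only [Module.finrank_fintype_fun_eq_card, Fintype.card_fin] at this
    omega
  -- `B` maps the image of `F p` isomorphically to `Kⁿ⁻ᵏ`. Near `p` the product `B * F z` stays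
  -- surjective, so its kernel has dimension `k` and equals the kernel of `F z`, which it contains.
  -- This reduces to surjective matrices.
  obtain ⟨B, hB⟩ : ∃ B : Matrix (Fin (n - k)) (Fin m) K,
      LinearMap.range (B * F p).mulVecLin = ⊤ := by
    have h1 := LinearMap.finrank_range_add_finrank_ker (F p).mulVecLin
    rw [h.self_of_nhds, finrank_subspace] at h1
    simp only [Module.finrank_fintype_fun_eq_card, Fintype.card_fin] at h1
    have e : LinearMap.range (F p).mulVecLin ≃ₗ[K] (Fin (n - k) → K) := by
      refine LinearEquiv.ofFinrankEq _ _ ?_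
      simp only [Module.finrank_fintype_fun_eq_card, Fintype.card_fin]
      omega
    obtain ⟨g, hg⟩ := LinearMap.exists_extend e.toLinearMap
    refine ⟨LinearMap.toMatrix' g, ?_⟩
    rw [LinearMap.range_eq_top]
    intro u
    obtain ⟨⟨_, v, rfl⟩, hy⟩ := e.surjective u
    refine ⟨v, ?_⟩
    rw [Matrix.mulVecLin_apply, ← Matrix.mulVec_mulVec, LinearMap.toMatrix'_mulVec, ← hy]
    exact congrArg (fun f => f ⟨_, v, rfl⟩) hg
  have hreg := regAt_matrix_mul (M := fun _ => B) (fun _ _ => Z.regAt_const _ p) hF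
  refine morphAt_ker hreg ?_
  filter_upwards [h, eventually_range_eq_top hreg hB] with z h1 h2
  rw [← h1]
  refine (Submodule.eq_of_le_of_finrank_eq ?_ ?_).symm
  · intro v hv
    rw [LinearMap.mem_ker, Matrix.mulVecLin_apply] at hv ⊢
    rw [← Matrix.mulVec_mulVec, hv, Matrix.mulVec_zero]
  · rw [hrank _ _ h2, h1, finrank_subspace]

/-- For `c` surjective and `ψ` injective, `ψ c` has the kernel of `c`. The assumption `n ≤ m` leaves
room for an injective `ψ` with `n - k` columns. -/
theorem exists_finrank_matrixKer_eq (hk : k < n) (hnm : n ≤ m) :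
    ∃ q : incidenceVariety K m n k, Module.finrank K (matrixKer K (incidencePhi q)) = k := by
  obtain ⟨c, hc⟩ := exists_range_eq_top (K := K) k n
  obtain ⟨ψ, hψ⟩ := exists_injective_matrix (K := K) (show n - k ≤ m by omega)
  have hψ0 : ψ ≠ 0 := by
    rintro rfl
    rw [Matrix.mulVecLin_zero, LinearMap.ker_zero] at hψ
    have : Nonempty (Fin (n - k)) := ⟨⟨0, by omega⟩⟩
    exact top_ne_bot hψ
  refine ⟨incidenceOfFactors hk.le c ψ hc hψ0, ?_⟩
  have : matrixKer K (incidencePhi (incidenceOfFactors hk.le c ψ hc hψ0)) =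
      subspace K (kerPoint hk.le c hc) := by
    refine (matrixKer_matrixPoint _ _).trans ?_
    rw [Matrix.mulVecLin_mul, LinearMap.ker_comp, hψ]
    rfl
  rw [this, finrank_subspace]

theorem isBirationalMorphism_incidenceNu [IsAlgClosed K] (hk : k < n) (hnm : n ≤ m) :
    IsBirationalMorphism (incidenceNu K (m := m) (n := n) (k := k)) := by
  have := IsAlgClosed.instInfinite (K := K)
  obtain ⟨-, hX⟩ := compactSpace_and_irreducibleSpace_incidenceVariety (K := K) hk
    (show 0 < m by omega)
  have hY := (isVariety_detVariety (K := K) hk (show 0 < m by omega)).2.2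
  obtain ⟨q, hq⟩ := exists_finrank_matrixKer_eq (K := K) hk hnm
  let V : Set (detVariety K m n k) := {y | Module.finrank K (matrixKer K y.1) = k}
  have hV : IsOpen V := by
    -- On the determinantal variety, kernel dimension exactly `k` means not belonging to the closed
    -- locus for `k + 1`.
    have : V = (fun y : detVariety K m n k => y.1) ⁻¹' (detLocus K m n (k + 1))ᶜ := by
      ext y
      have hy : k ≤ Module.finrank K (matrixKer K y.1) := y.2
      change Module.finrank K (matrixKer K y.1) = k ↔ ¬ k + 1 ≤ Module.finrank K (matrixKer K y.1)
      omega
    rw [this]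
    exact isClosed_detLocus.isOpen_compl.preimage continuous_subtype_val
  let U : Set (incidenceVariety K m n k) := incidenceNu K ⁻¹' V
  have hU : IsOpen U := hV.preimage isMorphism_incidenceNu.1
  -- Equal dimensions turn `Λ ⊆ ker φ` into an equality, so that `φ ↦ (ker φ, φ)` is inverse to `ν`
  -- over `V`.
  have hker : ∀ x ∈ U, subspace K (incidenceRho K x) = matrixKer K (incidencePhi x) := by
    intro x hx
    have hx' : Module.finrank K (matrixKer K (incidencePhi x)) = k := hx
    exact Submodule.eq_of_le_of_finrank_eq (subspace_incidenceRho_le x)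
      ((finrank_subspace _).trans hx'.symm)
  let κ : (detVariety K m n k).restrict V → grassmannian K k n := fun y => ⟨matrixKer K y.1.1, y.2⟩
  let e : (incidenceVariety K m n k).restrict U ≃ (detVariety K m n k).restrict V :=
    { toFun := fun x => ⟨incidenceNu K x.1, x.2⟩
      invFun := fun y => ⟨incidencePoint (κ y) y.1.1 le_rfl, y.2⟩
      left_inv := fun x => Subtype.ext (incidence_ext (subspace_injective (hker _ x.2).symm) rfl)
      right_inv := fun _ => rfl }
  refine ⟨isMorphism_incidenceNu, U, V, hU, hU.dense ⟨q, hq⟩, hV,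
    hV.dense ⟨incidenceNu K q, hq⟩, e, ⟨?_, ?_⟩, fun _ => rfl⟩
  · exact isMorphism_iff.2 fun x =>
      morphAt_restrict_iff.2 (isMorphism_incidenceNu.morphAt x.1).restrict
  · refine isMorphism_iff.2 fun y => morphAt_restrict_iff.2 ?_
    have hval : MorphAt (X := (detVariety K m n k).restrict V) (Y := matrixSpace K m n)
        (fun y => y.1.1) y :=
      ((isMorphism_val (X := matrixSpace K m n) _).morphAt y.1).restrict
    refine morphAt_incidenceVariety ?_ hval
    obtain ⟨l, hl⟩ := exists_dual_matrixRep_ne_zero y.1.1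
    refine morphAt_matrixKer (f := κ) (F := fun z => matrixNormalize l z.1.1)
      (fun i j => hval.regAt (regAt_matrixNormalize hl i j)) ?_
    filter_upwards [hval.eventually ((isOpen_matrixRep_ne_zero l).mem_nhds hl)] with z hz
    exact ker_matrixNormalize hz

end Determinantal

/-! ### The incidence variety as a projective bundle -/

section ProjectiveBundle

variable {m n k : ℕ}

/-- The matrix whose rows are the linear forms on `Kⁿ` induced by linear forms on `Kⁿ / Λ`. -/
def dualMatrix (m : ℕ) (Λ : grassmannian K k n) :
    (Fin m → Module.Dual K ((Fin n → K) ⧸ subspace K Λ)) →ₗ[K] Matrix (Fin m) (Fin n) K where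
  toFun α := Matrix.of fun i j => α i ((subspace K Λ).mkQ (Pi.single j 1))
  map_add' _ _ := rfl
  map_smul' _ _ := rfl

theorem dualMatrix_mulVec (Λ : grassmannian K k n)
    (α : Fin m → Module.Dual K ((Fin n → K) ⧸ subspace K Λ)) (v : Fin n → K) :
    (dualMatrix m Λ α).mulVec v = fun i => α i ((subspace K Λ).mkQ v) := by
  funext i
  have := LinearMap.pi_apply_eq_sum_univ (α i ∘ₗ (subspace K Λ).mkQ) v
  rw [LinearMap.comp_apply] at this
  rw [this]
  simp only [Matrix.mulVec, dotProduct, smul_eq_mul]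
  refine Finset.sum_congr rfl fun j _ => ?_
  rw [mul_comm]
  congr 2
  have : (fun i => if j = i then (1 : K) else 0) = Pi.single j 1 := by
    ext i
    simp [Pi.single_apply, eq_comm]
  simp [this, dualMatrix]

theorem dualMatrix_injective (Λ : grassmannian K k n) :
    Function.Injective (dualMatrix m Λ) := by
  intro α β h
  funext i
  refine LinearMap.ext fun y => ?_
  obtain ⟨v, rfl⟩ := Submodule.mkQ_surjective _ y
  have := congrFun (dualMatrix_mulVec Λ α v) i
  rw [h, dualMatrix_mulVec] at this
  exact this.symm

theorem subspace_le_ker_dualMatrix (Λ : grassmannian K k n)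
    (α : Fin m → Module.Dual K ((Fin n → K) ⧸ subspace K Λ)) :
    subspace K Λ ≤ LinearMap.ker (dualMatrix m Λ α).mulVecLin := by
  intro v hv
  rw [LinearMap.mem_ker, Matrix.mulVecLin_apply, dualMatrix_mulVec]
  funext i
  rw [(Submodule.mkQ_apply _ v).trans ((Submodule.Quotient.mk_eq_zero _).2 hv), map_zero]
  rfl

theorem exists_dualMatrix_eq {Λ : grassmannian K k n} {M : Matrix (Fin m) (Fin n) K}
    (h : subspace K Λ ≤ LinearMap.ker M.mulVecLin) : ∃ α, dualMatrix m Λ α = M := by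
  refine ⟨fun i => LinearMap.proj i ∘ₗ (subspace K Λ).liftQ M.mulVecLin h, ?_⟩
  ext i j
  change ((subspace K Λ).liftQ M.mulVecLin h ((subspace K Λ).mkQ (Pi.single j 1))) i = _
  rw [Submodule.mkQ_apply, Submodule.liftQ_apply, Matrix.mulVecLin_apply,
    Matrix.mulVec_single_one, Matrix.col_apply]

/-- The first factor consists of the bundle coordinates of `α` in the frame of `s`, and the second
is regular in `Λ`. This factorization is what makes both directions of the isomorphism regular. -/
theorem dualMatrix_eq_mul_quotientMatrix {Λ : grassmannian K k n}
    {s : (Fin (n - k) → K) →ₗ[K] (Fin n → K)} (h : Λ ∈ quotientChart K s)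
    (α : Fin m → Module.Dual K ((Fin n → K) ⧸ subspace K Λ)) :
    dualMatrix m Λ α = Matrix.of (fun i c => α i (frameOfQuotient K s Λ (Pi.single c 1))) *
      quotientMatrix s Λ := by
  have : dualMatrix m Λ α * LinearMap.toMatrix' s =
      Matrix.of (fun i c => α i (frameOfQuotient K s Λ (Pi.single c 1))) := by
    refine Matrix.ext_of_mulVec_single fun c => ?_
    rw [← Matrix.mulVec_mulVec, LinearMap.toMatrix'_mulVec, dualMatrix_mulVec,
      Matrix.mulVec_single_one]
    rfl
  rw [← this, mul_section_mul_quotientMatrix h (subspace_le_ker_dualMatrix Λ α)]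

variable (K k n m)

/-- The bundle `Q^{∨m}`. -/
noncomputable abbrev dualPower : VectorBundle (grassmannian K k n) :=
  (universalQuotient K k n).dual.power m

variable {K k n m}

/-- The point of the incidence variety given by a line in a fibre of `Q^{∨m}`. -/
noncomputable def incidenceOfLine (p : (dualPower K m n k).projectivization) :
    incidenceVariety K m n k :=
  incidencePoint p.1 (Projectivization.map (dualMatrix m p.1) (dualMatrix_injective p.1) p.2) (by
    obtain ⟨Λ, p⟩ := p
    induction p using Projectivization.ind with
    | h α hα =>
      refine le_of_le_of_eq (subspace_le_ker_dualMatrix Λ α) ?_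
      exact (matrixKer_matrixPoint (dualMatrix m Λ α) fun h =>
        hα (dualMatrix_injective Λ (h.trans (map_zero _).symm))).symm)

/-- The matrices that vanish on `Λ` are those whose rows come from linear forms on `Kⁿ / Λ`,
uniquely, so the map is bijective on each fibre over the Grassmannian. -/
theorem bijective_incidenceOfLine :
    Function.Bijective (incidenceOfLine : _ → incidenceVariety K m n k) := by
  constructor
  · rintro ⟨Λ, p⟩ ⟨Λ', p'⟩ h
    obtain rfl : Λ = Λ' := congrArg (incidenceRho K) h
    have : Projectivization.map (dualMatrix m Λ) (dualMatrix_injective Λ) p =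
        Projectivization.map (dualMatrix m Λ) (dualMatrix_injective Λ) p' :=
      congrArg incidencePhi h
    exact congrArg (Sigma.mk Λ) (Projectivization.map_injective _ (dualMatrix_injective Λ) this)
  · intro q
    obtain ⟨α, hα⟩ := exists_dualMatrix_eq ((subspace_incidenceRho_le q).trans_eq
      (matrixKer_eq_ker_matrixRep _))
    have hα0 : α ≠ 0 := by
      rintro rfl
      exact matrixRep_ne_zero (incidencePhi q) (hα.symm.trans (map_zero _))
    refine ⟨⟨incidenceRho K q, Projectivization.mk K α hα0⟩, incidence_ext rfl ?_⟩
    conv_rhs => rw [← matrixPoint_matrixRep (incidencePhi q)]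
    change matrixPoint (dualMatrix m (incidenceRho K q) α) _ = _
    congr 1

/-- The chart of `ℙ(Q^{∨m})` given by `s`. -/
noncomputable def bundleChart (s : (Fin (n - k) → K) →ₗ[K] (Fin n → K))
    (x : prod ((grassmannian K k n).restrict (quotientChart K s))
      (projectiveSpace K (Fin m × Fin (n - k) → K))) : (dualPower K m n k).projectivization :=
  ⟨(fst x).1, Projectivization.map ((dualPower K m n k).triv s (fst x).1 (fst x).2).symm.toLinearMap
    (LinearEquiv.injective _) (snd x)⟩

theorem morphAt_bundleChart (s : (Fin (n - k) → K) →ₗ[K] (Fin n → K))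
    (x : prod ((grassmannian K k n).restrict (quotientChart K s))
      (projectiveSpace K (Fin m × Fin (n - k) → K))) : MorphAt (bundleChart s) x :=
  morphAt_final (X := fun i : (dualPower K m n k).chart =>
    prod ((grassmannian K k n).restrict ((dualPower K m n k).base i))
      (projectiveSpace K ((dualPower K m n k).idx → K)))
    (Y := Σ Λ, ℙ K ((dualPower K m n k).fiber Λ))
    (fun i q => ⟨(fst q).1, Projectivization.map
      ((dualPower K m n k).triv i (fst q).1 (fst q).2).symm.toLinearMap
        (LinearEquiv.injective _) (snd q)⟩) s x

/-- The matrix with entries `w (i, c)`. -/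
def curryMatrix (w : Fin m × Fin (n - k) → K) : Matrix (Fin m) (Fin (n - k)) K :=
  Matrix.of fun i c => w (i, c)

theorem curryMatrix_mul_quotientMatrix_ne_zero {Λ : grassmannian K k n}
    {s : (Fin (n - k) → K) →ₗ[K] (Fin n → K)} (h : Λ ∈ quotientChart K s)
    {w : Fin m × Fin (n - k) → K} (hw : w ≠ 0) : curryMatrix w * quotientMatrix s Λ ≠ 0 := by
  refine mul_ne_zero_of_range_eq_top (range_eq_top_of_mul_eq_one (quotientMatrix_mul_section h)) ?_
  intro h0
  exact hw (funext fun a => congrFun (congrFun h0 a.1) a.2)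

theorem incidencePhi_bundleChart {s : (Fin (n - k) → K) →ₗ[K] (Fin n → K)}
    (Λ : (grassmannian K k n).restrict (quotientChart K s)) {w : Fin m × Fin (n - k) → K}
    (hw : w ≠ 0) :
    incidencePhi (incidenceOfLine (bundleChart s (pair Λ (projPoint w hw)))) =
      matrixPoint (curryMatrix w * quotientMatrix s Λ.1)
        (curryMatrix_mul_quotientMatrix_ne_zero Λ.2 hw) := by
  let α : Fin m → Module.Dual K ((Fin n → K) ⧸ subspace K Λ.1) :=
    ((dualPower K m n k).triv s Λ.1 Λ.2).symm w
  have hα : (dualPower K m n k).triv s Λ.1 Λ.2 α = w := LinearEquiv.apply_symm_apply _ _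
  have hα' : Matrix.of (fun i c => α i (frameOfQuotient K s Λ.1 (Pi.single c 1))) =
      curryMatrix w := by
    ext i c
    exact congrFun hα (i, c)
  have h := dualMatrix_eq_mul_quotientMatrix (m := m) Λ.2 α
  rw [hα'] at h
  change matrixPoint (dualMatrix m Λ.1 α) _ = _
  congr 1

theorem morphAt_incidenceOfLine_bundleChart (s : (Fin (n - k) → K) →ₗ[K] (Fin n → K))
    (x : prod ((grassmannian K k n).restrict (quotientChart K s))
      (projectiveSpace K (Fin m × Fin (n - k) → K))) :
    MorphAt (fun x => incidenceOfLine (bundleChart s x)) x := by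
  have hfst : MorphAt (X := prod ((grassmannian K k n).restrict (quotientChart K s))
      (projectiveSpace K (Fin m × Fin (n - k) → K))) (Y := grassmannian K k n)
      (fun x => (fst x).1) x :=
    ((isMorphism_val (quotientChart K s)).morphAt (fst x)).comp (morphAt_fst x)
  refine morphAt_incidenceVariety hfst ?_
  obtain ⟨l, hl⟩ := exists_dual_projRep_ne_zero (snd x)
  have hsnd := (morphAt_projNormalize hl).comp (morphAt_snd x)
  refine morphAt_matrixSpace (F := fun x : prod ((grassmannian K k n).restrict (quotientChart K s))
      (projectiveSpace K (Fin m × Fin (n - k) → K)) =>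
    curryMatrix (projNormalize l (snd x)) * quotientMatrix s (fst x).1) (regAt_matrix_mul (fun i c => ?_)
      fun i j => hfst.regAt (regAt_quotientMatrix (fst x).2 i j)) ?_
  · exact hsnd.regAt_dual (LinearMap.proj (i, c))
  · filter_upwards [(morphAt_snd x).eventually ((isOpen_projRep_ne_zero l).mem_nhds hl)] with z hz
    refine ⟨curryMatrix_mul_quotientMatrix_ne_zero (fst z).2 (projNormalize_ne_zero hz), ?_⟩
    have := incidencePhi_bundleChart (m := m) (fst z) (projNormalize_ne_zero hz)
    rwa [projPoint_projNormalize hz] at this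

theorem isMorphism_incidenceOfLine :
    IsMorphism (incidenceOfLine : _ → incidenceVariety K m n k) :=
  isMorphism_of_final fun s => isMorphism_iff.2 fun x => morphAt_incidenceOfLine_bundleChart s x

/-- The isomorphism of the incidence variety with `ℙ(Q^{∨m})`. -/
noncomputable def incidenceEquiv :
    incidenceVariety K m n k ≃ (dualPower K m n k).projectivization :=
  (Equiv.ofBijective _ bijective_incidenceOfLine).symm

theorem incidenceOfLine_incidenceEquiv (q : incidenceVariety K m n k) :
    incidenceOfLine (incidenceEquiv q) = q :=
  (Equiv.ofBijective _ bijective_incidenceOfLine).apply_symm_apply q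

theorem projectivizationProj_incidenceEquiv (q : incidenceVariety K m n k) :
    (dualPower K m n k).projectivizationProj (incidenceEquiv q) = incidenceRho K q := by
  conv_rhs => rw [← incidenceOfLine_incidenceEquiv q]
  rfl

/-- The universal property of the glued structure concerns maps out of it, so the inverse is
factored locally through a chart: the bundle coordinates of `(Λ, φ)` are the entries of `M s`, for
the representative `M` of `φ` normalized by `l`. -/
theorem isMorphism_incidenceEquiv :
    IsMorphism (incidenceEquiv : incidenceVariety K m n k → _) := by
  refine isMorphism_iff.2 fun p => ?_
  obtain ⟨s, hs⟩ := exists_mem_quotientChart (incidenceRho K p)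
  obtain ⟨l, hl⟩ := exists_dual_matrixRep_ne_zero (incidencePhi p)
  let U : Set (incidenceVariety K m n k) :=
    {q | incidenceRho K q ∈ quotientChart K s ∧ l (matrixRep (incidencePhi q)) ≠ 0}
  have hU : IsOpen U := ((isOpen_quotientChart s).preimage isMorphism_incidenceRho.1).inter
    ((isOpen_matrixRep_ne_zero l).preimage isMorphism_incidencePhi.1)
  let w : incidenceVariety K m n k → Fin m × Fin (n - k) → K := fun q a =>
    (matrixNormalize l (incidencePhi q) * LinearMap.toMatrix' s) a.1 a.2
  have hwq : ∀ q ∈ U, curryMatrix (w q) * quotientMatrix s (incidenceRho K q) =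
      matrixNormalize l (incidencePhi q) := fun q hq =>
    mul_section_mul_quotientMatrix hq.1
      ((subspace_incidenceRho_le q).trans_eq (ker_matrixNormalize hq.2).symm)
  have hw0 : ∀ q ∈ U, w q ≠ 0 := by
    intro q hq h
    have h1 := hwq q hq
    rw [show curryMatrix (w q) = 0 by rw [h]; rfl, Matrix.zero_mul] at h1
    exact matrixNormalize_ne_zero hq.2 h1.symm
  refine morphAt_of_restrict hU (show p ∈ U from ⟨hs, hl⟩) ?_
  let G : (incidenceVariety K m n k).restrict U →
      prod ((grassmannian K k n).restrict (quotientChart K s))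
        (projectiveSpace K (Fin m × Fin (n - k) → K)) := fun q =>
    pair ⟨incidenceRho K q.1, q.2.1⟩ (projPoint (w q.1) (hw0 q.1 q.2))
  have hG : ∀ q, incidenceEquiv q.1 = bundleChart s (G q) := by
    intro q
    refine bijective_incidenceOfLine.1 ?_
    rw [incidenceOfLine_incidenceEquiv]
    refine incidence_ext rfl ?_
    refine Eq.trans ?_ (incidencePhi_bundleChart ⟨incidenceRho K q.1, q.2.1⟩ (hw0 q.1 q.2)).symm
    conv_lhs => rw [← matrixPoint_matrixNormalize q.2.2]
    congr 1
    exact (hwq q.1 q.2).symm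
  have hGm : MorphAt G ⟨p, hs, hl⟩ := by
    refine MorphAt.pair ?_ ?_
    · exact morphAt_restrict_iff.2
        (MorphAt.restrict (φ := incidenceRho K) (isMorphism_incidenceRho.morphAt p))
    · refine morphAt_projectiveSpace (F := fun q : (incidenceVariety K m n k).restrict U => w q.1)
        (morphAt_pi fun a => ?_)
        (Eventually.of_forall fun q => ⟨hw0 q.1 q.2, rfl⟩)
      have h2 := ((isMorphism_incidencePhi.morphAt p).restrict (S := U) (p := ⟨p, hs, hl⟩))
      exact regAt_matrix_mul (fun i j => h2.regAt (regAt_matrixNormalize hl i j))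
        (N := fun _ => LinearMap.toMatrix' s) (fun _ _ => SpaceWithFunctions.regAt_const _ _ _) a.1 a.2
  exact ((morphAt_bundleChart s _).comp hGm).congr (Eventually.of_forall fun q => (hG q).symm)

theorem isIsomorphism_incidenceEquiv :
    IsIsomorphism (incidenceEquiv : incidenceVariety K m n k ≃ _) :=
  ⟨isMorphism_incidenceEquiv, isMorphism_incidenceOfLine⟩

end ProjectiveBundle

end SpaceWithFunctions

/-! ### Assembly of the theorem -/

theorem mainTheorem9 (K : Type u) [Field K] [IsAlgClosed K] [CharZero K] (m n k : ℕ)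
    (hnm : n ≤ m) (hkn : k < n) :
    IsClosed (SpaceWithFunctions.detLocus K m n k) ∧
    IsClosed (SpaceWithFunctions.incidenceLocus K m n k) ∧
    (∃ e : SpaceWithFunctions.incidenceVariety K m n k ≃
        ((SpaceWithFunctions.universalQuotient K k n).dual.power m).projectivization,
      SpaceWithFunctions.IsIsomorphism e ∧
      ∀ q, ((SpaceWithFunctions.universalQuotient K k n).dual.power m).projectivizationProj (e q) =
        SpaceWithFunctions.incidenceRho K q) ∧
    SpaceWithFunctions.IsSmooth (SpaceWithFunctions.incidenceVariety K m n k) ∧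
    SpaceWithFunctions.IsBirationalMorphism
      (SpaceWithFunctions.incidenceNu K (m := m) (n := n) (k := k)) ∧
    SpaceWithFunctions.IsResolutionOfSingularities
      (SpaceWithFunctions.incidenceNu K (m := m) (n := n) (k := k)) := by
  have := IsAlgClosed.instInfinite (K := K)
  have hm : 0 < m := by omega
  have hs := SpaceWithFunctions.isSmooth_incidenceVariety (K := K) (m := m) hkn.le
  have hb := SpaceWithFunctions.isBirationalMorphism_incidenceNu (K := K) hkn hnm
  exact ⟨SpaceWithFunctions.isClosed_detLocus, SpaceWithFunctions.isClosed_incidenceLocus,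
    ⟨SpaceWithFunctions.incidenceEquiv, SpaceWithFunctions.isIsomorphism_incidenceEquiv,
      SpaceWithFunctions.projectivizationProj_incidenceEquiv⟩, hs, hb,
    SpaceWithFunctions.isVariety_incidenceVariety hkn hm,
    SpaceWithFunctions.isVariety_detVariety hkn hm, hs,
    SpaceWithFunctions.isProperMorphism_incidenceNu, hb⟩
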